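/- Let $G_{n,p}$ be the binomial random graph on $n$ vertices, in which each pair of vertices is joined by an edge independently with probability $p$. Let $T(G)$ be the maximum number of vertices of an induced subgraph of $G$ that is a tree, and let $X_k$ be the number of $k$-element vertex sets that induce a tree in $G_{n,p}$. An event holds whp if its probability tends to $1$ as $n\to\infty$; $f\ll g$ and $f=o(g)$ mean $f/g\to 0$, and $f=\omega(g)$ means $g=o(f)$, as $n\to\infty$. There exists an integer-valued function $k_0=k_0(n,p)$ such that, for every sequence $p=p(n)\in[0,1]$ with $\frac1n\ll p\ll\frac1{\ln^2 n}$, the following hold. (i) For all sufficiently large $n$, the largest value of $k$ such that $\mathbb{E}[X_k]\ge 1$ exists and is either $k_0$ or $k_0+1$. (ii) If $p=\omega\left(n^{-1/2}\ln^{3/2}n\right)$, then $T(G_{n,p})\in\{k_0,k_0+1\}$ whp. (iii) If $p=o\left(n^{-1/2}\right)$, then $T(G_{n,p})<k_0-\frac{1}{4np^2}$ whp. -/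

import Mathlib

open Filter Topology MeasureTheory Asymptotics
open scoped unitInterval

namespace InducedTree

noncomputable section

open scoped Classical in
/-- The vertex sets `A` for which the induced subgraph `G[A]` is a tree. -/
def inducedTrees {V : Type*} [Fintype V] (G : SimpleGraph V) : Finset (Finset V) :=
  Finset.univ.filter fun A => (G.induce (A : Set V)).IsTree

/-- `T(G)`: the maximum number of vertices of an induced tree of `G`
(a tree is nonempty, so the value is `0` only for the graph without vertices). -/
def maxInducedTree {V : Type*} [Fintype V] (G : SimpleGraph V) : ℕ :=
  (inducedTrees G).sup Finset.card

/-- `X_k`: the number of induced trees of `G` on exactly `k` vertices. -/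
def inducedTreeCount {V : Type*} [Fintype V] (k : ℕ) (G : SimpleGraph V) : ℕ :=
  ((inducedTrees G).filter fun A => A.card = k).card

/-- `𝔼[X_k]` in the binomial random graph on `n` vertices with edge probability `p`. -/
def expectedCount (n : ℕ) (p : I) (k : ℕ) : ℝ :=
  ∫ G, (inducedTreeCount k G : ℝ) ∂(SimpleGraph.binomialRandom (Fin n) p)

/-- The property `P` of graphs on `n` vertices holds with high probability in the binomial
random graph with edge probabilities `p n`, as `n → ∞`. -/
def Whp (p : ℕ → I) (P : (n : ℕ) → SimpleGraph (Fin n) → Prop) : Prop :=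
  Tendsto (fun n => SimpleGraph.binomialRandom (Fin n) (p n) {G | P n G}) atTop (𝓝 1)

end

end InducedTree

/-! Put x = np, which tends to infinity, and let μ_k = C(n,k) k^(k-2) p^(k-1) (1-p)^C(k-1,2) be the
mean number of induced trees on k ≥ 1 vertices (Cayley: `card_treesOn`). Let K = `threshold` be the
largest k with μ_k ≥ 1. Elementary bounds on C(n,k) show that (1-p)^K is of order x⁻², so Kp is
about 2 log x, and close to K each increase of k by one divides μ_k by a factor of order x. Put k₀ =
`lowThreshold`, equal to K if μ_(K+1) ≥ x^(-1/2) and to K - 1 otherwise. This choice makes μ_(k₀) at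
least a constant times √x (`sqrt_le_meanTrees_lowThreshold`), while the sum of μ_k over k ≥ k₀ + 2
is O(x^(-1/2)) (`sum_meanTrees_lowThreshold_le`). This gives (i), and by the first moment T ≤ k₀ + 1
whp.

The lower bound in (ii) is a second moment argument for good trees, whose outside vertices all have
at least four neighbours in the tree. A tree fails to be good with conditional probability
O((kp)³/(np²)), which tends to 0 exactly because of the hypothesis p = ω(n^(-1/2) log^(3/2) n).
Goodness pays off for overlapping pairs. Let A, B be good of size k, let S be their intersection, of
size l, let r = k - l, and let S span a forest with c components. Then B \ A receives at least 4r
edges from A, and at most r + c - 1 of them come from S, so at least 3r + 1 - c edges run between A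
\ B and B \ A. These pairs are independent of everything inside A and inside B
(`pr_isGoodTree_pair_le`). The extra factor controls the pairs with small r.

The number of pairs of trees that agree on S comes from counting the trees that extend a given
forest (`card_trees_extending_le`) and from a Beta-sum bound for the number of forests
(`blockSum_le_forestBound`). Relative to μ = μ_(k₀), the pairs with l ≤ 31k/32 contribute at most μ²
ε^l (`overlap_far_le`, `far_base_le`) and the others at most μ ε^r (`near_le`), where ε tends to 0.
Both series are geometric, so the second moment is (1 + o(1)) μ².

For (iii), a largest induced tree has no outside vertex with exactly one neighbour in it, since such
a vertex could be added as a leaf. The first moment can therefore be taken over maximal trees only.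
With s = 1/(4np²) and L = log x this costs a factor exp(-n·kp(1-p)^(k-1)), which is below exp(-1.05
sL) for k near K, whereas μ_k for K - 1 - s ≤ k ≤ K + 1 is at most exp((s+2)(L+5)). The product is
tiny (`pr_le_of_sparse`). -/

namespace InducedTree

noncomputable section

open Finset
set_option linter.unusedSectionVars false
set_option linter.unusedDecidableInType false
set_option linter.unusedFintypeInType false

section

variable {V : Type*} [Fintype V] [DecidableEq V]

/-! ### The binomial random graph as a finite weighted sum -/

/-- The pairs of distinct elements of `A`. -/
def pairsIn {V : Type*} [DecidableEq V] (A : Finset V) : Finset (Sym2 V) :=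
  A.sym2.filter fun e => ¬ e.IsDiag

lemma mem_pairsIn {V : Type*} [DecidableEq V] {A : Finset V} {u v : V} :
    s(u, v) ∈ pairsIn A ↔ u ∈ A ∧ v ∈ A ∧ u ≠ v := by
  simp [pairsIn, and_assoc]

lemma pairsIn_mono {V : Type*} [DecidableEq V] {A B : Finset V} (h : A ⊆ B) :
    pairsIn A ⊆ pairsIn B :=
  filter_subset_filter _ (Finset.sym2_mono h)

lemma pairsIn_inter {V : Type*} [DecidableEq V] (A B : Finset V) :
    pairsIn (A ∩ B) = pairsIn A ∩ pairsIn B := by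
  ext e
  induction e with | _ u v => simp only [mem_inter, mem_pairsIn]; tauto

lemma card_pairsIn {V : Type*} [DecidableEq V] (A : Finset V) :
    (pairsIn A).card = A.card.choose 2 := by
  rw [← Sym2.card_image_offDiag]
  congr 1
  ext e
  induction e with
  | _ u v =>
    simp only [mem_pairsIn, mem_image, mem_offDiag, Prod.exists, Function.uncurry_apply_pair]
    constructor
    · rintro h
      exact ⟨u, v, h, rfl⟩
    · rintro ⟨a, b, h, hab⟩
      rcases Sym2.eq_iff.1 hab with ⟨rfl, rfl⟩ | ⟨rfl, rfl⟩
      · exact h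
      · exact ⟨h.2.1, h.1, h.2.2.symm⟩

open scoped Classical in
/-- The edges of `G`, as a finite set. -/
def edges (G : SimpleGraph V) : Finset (Sym2 V) := univ.filter fun e => e ∈ G.edgeSet

@[simp] lemma mem_edges {G : SimpleGraph V} {e : Sym2 V} : e ∈ edges G ↔ e ∈ G.edgeSet := by
  simp [edges]

lemma edges_subset (G : SimpleGraph V) : edges G ⊆ pairsIn univ := by
  intro e
  induction e with | _ u v => simpa [mem_pairsIn] using fun h => h.ne

lemma edges_fromEdgeSet {E : Finset (Sym2 V)} (hE : E ⊆ pairsIn univ) :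
    edges (SimpleGraph.fromEdgeSet (E : Set (Sym2 V))) = E := by
  ext e
  induction e with
  | _ u v =>
    simp only [mem_edges, SimpleGraph.mem_edgeSet, SimpleGraph.fromEdgeSet_adj, mem_coe]
    exact ⟨fun h => h.1, fun h => ⟨h, (mem_pairsIn.1 (hE h)).2.2⟩⟩

/-- The probability of the graph `G`. -/
def weight (p : ℝ) (G : SimpleGraph V) : ℝ :=
  p ^ (edges G).card * (1 - p) ^ ((Fintype.card V).choose 2 - (edges G).card)

open scoped Classical in
/-- The probability of the graph property `P` in the binomial random graph. -/
def pr (p : ℝ) (P : SimpleGraph V → Prop) : ℝ := ∑ G with P G, weight p G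

variable {p : ℝ}

lemma weight_nonneg (hp : 0 ≤ p) (hp1 : p ≤ 1) (G : SimpleGraph V) : 0 ≤ weight p G :=
  mul_nonneg (pow_nonneg hp _) (pow_nonneg (by linarith) _)

lemma pr_nonneg (hp : 0 ≤ p) (hp1 : p ≤ 1) (P : SimpleGraph V → Prop) : 0 ≤ pr p P :=
  sum_nonneg fun G _ => weight_nonneg hp hp1 G

open scoped Classical in
lemma pr_mono (hp : 0 ≤ p) (hp1 : p ≤ 1) {P Q : SimpleGraph V → Prop} (h : ∀ G, P G → Q G) :
    pr p P ≤ pr p Q :=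
  sum_le_sum_of_subset_of_nonneg (monotone_filter_right _ fun G _ => h G)
    fun G _ _ => weight_nonneg hp hp1 G

open scoped Classical in
lemma pr_eq_sum_ite (P : SimpleGraph V → Prop) :
    pr p P = ∑ G, weight p G * if P G then 1 else 0 := by
  simp [pr, sum_filter]

open scoped Classical in
/-- The expected number of elements of `s` with the property `P`. -/
lemma sum_weight_mul_card {ι : Type*} (s : Finset ι) (P : ι → SimpleGraph V → Prop) :
    ∑ G, weight p G * ((s.filter fun i => P i G).card : ℝ) = ∑ i ∈ s, pr p (P i) := by
  simp_rw [pr_eq_sum_ite]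
  rw [sum_comm]
  refine sum_congr rfl fun G _ => ?_
  rw [← mul_sum, card_filter]
  push_cast
  rfl

/-- The union bound. -/
lemma pr_exists_le (hp : 0 ≤ p) (hp1 : p ≤ 1) {ι : Type*} (s : Finset ι)
    (P : ι → SimpleGraph V → Prop) :
    pr p (fun G => ∃ i ∈ s, P i G) ≤ ∑ i ∈ s, pr p (P i) := by
  classical
  rw [← sum_weight_mul_card, pr_eq_sum_ite]
  refine sum_le_sum fun G _ => mul_le_mul_of_nonneg_left ?_ (weight_nonneg hp hp1 G)
  split_ifs with h
  · obtain ⟨i, hi, h⟩ := h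
    exact_mod_cast Finset.card_pos.2 ⟨i, by simp [hi, h]⟩
  · positivity

lemma pr_exists_eq {ι : Type*} (s : Finset ι) (P : ι → SimpleGraph V → Prop)
    (h : ∀ G, ∀ i ∈ s, ∀ j ∈ s, P i G → P j G → i = j) :
    pr p (fun G => ∃ i ∈ s, P i G) = ∑ i ∈ s, pr p (P i) := by
  classical
  rw [← sum_weight_mul_card, pr_eq_sum_ite]
  refine sum_congr rfl fun G _ => ?_
  congr 1
  split_ifs with hG
  · obtain ⟨i, hi, hP⟩ := hG
    have : s.filter (fun i => P i G) = {i} := by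
      ext j
      simp only [mem_filter, mem_singleton]
      exact ⟨fun hj => h G j hj.1 i hi hj.2 hP, by rintro rfl; exact ⟨hi, hP⟩⟩
    simp [this]
  · have : s.filter (fun i => P i G) = ∅ := by
      ext j
      simp only [mem_filter, notMem_empty, iff_false]
      exact fun hj => hG ⟨j, hj⟩
    simp [this]

lemma pr_and_add_pr_and_not (P Q : SimpleGraph V → Prop) :
    pr p (fun G => P G ∧ Q G) + pr p (fun G => P G ∧ ¬ Q G) = pr p P := by
  simp_rw [pr_eq_sum_ite]
  rw [← sum_add_distrib]
  refine sum_congr rfl fun G _ => ?_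
  by_cases h : P G <;> by_cases h' : Q G <;> simp [h, h']

/-- The probability that all pairs in `E₁` and none of the pairs in `E₀` are edges. -/
lemma pr_cylinder {E₁ E₀ : Finset (Sym2 V)} (h₁ : E₁ ⊆ pairsIn univ) (h₀ : E₀ ⊆ pairsIn univ)
    (hd : Disjoint E₁ E₀) :
    pr p (fun G : SimpleGraph V => E₁ ⊆ edges G ∧ Disjoint E₀ (edges G)) =
      p ^ E₁.card * (1 - p) ^ E₀.card := by
  set N : Finset (Sym2 V) := pairsIn univ with hN
  set D := N \ (E₁ ∪ E₀) with hD
  have hcN : N.card = (Fintype.card V).choose 2 := by rw [hN, card_pairsIn, card_univ]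
  have hcD : D.card + E₁.card + E₀.card = N.card := by
    rw [hD, card_sdiff_of_subset (union_subset h₁ h₀), card_union_of_disjoint hd]
    have := card_le_card (union_subset h₁ h₀)
    rw [card_union_of_disjoint hd] at this
    omega
  have key : pr p (fun G : SimpleGraph V => E₁ ⊆ edges G ∧ Disjoint E₀ (edges G)) =
      ∑ t ∈ D.powerset, p ^ E₁.card * (1 - p) ^ E₀.card *
        (p ^ t.card * (1 - p) ^ (D.card - t.card)) := by
    refine sum_bij' (fun G _ => edges G \ E₁)
      (fun t _ => SimpleGraph.fromEdgeSet ((t ∪ E₁ : Finset (Sym2 V)) : Set (Sym2 V))) ?_ ?_ ?_ ?_ ?_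
    · intro G hG
      simp only [mem_filter, mem_univ, true_and] at hG
      rw [mem_powerset, hD]
      intro e he
      replace he := Finset.mem_sdiff.1 he
      rw [Finset.mem_sdiff, mem_union]
      refine ⟨edges_subset G he.1, ?_⟩
      rintro (h | h)
      · exact he.2 h
      · exact (disjoint_left.1 hG.2 h) he.1
    · intro t ht
      rw [mem_powerset, hD] at ht
      have hsub : t ∪ E₁ ⊆ pairsIn univ := union_subset (ht.trans sdiff_subset) h₁
      simp only [mem_filter, mem_univ, true_and]
      rw [edges_fromEdgeSet hsub]
      refine ⟨subset_union_right, disjoint_union_right.2 ⟨?_, hd.symm⟩⟩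
      rw [disjoint_right]
      intro e he h
      exact (Finset.mem_sdiff.1 (ht he)).2 (mem_union_right _ h)
    · intro G hG
      simp only [mem_filter, mem_univ, true_and] at hG
      ext u v
      simp only [SimpleGraph.fromEdgeSet_adj, mem_coe, sdiff_union_of_subset hG.1, mem_edges,
        SimpleGraph.mem_edgeSet]
      exact ⟨fun h => h.1, fun h => ⟨h, h.ne⟩⟩
    · intro t ht
      rw [mem_powerset, hD] at ht
      have hsub : t ∪ E₁ ⊆ pairsIn univ := union_subset (ht.trans sdiff_subset) h₁
      rw [edges_fromEdgeSet hsub]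
      refine union_sdiff_cancel_right ?_
      rw [disjoint_left]
      intro e he h
      exact (Finset.mem_sdiff.1 (ht he)).2 (mem_union_left _ h)
    · intro G hG
      simp only [mem_filter, mem_univ, true_and] at hG
      have h1 : (edges G \ E₁).card + E₁.card = (edges G).card := by
        rw [card_sdiff_add_card_eq_card hG.1]
      have h2 : (edges G).card + E₀.card ≤ N.card := by
        rw [add_comm, ← card_union_of_disjoint hG.2]
        exact card_le_card (union_subset h₀ (edges_subset G))
      rw [weight, ← hcN, show N.card - (edges G).card =
        E₀.card + (D.card - (edges G \ E₁).card) by omega, ← h1, pow_add, pow_add]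
      ring
  -- The unconstrained pairs contribute (p + (1-p))^|D| = 1.
  rw [key, ← mul_sum, sum_pow_mul_eq_add_pow]
  simp

lemma pr_true : pr p (fun _ : SimpleGraph V => True) = 1 := by
  have := pr_cylinder (V := V) (p := p) (E₁ := ∅) (E₀ := ∅) (by simp) (by simp) (by simp)
  simpa using this

instance measurableSingletonClass : MeasurableSingletonClass (SimpleGraph V) where
  measurableSet_singleton G := by
    rw [← SimpleGraph.measurableEmbedding_edgeSet.measurableSet_image]
    simp

lemma measureReal_singleton (p : I) (G : SimpleGraph V) :
    (SimpleGraph.binomialRandom V p).real {G} = weight (p : ℝ) G := by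
  have hc : (edges G).card = G.edgeSet.ncard := by
    rw [← Set.ncard_coe_finset]
    congr 1
    ext e
    simp
  rw [measureReal_def, SimpleGraph.binomialRandom_singleton, weight, hc, Nat.card_eq_fintype_card]
  simp

lemma integral_eq_sum_weight (p : I) (f : SimpleGraph V → ℝ) :
    ∫ G, f G ∂(SimpleGraph.binomialRandom V p) = ∑ G, weight (p : ℝ) G * f G := by
  rw [integral_fintype .of_finite]
  simp [measureReal_singleton]

lemma measure_eq_ofReal_pr (p : I) (P : SimpleGraph V → Prop) :
    SimpleGraph.binomialRandom V p {G | P G} = ENNReal.ofReal (pr (p : ℝ) P) := by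
  classical
  have : ({G | P G} : Set (SimpleGraph V)) = ((univ.filter P : Finset (SimpleGraph V)) : Set _) := by
    ext; simp
  rw [this, ← ENNReal.ofReal_toReal (measure_ne_top _ _), ← measureReal_def,
    ← sum_measureReal_singleton]
  simp_rw [measureReal_singleton]
  rfl

end

section

variable {V : Type*} [Fintype V] [DecidableEq V]

/-! ### Trees as edge sets -/

open scoped Classical in
/-- The edge sets of the trees with vertex set `A`. -/
def treesOn (A : Finset V) : Finset (Finset (Sym2 V)) :=
  (pairsIn A).powerset.filter fun E =>
    ((SimpleGraph.fromEdgeSet (E : Set (Sym2 V))).induce (A : Set V)).IsTree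

lemma mem_treesOn {A : Finset V} {E : Finset (Sym2 V)} :
    E ∈ treesOn A ↔ E ⊆ pairsIn A ∧
      ((SimpleGraph.fromEdgeSet (E : Set (Sym2 V))).induce (A : Set V)).IsTree := by
  simp [treesOn]

lemma subset_pairsIn_of_mem_treesOn {A : Finset V} {E : Finset (Sym2 V)} (h : E ∈ treesOn A) :
    E ⊆ pairsIn A := (mem_treesOn.1 h).1

lemma isTree_of_mem_treesOn {A : Finset V} {E : Finset (Sym2 V)} (h : E ∈ treesOn A) :
    ((SimpleGraph.fromEdgeSet (E : Set (Sym2 V))).induce (A : Set V)).IsTree :=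
  (mem_treesOn.1 h).2

/-- The edges of `G` inside `A`. -/
def edgesIn (G : SimpleGraph V) (A : Finset V) : Finset (Sym2 V) := edges G ∩ pairsIn A

lemma mk_mem_edgesIn {G : SimpleGraph V} {A : Finset V} {u v : V} :
    s(u, v) ∈ edgesIn G A ↔ G.Adj u v ∧ u ∈ A ∧ v ∈ A := by
  simp only [edgesIn, mem_inter, mem_edges, SimpleGraph.mem_edgeSet, mem_pairsIn]
  exact ⟨fun h => ⟨h.1, h.2.1, h.2.2.1⟩, fun h => ⟨h.1, h.2.1, h.2.2, h.1.ne⟩⟩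

lemma edgesIn_subset (G : SimpleGraph V) (A : Finset V) : edgesIn G A ⊆ pairsIn A :=
  inter_subset_right

lemma edgesIn_inter (G : SimpleGraph V) {A S : Finset V} (h : S ⊆ A) :
    edgesIn G A ∩ pairsIn S = edgesIn G S := by
  rw [edgesIn, edgesIn, inter_assoc, inter_eq_right.2 (pairsIn_mono h)]

/-- Only the edges inside A matter. The event becomes a disjoint union of finitely many edge
patterns, which is the form in which probabilities are computed. -/
lemma induce_isTree_iff (G : SimpleGraph V) (A : Finset V) :
    (G.induce (A : Set V)).IsTree ↔ edgesIn G A ∈ treesOn A := by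
  have : (SimpleGraph.fromEdgeSet (edgesIn G A : Set (Sym2 V))).induce (A : Set V) =
      G.induce (A : Set V) := by
    ext ⟨u, hu⟩ ⟨v, hv⟩
    simp only [SimpleGraph.comap_adj, SimpleGraph.fromEdgeSet_adj, mem_coe,
      Function.Embedding.subtype_apply, mk_mem_edgesIn]
    exact ⟨fun h => h.1.1, fun h => ⟨⟨h, hu, hv⟩, h.ne⟩⟩
  rw [mem_treesOn, this]
  exact ⟨fun h => ⟨edgesIn_subset G A, h⟩, fun h => h.2⟩

lemma natCard_edgeSet_induce {A : Finset V} {E : Finset (Sym2 V)} (hE : E ⊆ pairsIn A) :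
    Nat.card ((SimpleGraph.fromEdgeSet (E : Set (Sym2 V))).induce (A : Set V)).edgeSet =
      E.card := by
  have himg : Sym2.map (Subtype.val : ↥(A : Set V) → V) ''
      ((SimpleGraph.fromEdgeSet (E : Set (Sym2 V))).induce (A : Set V)).edgeSet = E := by
    ext e
    induction e with
    | _ u v =>
      constructor
      · rintro ⟨e', he', h⟩
        induction e' with
        | _ a b =>
          rw [← h]
          simp only [SimpleGraph.mem_edgeSet, SimpleGraph.comap_adj,
            SimpleGraph.fromEdgeSet_adj] at he'
          exact he'.1
      · intro h
        obtain ⟨hu, hv, huv⟩ := mem_pairsIn.1 (hE h)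
        refine ⟨s(⟨u, hu⟩, ⟨v, hv⟩), ?_, rfl⟩
        simp only [SimpleGraph.mem_edgeSet, SimpleGraph.comap_adj, SimpleGraph.fromEdgeSet_adj]
        exact ⟨h, huv⟩
  rw [Nat.card_coe_set_eq, ← Set.ncard_image_of_injective _
    (Sym2.map.injective Subtype.val_injective), himg, Set.ncard_coe_finset]

lemma card_add_one_of_mem_treesOn {A : Finset V} {E : Finset (Sym2 V)} (h : E ∈ treesOn A) :
    E.card + 1 = A.card := by
  have := (SimpleGraph.isTree_iff_connected_and_card.1 (isTree_of_mem_treesOn h)).2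
  rw [natCard_edgeSet_induce (subset_pairsIn_of_mem_treesOn h)] at this
  simpa using this

lemma nonempty_of_mem_treesOn {A : Finset V} {E : Finset (Sym2 V)} (h : E ∈ treesOn A) :
    A.Nonempty := by
  rw [← card_pos, ← card_add_one_of_mem_treesOn h]
  omega

/-- `f` sends every element of `A` other than `ρ` to an element of `A`, and following `f` one
always ends in `ρ`. -/
def IsParentMap (A : Finset V) (ρ : V) (f : V → V) : Prop :=
  (∀ v ∈ A.erase ρ, f v ∈ A) ∧ ∃ h : V → ℕ, ∀ v ∈ A.erase ρ, h (f v) < h v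

/-- The edges joining the elements of `A` other than `ρ` to their parents. -/
def parentEdges (A : Finset V) (ρ : V) (f : V → V) : Finset (Sym2 V) :=
  (A.erase ρ).image fun v => s(v, f v)

/-- If two vertices gave the same edge, each would be the parent of the other, and the height would
decrease in both directions. -/
lemma IsParentMap.injOn {A : Finset V} {ρ : V} {f : V → V} (hf : IsParentMap A ρ f) :
    Set.InjOn (fun v => s(v, f v)) (A.erase ρ : Finset V) := by
  obtain ⟨-, h, hh⟩ := hf
  intro v hv w hw hvw
  rcases Sym2.eq_iff.1 hvw with ⟨h1, -⟩ | ⟨h1, h2⟩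
  · exact h1
  · have h3 := hh v hv
    have h4 := hh w hw
    rw [h2] at h3
    rw [← h1] at h4
    omega

lemma IsParentMap.card_parentEdges {A : Finset V} {ρ : V} {f : V → V} (hf : IsParentMap A ρ f) :
    (parentEdges A ρ f).card = (A.erase ρ).card :=
  card_image_of_injOn hf.injOn

/-- The parent of v is the next vertex on a shortest path to ρ, and the height is the distance to ρ.
The parent edges lie in E, and there are |A| - 1 of them, so they are all of E. -/
lemma exists_isParentMap {A : Finset V} {E : Finset (Sym2 V)} (hE : E ∈ treesOn A) {ρ : V}
    (hρ : ρ ∈ A) : ∃ f, IsParentMap A ρ f ∧ parentEdges A ρ f = E := by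
  set T := (SimpleGraph.fromEdgeSet (E : Set (Sym2 V))).induce (A : Set V) with hT
  have htree : T.IsTree := isTree_of_mem_treesOn hE
  have hex : ∀ v : (A : Set V), v ≠ ⟨ρ, hρ⟩ → ∃ w, T.Adj v w ∧ T.dist w ⟨ρ, hρ⟩ < T.dist v ⟨ρ, hρ⟩ := by
    intro v hv
    obtain ⟨w, hw⟩ := htree.connected.exists_walk_length_eq_dist v ⟨ρ, hρ⟩
    cases w with
    | nil => exact absurd rfl hv
    | cons hadj w' =>
      rename_i b
      refine ⟨b, hadj, ?_⟩
      have := SimpleGraph.dist_le w'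
      rw [SimpleGraph.Walk.length_cons] at hw
      omega
  choose! g hg1 hg2 using hex
  have key : ∀ v (hv : v ∈ A.erase ρ), T.Adj ⟨v, mem_of_mem_erase hv⟩ (g ⟨v, mem_of_mem_erase hv⟩) ∧
      T.dist (g ⟨v, mem_of_mem_erase hv⟩) ⟨ρ, hρ⟩ < T.dist ⟨v, mem_of_mem_erase hv⟩ ⟨ρ, hρ⟩ := by
    intro v hv
    have hne : (⟨v, mem_of_mem_erase hv⟩ : (A : Set V)) ≠ ⟨ρ, hρ⟩ := by
      intro h
      exact (mem_erase.1 hv).1 (congrArg Subtype.val h)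
    exact ⟨hg1 _ hne, hg2 _ hne⟩
  let f : V → V := fun v => if hv : v ∈ A then (g ⟨v, hv⟩ : V) else v
  let h : V → ℕ := fun v => if hv : v ∈ A then T.dist ⟨v, hv⟩ ⟨ρ, hρ⟩ else 0
  have hfv : ∀ v (hv : v ∈ A.erase ρ), f v = (g ⟨v, mem_of_mem_erase hv⟩ : V) := fun v hv =>
    dif_pos (mem_of_mem_erase hv)
  have hpar : IsParentMap A ρ f := by
    refine ⟨fun v hv => ?_, h, fun v hv => ?_⟩
    · rw [hfv v hv]
      exact (g ⟨v, mem_of_mem_erase hv⟩).2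
    · have h1 : h v = T.dist ⟨v, mem_of_mem_erase hv⟩ ⟨ρ, hρ⟩ := dif_pos (mem_of_mem_erase hv)
      have h2 : h (f v) = T.dist (g ⟨v, mem_of_mem_erase hv⟩) ⟨ρ, hρ⟩ := by
        rw [hfv v hv]
        exact dif_pos (g ⟨v, mem_of_mem_erase hv⟩).2
      rw [h1, h2]
      exact (key v hv).2
  refine ⟨f, hpar, eq_of_subset_of_card_le ?_ ?_⟩
  · intro e he
    obtain ⟨v, hv, rfl⟩ := mem_image.1 he
    have := (key v hv).1
    rw [hT, SimpleGraph.comap_adj, SimpleGraph.fromEdgeSet_adj] at this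
    rw [hfv v hv]
    exact this.1
  · rw [hpar.card_parentEdges, card_erase_of_mem hρ]
    have := card_add_one_of_mem_treesOn hE
    omega

lemma IsParentMap.parentEdges_subset {A : Finset V} {ρ : V} {f : V → V} (hf : IsParentMap A ρ f) :
    parentEdges A ρ f ⊆ pairsIn A := by
  obtain ⟨hA, h, hh⟩ := hf
  intro e he
  obtain ⟨v, hv, rfl⟩ := mem_image.1 he
  refine mem_pairsIn.2 ⟨mem_of_mem_erase hv, hA v hv, fun hc => ?_⟩
  have := hh v hv
  rw [← hc] at this
  exact lt_irrefl _ this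

/-- Following parents connects every vertex to ρ, and a connected graph with |A| - 1 edges is a
tree. -/
lemma IsParentMap.mem_treesOn {A : Finset V} {ρ : V} (hρ : ρ ∈ A) {f : V → V}
    (hf : IsParentMap A ρ f) : parentEdges A ρ f ∈ treesOn A := by
  have hsub := hf.parentEdges_subset
  refine InducedTree.mem_treesOn.2 ⟨hsub, SimpleGraph.isTree_iff_connected_and_card.2 ⟨?_, ?_⟩⟩
  · set T := (SimpleGraph.fromEdgeSet (parentEdges A ρ f : Set (Sym2 V))).induce (A : Set V)
    obtain ⟨hA, h, hh⟩ := hf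
    have hreach : ∀ m, ∀ v (hv : v ∈ A), h v ≤ m → T.Reachable ⟨v, hv⟩ ⟨ρ, hρ⟩ := by
      intro m
      induction m with
      | zero =>
        intro v hv hm
        by_cases hvρ : v = ρ
        · subst hvρ; rfl
        · have := hh v (mem_erase.2 ⟨hvρ, hv⟩)
          omega
      | succ m ih =>
        intro v hv hm
        by_cases hvρ : v = ρ
        · subst hvρ; rfl
        · have hv' := mem_erase.2 ⟨hvρ, hv⟩
          have h1 := hh v hv'
          have hadj : T.Adj ⟨v, hv⟩ ⟨f v, hA v hv'⟩ := by
            rw [SimpleGraph.comap_adj, SimpleGraph.fromEdgeSet_adj]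
            refine ⟨?_, fun hc => ?_⟩
            · exact mem_coe.2 (mem_image.2 ⟨v, hv', rfl⟩)
            · have hc' : v = f v := hc
              rw [← hc'] at h1
              exact lt_irrefl _ h1
          exact hadj.reachable.trans (ih _ _ (by omega))
    have : Nonempty (A : Set V) := ⟨⟨ρ, hρ⟩⟩
    exact ⟨fun u v => (hreach _ u u.2 le_rfl).trans (hreach _ v v.2 le_rfl).symm⟩
  · rw [natCard_edgeSet_induce hsub, hf.card_parentEdges, card_erase_of_mem hρ]
    have := card_pos.2 ⟨ρ, hρ⟩
    simp only [SetLike.coe_sort_coe, Nat.card_eq_fintype_card, Fintype.card_coe]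
    omega

/-- A tree and its root determine the parents, by induction on the height for g. If the edge {v, g
v} were the f-edge of another vertex, that vertex would be w = g v with f w = v. But w is lower, so
g w = f w = v, and v and w would share an edge under g. -/
lemma IsParentMap.eq_of_parentEdges_eq {A : Finset V} {ρ : V} {f g : V → V}
    (hg : IsParentMap A ρ g)
    (h : parentEdges A ρ f = parentEdges A ρ g) : ∀ v ∈ A.erase ρ, f v = g v := by
  obtain ⟨hgA, H, hH⟩ := id hg
  have key : ∀ m, ∀ v ∈ A.erase ρ, H v ≤ m → f v = g v := by
    intro m
    induction m with
    | zero =>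
      intro v hv hm
      have := hH v hv
      omega
    | succ m ih =>
      intro v hv hm
      by_contra hne
      have hmem : s(v, g v) ∈ parentEdges A ρ f := by
        rw [h]
        exact mem_image.2 ⟨v, hv, rfl⟩
      obtain ⟨w, hw, hwe⟩ := mem_image.1 hmem
      rcases Sym2.eq_iff.1 hwe with ⟨h1, h2⟩ | ⟨h1, h2⟩
      · rw [h1] at h2
        exact hne h2
      · have hvw : v ≠ w := by
          rintro rfl
          exact hne (h2.trans h1)
        have h3 := hH v hv
        rw [← h1] at h3
        have h4 := ih w hw (by omega)
        refine hvw (hg.injOn hv hw ?_)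
        change s(v, g v) = s(w, g w)
        rw [← h4, h2, ← h1]
        exact Sym2.eq_swap
  exact fun v hv => key _ v hv le_rfl

end

section

variable {V : Type*} [Fintype V] [DecidableEq V]

/-! ### Cayley's formula -/

/-- A partial map from `R` to `A` which, composed with a map `κ` from `A` to `R`, has no cycles.
For `A = R` and `κ = id` this is a rooted forest on `A`; its roots are the elements of `R` at which
it is undefined. -/
def IsRootedForest (A R : Finset V) (κ : V → V) (f : V → Option V) : Prop :=
  (∀ v w, f v = some w → v ∈ R ∧ w ∈ A) ∧ ∃ h : V → ℕ, ∀ v w, f v = some w → h (κ w) < h v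

/-- The elements at which a partial map is defined. -/
def definedAt (f : V → Option V) : Finset V := univ.filter fun v => f v ≠ none

lemma mem_definedAt {f : V → Option V} {v : V} : v ∈ definedAt f ↔ f v ≠ none := by
  simp [definedAt]

variable {A R : Finset V} {κ : V → V}

lemma IsRootedForest.definedAt_subset {f : V → Option V} (hf : IsRootedForest A R κ f) :
    definedAt f ⊆ R := by
  intro v hv
  obtain ⟨w, hw⟩ := Option.ne_none_iff_exists'.1 (mem_definedAt.1 hv)
  exact (hf.1 v w hw).1

open scoped Classical in
/-- The rooted forests with `j` edges. -/
def rootedForests (A R : Finset V) (κ : V → V) (j : ℕ) : Finset (V → Option V) :=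
  univ.filter fun f => IsRootedForest A R κ f ∧ (definedAt f).card = j

lemma mem_rootedForests {j : ℕ} {f : V → Option V} :
    f ∈ rootedForests A R κ j ↔ IsRootedForest A R κ f ∧ (definedAt f).card = j := by
  simp [rootedForests]

/-- The root is found by iterating v ↦ κ (f v) until f is undefined, and the height function makes
this stop. -/
lemma IsRootedForest.exists_root (hκ : ∀ v ∈ A, κ v ∈ R) {f : V → Option V}
    (hf : IsRootedForest A R κ f) :
    ∃ root : V → V, (∀ v, f (root v) = none) ∧ (∀ v, f v = none → root v = v) ∧
      (∀ v w, f v = some w → root v = root (κ w)) ∧ (∀ v ∈ R, root v ∈ R) := by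
  obtain ⟨hA, h, hh⟩ := hf
  let step : V → V := fun v => ((f v).map κ).getD v
  have hnone : ∀ v, f v = none → step v = v := fun v hv => by simp [step, hv]
  have hsome : ∀ v w, f v = some w → step v = κ w := fun v w hv => by simp [step, hv]
  have hend : ∀ m, ∀ v, h v ≤ m → f (step^[m] v) = none := by
    intro m
    induction m with
    | zero =>
      intro v hv
      by_contra hc
      obtain ⟨w, hw⟩ := Option.ne_none_iff_exists'.1 hc
      have := hh _ _ hw
      simp only [Function.iterate_zero, id_eq] at this
      omega
    | succ m ih =>
      intro v hv
      rcases hfv : f v with _ | w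
      · rw [Function.iterate_fixed (hnone v hfv)]
        exact hfv
      · rw [Function.iterate_succ_apply, hsome v w hfv]
        have := hh v w hfv
        exact ih (κ w) (by omega)
  -- One number of iterations that suffices for every starting vertex.
  set M := ∑ v, h v with hM
  have hle : ∀ v, h v ≤ M := fun v => single_le_sum (fun _ _ => Nat.zero_le _) (mem_univ v)
  refine ⟨fun v => step^[M] v, fun v => hend M v (hle v), fun v hv =>
    Function.iterate_fixed (hnone v hv) M, fun v w hvw => ?_, fun v hv => ?_⟩
  · have h1 : step^[M + 1] v = step^[M] (κ w) := by
      rw [Function.iterate_succ_apply, hsome v w hvw]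
    have h2 : step^[M + 1] v = step^[M] v := by
      rw [Function.iterate_succ_apply']
      exact hnone _ (hend M v (hle v))
    exact h2.symm.trans h1
  · have : ∀ m, step^[m] v ∈ R := by
      intro m
      induction m with
      | zero => exact hv
      | succ m ih =>
        rw [Function.iterate_succ_apply']
        rcases hfv : f (step^[m] v) with _ | w
        · rw [hnone _ hfv]; exact ih
        · rw [hsome _ _ hfv]; exact hκ w (hA _ _ hfv).2
    exact this M

/-- Removing an edge from a rooted forest. -/
lemma IsRootedForest.update_none {f : V → Option V} (hf : IsRootedForest A R κ f)
    (x : V) : IsRootedForest A R κ (Function.update f x none) := by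
  obtain ⟨hA, h, hh⟩ := hf
  have key : ∀ v w, Function.update f x none v = some w → f v = some w := by
    intro v w hvw
    by_cases hx : v = x
    · subst hx; simp at hvw
    · rwa [Function.update_of_ne hx] at hvw
  exact ⟨fun v w hvw => hA v w (key v w hvw), h, fun v w hvw => hh v w (key v w hvw)⟩

/-- Hanging a root below a vertex of another component. -/
lemma IsRootedForest.update_some {f : V → Option V} (hf : IsRootedForest A R κ f)
    {root : V → V} (hself : ∀ v, f v = none → root v = v)
    (hstep : ∀ v w, f v = some w → root v = root (κ w)) {x v : V} (hx : x ∈ R) (hv : v ∈ A)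
    (hfx : f x = none) (hroot : root (κ v) ≠ x) :
    IsRootedForest A R κ (Function.update f x (some v)) := by
  obtain ⟨hA, h, hh⟩ := hf
  -- The whole component of x is lifted above κ v. The component of κ v is a different one and keeps
  -- its heights.
  refine ⟨fun a b hab => ?_, fun u => h u + if root u = x then h (κ v) + 1 else 0,
    fun a b hab => ?_⟩
  · by_cases ha : a = x
    · subst ha
      simp only [Function.update_self, Option.some.injEq] at hab
      subst hab
      exact ⟨hx, hv⟩
    · rw [Function.update_of_ne ha] at hab
      exact hA a b hab
  · by_cases ha : a = x
    · subst ha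
      simp only [Function.update_self, Option.some.injEq] at hab
      subst hab
      simp only [hroot, hself a hfx, if_true, if_false]
      omega
    · rw [Function.update_of_ne ha] at hab
      have := hh a b hab
      simp only [hstep a b hab]
      omega

lemma definedAt_update_none (f : V → Option V) (x : V) :
    definedAt (Function.update f x none) = (definedAt f).erase x := by
  ext v
  by_cases h : v = x
  · subst h; simp [mem_definedAt]
  · simp [mem_definedAt, h]

lemma definedAt_update_some (f : V → Option V) (x v : V) :
    definedAt (Function.update f x (some v)) = insert x (definedAt f) := by
  ext u
  by_cases h : u = x
  · subst h; simp [mem_definedAt]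
  · simp [mem_definedAt, h]

/-- Double counting of the pairs of a rooted forest and one of its edges. -/
lemma card_rootedForests_succ (hκ : ∀ v ∈ A, κ v ∈ R) (j : ℕ) :
    (j + 1) * (rootedForests A R κ (j + 1)).card =
      (rootedForests A R κ j).card * (A.card * (R.card - j - 1)) := by
  classical
  have : Nonempty (V → V) := ⟨id⟩
  choose! root hr1 hr2 hr3 hr4 using
    fun (f : V → Option V) (hf : IsRootedForest A R κ f) => hf.exists_root hκ
  have hL : ((rootedForests A R κ (j + 1)).sigma fun f => definedAt f).card =
      (j + 1) * (rootedForests A R κ (j + 1)).card := by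
    rw [card_sigma, sum_congr rfl fun f hf => (mem_rootedForests.1 hf).2, sum_const, smul_eq_mul,
      mul_comm]
  -- Inverse of deleting an edge: v in A is arbitrary, and x is any of the |R| - j roots except the
  -- root of the component of κ v.
  have hR : ((rootedForests A R κ j).sigma fun f =>
      A.sigma fun v => (R \ definedAt f).erase (root f (κ v))).card =
      (rootedForests A R κ j).card * (A.card * (R.card - j - 1)) := by
    rw [card_sigma, sum_congr rfl (g := fun _ => A.card * (R.card - j - 1)), sum_const,
      smul_eq_mul]
    intro f hf
    obtain ⟨hf, hj⟩ := mem_rootedForests.1 hf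
    rw [card_sigma, sum_congr rfl (g := fun _ => R.card - j - 1), sum_const, smul_eq_mul]
    intro v hv
    rw [card_erase_of_mem, card_sdiff_of_subset hf.definedAt_subset, hj]
    rw [Finset.mem_sdiff, mem_definedAt, not_not]
    exact ⟨hr4 f hf _ (hκ v hv), hr1 f hf _⟩
  rw [← hL, ← hR]
  refine card_bij' (fun y _ => ⟨Function.update y.1 y.2 none, (y.1 y.2).getD y.2, y.2⟩)
    (fun z _ => ⟨Function.update z.1 z.2.2 (some z.2.1), z.2.2⟩) ?_ ?_ ?_ ?_
  · rintro ⟨f, x⟩ hfx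
    simp only [mem_sigma] at hfx ⊢
    obtain ⟨hf, hj⟩ := mem_rootedForests.1 hfx.1
    obtain ⟨v, hv⟩ := Option.ne_none_iff_exists'.1 (mem_definedAt.1 hfx.2)
    have hf' := hf.update_none x
    refine ⟨mem_rootedForests.2 ⟨hf', ?_⟩, ?_, ?_⟩
    · rw [definedAt_update_none, card_erase_of_mem hfx.2, hj]
      omega
    · rw [hv]; exact (hf.1 x v hv).2
    · rw [hv, Option.getD_some, mem_erase, Finset.mem_sdiff, definedAt_update_none]
      refine ⟨fun hc => ?_, (hf.1 x v hv).1, by simp⟩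
      obtain ⟨h, hh⟩ := hf.2
      -- Passing to the root does not raise the height. The root reached from κ v is thus strictly
      -- lower than x, so it differs from x.
      have hle : ∀ m, ∀ u, h u ≤ m → h (root (Function.update f x none) u) ≤ h u := by
        intro m
        induction m with
        | zero =>
          intro u hu
          rcases hfu : Function.update f x none u with _ | w
          · rw [hr2 _ hf' u hfu]
          · have hux : u ≠ x := by rintro rfl; simp at hfu
            rw [Function.update_of_ne hux] at hfu
            have := hh u w hfu
            omega
        | succ m ih =>
          intro u hu
          rcases hfu : Function.update f x none u with _ | w
          · rw [hr2 _ hf' u hfu]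
          · have h0 := hr3 _ hf' u w hfu
            have hux : u ≠ x := by rintro rfl; simp at hfu
            rw [Function.update_of_ne hux] at hfu
            have := hh u w hfu
            have h2 := ih (κ w) (by omega)
            rw [h0]
            omega
      have h1 := hle _ (κ v) le_rfl
      rw [← hc] at h1
      have h2 := hh x v hv
      omega
  · rintro ⟨f, v, x⟩ hfx
    simp only [mem_sigma, mem_erase, Finset.mem_sdiff, mem_definedAt, not_not] at hfx ⊢
    obtain ⟨hf, hv, hne, hx, hfx⟩ := hfx
    obtain ⟨hf, hj⟩ := mem_rootedForests.1 hf
    refine ⟨mem_rootedForests.2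
      ⟨hf.update_some (hr2 f hf) (hr3 f hf) hx hv hfx hne.symm, ?_⟩, by simp⟩
    rw [definedAt_update_some, card_insert_of_notMem (by simp [mem_definedAt, hfx]), hj]
  · rintro ⟨f, x⟩ hfx
    simp only [mem_sigma] at hfx
    obtain ⟨v, hv⟩ := Option.ne_none_iff_exists'.1 (mem_definedAt.1 hfx.2)
    simp only [hv, Option.getD_some, Function.update_idem]
    rw [← hv, Function.update_eq_self]
  · rintro ⟨f, v, x⟩ hfx
    simp only [mem_sigma, mem_erase, Finset.mem_sdiff, mem_definedAt, not_not] at hfx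
    have hfx' := hfx.2.2.2.2
    simp only [Function.update_idem, Function.update_self, Option.getD_some]
    rw [← hfx', Function.update_eq_self]

/-- Solves the recursion of `card_rootedForests_succ`. The count does not depend on κ: κ = id gives
Cayley's formula, and a κ that contracts blocks gives the count of trees extending a forest. -/
lemma card_rootedForests (hκ : ∀ v ∈ A, κ v ∈ R) (j : ℕ) (hj : j + 1 ≤ R.card) :
    (rootedForests A R κ j).card = (R.card - 1).choose j * A.card ^ j := by
  induction j with
  | zero =>
    rw [Nat.choose_zero_right, pow_zero, mul_one, card_eq_one]
    refine ⟨fun _ => none, ?_⟩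
    ext f
    rw [mem_rootedForests, mem_singleton]
    constructor
    · rintro ⟨-, h⟩
      funext v
      by_contra hc
      have : v ∈ definedAt f := mem_definedAt.2 hc
      rw [card_eq_zero.1 h] at this
      exact notMem_empty _ this
    · rintro rfl
      exact ⟨⟨by simp, fun _ => 0, by simp⟩, by simp [definedAt]⟩
  | succ j ih =>
    have h1 := card_rootedForests_succ hκ j
    rw [ih (by omega)] at h1
    have h2 := Nat.choose_succ_right_eq (R.card - 1) j
    refine Nat.eq_of_mul_eq_mul_left (Nat.succ_pos j) ?_
    rw [Nat.succ_eq_add_one, h1, pow_succ]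
    calc (R.card - 1).choose j * A.card ^ j * (A.card * (R.card - j - 1))
        = ((R.card - 1).choose j * (R.card - 1 - j)) * (A.card ^ j * A.card) := by
          rw [show R.card - j - 1 = R.card - 1 - j by omega]; ring
      _ = _ := by rw [← h2]; ring

/-- **Cayley's formula.** -/
theorem card_treesOn (A : Finset V) (hA : A.Nonempty) :
    (treesOn A).card = A.card ^ (A.card - 2) := by
  classical
  have hk := card_pos.2 hA
  -- A tree with a marked root is a rooted forest with |A| - 1 edges, so |A| times the number of
  -- trees is |A|^(|A|-1). The root is the only vertex of A at which the partial map is undefined.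
  have hpairs : (treesOn A ×ˢ A).card = (rootedForests A A id (A.card - 1)).card := by
    have hex : ∀ x ∈ treesOn A ×ˢ A, ∃ f, IsParentMap A x.2 f ∧ parentEdges A x.2 f = x.1 := by
      rintro ⟨E, ρ⟩ hx
      exact exists_isParentMap (mem_product.1 hx).1 (mem_product.1 hx).2
    have : Nonempty (V → V) := ⟨id⟩
    choose! par hpar hparE using hex
    refine card_bij (fun x _ v => if v ∈ A.erase x.2 then some (par x v) else none) ?_ ?_ ?_
    · rintro ⟨E, ρ⟩ hx
      have hρ := (mem_product.1 hx).2
      obtain ⟨h1, h, h2⟩ := hpar _ hx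
      refine mem_rootedForests.2 ⟨⟨fun v w hvw => ?_, h, fun v w hvw => ?_⟩, ?_⟩
      · dsimp only at hvw
        split_ifs at hvw with hv
        rw [← Option.some.inj hvw]
        exact ⟨mem_of_mem_erase hv, h1 v hv⟩
      · dsimp only at hvw
        split_ifs at hvw with hv
        rw [← Option.some.inj hvw]
        exact h2 v hv
      · rw [← card_erase_of_mem hρ]
        congr 1
        ext v
        rw [mem_definedAt]
        by_cases hv : v ∈ A.erase ρ <;> simp [hv]
    · rintro ⟨E, ρ⟩ hx ⟨E', ρ'⟩ hx' heq
      have hρ : ρ = ρ' := by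
        by_contra hne
        have h1 := congrFun heq ρ
        have h2 : ρ ∈ A.erase ρ' := mem_erase.2 ⟨hne, (mem_product.1 hx).2⟩
        simp [h2] at h1
      subst hρ
      have h3 := hparE _ hx
      have h4 := hparE _ hx'
      have h5 : parentEdges A ρ (par (E, ρ)) = parentEdges A ρ (par (E', ρ)) := by
        refine image_congr fun v hv => ?_
        have h1 := congrFun heq v
        rw [if_pos (mem_coe.1 hv), if_pos (mem_coe.1 hv)] at h1
        rw [Option.some.inj h1]
      simp only at h3 h4
      rw [← h3, ← h4, h5]
    · intro f hf
      obtain ⟨⟨hfA, h, hh⟩, hfc⟩ := mem_rootedForests.1 hf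
      have hsub : definedAt f ⊆ A := IsRootedForest.definedAt_subset ⟨hfA, h, hh⟩
      have hone : (A \ definedAt f).card = 1 := by
        rw [card_sdiff_of_subset hsub, hfc]; omega
      obtain ⟨ρ, hρ⟩ := card_eq_one.1 hone
      have hρA : ρ ∈ A := (Finset.mem_sdiff.1 (hρ ▸ mem_singleton_self ρ)).1
      have hdef : definedAt f = A.erase ρ := by
        rw [erase_eq, ← hρ, Finset.sdiff_sdiff_eq_self hsub]
      have hsome : ∀ v ∈ A.erase ρ, f v = some ((f v).getD v) := by
        intro v hv
        rw [← hdef, mem_definedAt] at hv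
        obtain ⟨w, hw⟩ := Option.ne_none_iff_exists'.1 hv
        simp [hw]
      set g : V → V := fun v => (f v).getD v with hg
      have hpm : IsParentMap A ρ g :=
        ⟨fun v hv => (hfA v _ (hsome v hv)).2, h, fun v hv => hh v _ (hsome v hv)⟩
      have hmem : (parentEdges A ρ g, ρ) ∈ treesOn A ×ˢ A :=
        mem_product.2 ⟨hpm.mem_treesOn hρA, hρA⟩
      refine ⟨(parentEdges A ρ g, ρ), hmem, ?_⟩
      funext v
      by_cases hv : v ∈ A.erase ρ
      · rw [if_pos hv, hsome v hv,
          IsParentMap.eq_of_parentEdges_eq hpm (hparE _ hmem) v hv]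
      · rw [if_neg hv]
        rw [← hdef, mem_definedAt, not_not] at hv
        exact hv.symm
  rw [card_product, card_rootedForests (κ := id) (fun _ h => h) _ (by omega), Nat.choose_self, one_mul] at hpairs
  rcases Nat.lt_or_ge A.card 2 with h | h
  · have h1 : A.card = 1 := by omega
    rw [h1] at hpairs ⊢
    simpa using hpairs
  · refine Nat.eq_of_mul_eq_mul_right hk ?_
    rw [hpairs, ← pow_succ]
    congr 1
    omega

end

section

variable {V : Type*} [Fintype V] [DecidableEq V]

/-! ### Forests and the trees extending them -/

open scoped Classical in
/-- The partitions of `S` into `c` nonempty blocks. -/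
def partitions (S : Finset V) (c : ℕ) : Finset (Finset (Finset V)) :=
  univ.filter fun P => (P : Set (Finset V)).PairwiseDisjoint id ∧ P.biUnion id = S ∧
    ∅ ∉ P ∧ P.card = c

lemma mem_partitions {S : Finset V} {c : ℕ} {P : Finset (Finset V)} :
    P ∈ partitions S c ↔ (P : Set (Finset V)).PairwiseDisjoint id ∧ P.biUnion id = S ∧
      ∅ ∉ P ∧ P.card = c := by
  simp [partitions]

lemma subset_of_mem_partitions {S : Finset V} {c : ℕ} {P : Finset (Finset V)}
    (hP : P ∈ partitions S c) {U : Finset V} (hU : U ∈ P) : U ⊆ S := by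
  rw [← (mem_partitions.1 hP).2.1]
  exact subset_biUnion_of_mem id hU

lemma exists_block {S : Finset V} {c : ℕ} {P : Finset (Finset V)} (hP : P ∈ partitions S c)
    {v : V} (hv : v ∈ S) : ∃ U ∈ P, v ∈ U := by
  rw [← (mem_partitions.1 hP).2.1] at hv
  simpa using hv

lemma block_unique {S : Finset V} {c : ℕ} {P : Finset (Finset V)} (hP : P ∈ partitions S c)
    {U U' : Finset V} (hU : U ∈ P) (hU' : U' ∈ P) {v : V} (hv : v ∈ U) (hv' : v ∈ U') : U = U' := by
  by_contra hne
  exact disjoint_left.1 ((mem_partitions.1 hP).1 hU hU' hne) hv hv'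

/-- `F` is the edge set of a forest whose components are the blocks in `P`. -/
def IsForestOn (P : Finset (Finset V)) (F : Finset (Sym2 V)) : Prop :=
  (∀ U ∈ P, F ∩ pairsIn U ∈ treesOn U) ∧ ∀ e ∈ F, ∃ U ∈ P, e ∈ pairsIn U

lemma edgesIn_fromEdgeSet {E : Finset (Sym2 V)} {A : Finset V} (hE : E ⊆ pairsIn A)
    (U : Finset V) : edgesIn (SimpleGraph.fromEdgeSet (E : Set (Sym2 V))) U = E ∩ pairsIn U := by
  rw [edgesIn, edges_fromEdgeSet (hE.trans (pairsIn_mono (subset_univ A)))]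

/-- A subset of the vertex set of a tree spans a forest. -/
lemma exists_isForestOn {A S : Finset V} (hS : S ⊆ A) {E : Finset (Sym2 V)} (hE : E ∈ treesOn A) :
    ∃ c, ∃ P ∈ partitions S c, IsForestOn P (E ∩ pairsIn S) := by
  classical
  set G := SimpleGraph.fromEdgeSet (E : Set (Sym2 V)) with hG
  set H := G.induce (S : Set V) with hH
  have hacyc : H.IsAcyclic := by
    refine (isTree_of_mem_treesOn hE).isAcyclic.comap
      (SimpleGraph.induceHomOfLE G (coe_subset.2 hS)).toHom ?_
    exact (SimpleGraph.induceHomOfLE G (coe_subset.2 hS)).injective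
  let blk : H.ConnectedComponent → Finset V := fun C =>
    univ.filter fun v => ∃ hv : v ∈ S, H.connectedComponentMk ⟨v, hv⟩ = C
  have hblk : ∀ C v, v ∈ blk C ↔ ∃ hv : v ∈ S, H.connectedComponentMk ⟨v, hv⟩ = C := by
    intro C v
    simp [blk]
  let P : Finset (Finset V) := S.attach.image fun v => blk (H.connectedComponentMk ⟨v.1, v.2⟩)
  have hPmem : ∀ U, U ∈ P ↔ ∃ v, ∃ hv : v ∈ S, blk (H.connectedComponentMk ⟨v, hv⟩) = U := by
    intro U
    simp [P]
  refine ⟨P.card, P, mem_partitions.2 ⟨?_, ?_, ?_, rfl⟩, ?_, ?_⟩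
  · intro U hU U' hU' hne
    obtain ⟨v, hv, rfl⟩ := (hPmem U).1 hU
    obtain ⟨v', hv', rfl⟩ := (hPmem U').1 hU'
    rw [Function.onFun, id, id, disjoint_left]
    intro u hu hu'
    obtain ⟨h1, h2⟩ := (hblk _ u).1 hu
    obtain ⟨h3, h4⟩ := (hblk _ u).1 hu'
    exact hne (by rw [← h2, ← h4])
  · ext v
    simp only [mem_biUnion, id]
    constructor
    · rintro ⟨U, hU, hv⟩
      obtain ⟨w, hw, rfl⟩ := (hPmem U).1 hU
      exact ((hblk _ v).1 hv).1
    · intro hv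
      exact ⟨_, (hPmem _).2 ⟨v, hv, rfl⟩, (hblk _ v).2 ⟨hv, rfl⟩⟩
  · intro h
    obtain ⟨v, hv, h⟩ := (hPmem _).1 h
    have : v ∈ blk (H.connectedComponentMk ⟨v, hv⟩) := (hblk _ v).2 ⟨hv, rfl⟩
    rw [h] at this
    exact notMem_empty _ this
  · intro U hU
    obtain ⟨v, hv, rfl⟩ := (hPmem U).1 hU
    set C := H.connectedComponentMk ⟨v, hv⟩ with hC
    have hUS : blk C ⊆ S := fun u hu => ((hblk _ u).1 hu).1
    have htree := hacyc.isTree_connectedComponent C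
    let φ : C.toSimpleGraph ≃g G.induce (blk C : Set V) :=
      { toFun := fun x => ⟨x.1.1, (hblk C _).2 ⟨x.1.2, x.2⟩⟩
        invFun := fun y => ⟨⟨y.1, hUS y.2⟩, ((hblk C _).1 y.2).2⟩
        left_inv := fun x => rfl
        right_inv := fun y => rfl
        map_rel_iff' := Iff.rfl }
    rw [inter_assoc, inter_eq_right.2 (pairsIn_mono hUS),
      ← edgesIn_fromEdgeSet (subset_pairsIn_of_mem_treesOn hE), ← induce_isTree_iff]
    exact φ.isTree_iff.1 htree
  · intro e he
    induction e with
    | _ u v =>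
      obtain ⟨h1, h2⟩ := mem_inter.1 he
      obtain ⟨hu, hv, huv⟩ := mem_pairsIn.1 h2
      have hadj : H.Adj ⟨u, hu⟩ ⟨v, hv⟩ := by
        rw [hH, hG, SimpleGraph.comap_adj, SimpleGraph.fromEdgeSet_adj]
        exact ⟨h1, huv⟩
      refine ⟨_, (hPmem _).2 ⟨u, hu, rfl⟩, mem_pairsIn.2 ⟨(hblk _ u).2 ⟨hu, rfl⟩,
        (hblk _ v).2 ⟨hv, ?_⟩, huv⟩⟩
      exact (SimpleGraph.ConnectedComponent.eq.2 hadj.reachable).symm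

lemma IsForestOn.eq_biUnion {P : Finset (Finset V)} {F : Finset (Sym2 V)} (hF : IsForestOn P F) :
    F = P.biUnion fun U => F ∩ pairsIn U := by
  ext e
  simp only [mem_biUnion, mem_inter]
  exact ⟨fun h => (hF.2 e h).imp fun U hU => ⟨hU.1, h, hU.2⟩, fun ⟨_, _, h, _⟩ => h⟩

/-- A forest with `c` components on `l` vertices has `l - c` edges. -/
lemma IsForestOn.card_add {S : Finset V} {c : ℕ} {P : Finset (Finset V)}
    (hP : P ∈ partitions S c) {F : Finset (Sym2 V)} (hF : IsForestOn P F) :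
    F.card + c = S.card := by
  obtain ⟨hd, hS, -, hc⟩ := mem_partitions.1 hP
  have h1 : F.card = ∑ U ∈ P, (F ∩ pairsIn U).card := by
    conv_lhs => rw [hF.eq_biUnion]
    refine card_biUnion fun U hU U' hU' hne => ?_
    refine disjoint_of_subset_left inter_subset_right (disjoint_of_subset_right inter_subset_right ?_)
    rw [disjoint_left]
    intro e h1 h2
    induction e with
    | _ u v => exact hne (block_unique hP hU hU' (mem_pairsIn.1 h1).1 (mem_pairsIn.1 h2).1)
  have h2 : S.card = ∑ U ∈ P, U.card := by
    rw [← hS]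
    exact card_biUnion fun U hU U' hU' hne => hd hU hU' hne
  rw [h1, h2, ← hc, card_eq_sum_ones, ← sum_add_distrib]
  exact sum_congr rfl fun U hU => card_add_one_of_mem_treesOn (hF.1 U hU)

/-- In a tree with root outside `S`, every component of the forest spanned by `S` has exactly one
vertex whose parent is outside the component, and this parent is not in `S`. -/
lemma exists_top {A S : Finset V} {c : ℕ} {P : Finset (Finset V)} (hS : S ⊆ A)
    (hP : P ∈ partitions S c) {E : Finset (Sym2 V)} (hF : IsForestOn P (E ∩ pairsIn S)) {ρ : V}
    (hρ : ρ ∈ A \ S) {f : V → V} (hf : IsParentMap A ρ f) (hfE : parentEdges A ρ f = E)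
    {U : Finset V} (hU : U ∈ P) :
    ∃ t ∈ U, f t ∈ A \ S ∧ ∀ u ∈ U, u ≠ t → f u ∈ U := by
  have hUS := subset_of_mem_partitions hP hU
  have hUA : U ⊆ A.erase ρ := by
    intro u hu
    refine mem_erase.2 ⟨?_, hS (hUS hu)⟩
    rintro rfl
    exact (Finset.mem_sdiff.1 hρ).2 (hUS hu)
  have htree := hF.1 U hU
  rw [inter_assoc, inter_eq_right.2 (pairsIn_mono hUS)] at htree
  -- The edges of the tree inside U are exactly the parent edges of the elements of D. There are |U|
  -- - 1 of them, so a single vertex of U has its parent outside U.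
  set D := U.filter fun u => f u ∈ U with hD
  have hDU : D ⊆ U := filter_subset _ _
  have himg : D.image (fun v => s(v, f v)) = E ∩ pairsIn U := by
    ext e
    rw [mem_image, mem_inter]
    constructor
    · rintro ⟨v, hv, rfl⟩
      obtain ⟨hv1, hv2⟩ := mem_filter.1 hv
      have hmem : s(v, f v) ∈ parentEdges A ρ f := mem_image.2 ⟨v, hUA hv1, rfl⟩
      refine ⟨hfE ▸ hmem, mem_pairsIn.2 ⟨hv1, hv2, ?_⟩⟩
      exact (mem_pairsIn.1 (hf.parentEdges_subset hmem)).2.2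
    · rintro ⟨h1, h2⟩
      rw [← hfE] at h1
      obtain ⟨v, hv, rfl⟩ := mem_image.1 h1
      obtain ⟨h3, h4, -⟩ := mem_pairsIn.1 h2
      exact ⟨v, mem_filter.2 ⟨h3, h4⟩, rfl⟩
  have hDcard : D.card + 1 = U.card := by
    rw [← card_add_one_of_mem_treesOn htree, ← himg, card_image_of_injOn]
    exact hf.injOn.mono (coe_subset.2 (hDU.trans hUA))
  have hone : (U \ D).card = 1 := by
    rw [card_sdiff_of_subset hDU]; omega
  obtain ⟨t, ht⟩ := card_eq_one.1 hone
  have htm : t ∈ U \ D := ht ▸ mem_singleton_self t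
  obtain ⟨htU, htD⟩ := Finset.mem_sdiff.1 htm
  refine ⟨t, htU, ?_, ?_⟩
  · refine Finset.mem_sdiff.2 ⟨hf.1 t (hUA htU), fun hfS => ?_⟩
    have hmem : s(t, f t) ∈ parentEdges A ρ f := mem_image.2 ⟨t, hUA htU, rfl⟩
    have hne := (mem_pairsIn.1 (hf.parentEdges_subset hmem)).2.2
    obtain ⟨U', hU', he⟩ := hF.2 s(t, f t)
      (mem_inter.2 ⟨hfE ▸ hmem, mem_pairsIn.2 ⟨hUS htU, hfS, hne⟩⟩)
    obtain ⟨h1, h2, -⟩ := mem_pairsIn.1 he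
    rw [block_unique hP hU' hU h1 htU] at h2
    exact htD (mem_filter.2 ⟨htU, h2⟩)
  · intro u hu hne
    by_contra hc
    have : u ∈ U \ D := Finset.mem_sdiff.2 ⟨hu, fun h => hc (mem_filter.1 h).2⟩
    rw [ht, mem_singleton] at this
    exact hne this

open scoped Classical in
/-- Sends the elements of a block to the vertex to which the block is attached. -/
def attachMap (P : Finset (Finset V)) (a : ∀ U ∈ P, V × V) (u : V) : V :=
  if h : ∃ U, ∃ _ : U ∈ P, u ∈ U then (a h.choose h.choose_spec.choose).2 else u

lemma attachMap_of_mem {S : Finset V} {c : ℕ} {P : Finset (Finset V)} (hP : P ∈ partitions S c)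
    (a : ∀ U ∈ P, V × V) {U : Finset V} (hU : U ∈ P) {u : V} (hu : u ∈ U) :
    attachMap P a u = (a U hU).2 := by
  have h : ∃ U, ∃ _ : U ∈ P, u ∈ U := ⟨U, hU, hu⟩
  rw [attachMap, dif_pos h]
  have : h.choose = U :=
    block_unique hP h.choose_spec.choose hU h.choose_spec.choose_spec hu
  congr 2

lemma attachMap_of_notMem {S : Finset V} {c : ℕ} {P : Finset (Finset V)} (hP : P ∈ partitions S c)
    (a : ∀ U ∈ P, V × V) {u : V} (hu : u ∉ S) : attachMap P a u = u := by
  rw [attachMap, dif_neg]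
  rintro ⟨U, hU, h⟩
  exact hu (subset_of_mem_partitions hP hU h)

/-- The number of trees on `A` that extend a given forest on `S` without further edges in `S`. -/
lemma card_trees_extending_le {A S : Finset V} {c : ℕ} {P : Finset (Finset V)} (hS : S ⊆ A)
    (hR : (A \ S).Nonempty) (hP : P ∈ partitions S c) {F : Finset (Sym2 V)} (hF : IsForestOn P F) :
    ((treesOn A).filter fun E => E ∩ pairsIn S = F).card * (A \ S).card ≤
      (∏ U ∈ P, U.card) * (A \ S).card ^ c * A.card ^ ((A \ S).card - 1) := by
  classical
  set R := A \ S with hRdef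
  set X := (treesOn A).filter fun E => E ∩ pairsIn S = F with hX
  have hdisj : ∀ v ∈ R, v ∉ S := fun v hv => (Finset.mem_sdiff.1 hv).2
  have hRA : R ⊆ A := sdiff_subset
  have hex : ∀ x ∈ X ×ˢ R, ∃ f : V → V, ∃ t : Finset V → V,
      IsParentMap A x.2 f ∧ parentEdges A x.2 f = x.1 ∧
      ∀ U ∈ P, t U ∈ U ∧ f (t U) ∈ R ∧ ∀ u ∈ U, u ≠ t U → f u ∈ U := by
    rintro ⟨E, ρ⟩ hx
    obtain ⟨hE, hρ⟩ := mem_product.1 hx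
    obtain ⟨hE, hEF⟩ := mem_filter.1 hE
    obtain ⟨f, hf, hfE⟩ := exists_isParentMap hE (hRA hρ)
    have htop : ∀ U ∈ P, ∃ t, t ∈ U ∧ f t ∈ R ∧ ∀ u ∈ U, u ≠ t → f u ∈ U := by
      intro U hU
      obtain ⟨t, h1, h2, h3⟩ := exists_top hS hP (E := E) (hEF ▸ hF) hρ hf hfE hU
      exact ⟨t, h1, h2, h3⟩
    have : Nonempty V := ⟨ρ⟩
    choose! t ht using htop
    exact ⟨f, t, hf, hfE, ht⟩
  have : Nonempty V := ⟨hR.choose⟩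
  choose! f t hf hfE ht using hex
  have hmaps : ∀ a ∈ P.pi fun U => U ×ˢ R, ∀ v ∈ A, attachMap P a v ∈ R := by
    intro a ha v hv
    by_cases hvS : v ∈ S
    · obtain ⟨U, hU, hvU⟩ := exists_block hP hvS
      rw [attachMap_of_mem hP a hU hvU]
      exact (mem_product.1 (mem_pi.1 ha U hU)).2
    · rw [attachMap_of_notMem hP a hvS]
      exact Finset.mem_sdiff.2 ⟨hv, hvS⟩
  -- A pair (E, ρ) with ρ in R is encoded by two data. The first is, for each block, its top vertex
  -- and the vertex of R to which the top is attached: ∏|U| · |R|^c choices. The second is the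
  -- parent map on R, with values in A. Contracting each block to its attachment point makes the
  -- latter a rooted forest with |R| - 1 edges: |A|^(|R|-1) choices.
  have hcard : ((P.pi fun U => U ×ˢ R).sigma fun a =>
      rootedForests A R (attachMap P a) (R.card - 1)).card =
      (∏ U ∈ P, U.card) * R.card ^ c * A.card ^ (R.card - 1) := by
    have hRpos := card_pos.2 hR
    rw [card_sigma, sum_congr rfl fun a ha => card_rootedForests (hmaps a ha) _ (by omega),
      sum_const, card_pi, Nat.choose_self, one_mul, smul_eq_mul]
    congr 1
    simp_rw [card_product]
    rw [prod_mul_distrib, prod_const, (mem_partitions.1 hP).2.2.2]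
  rw [← card_product, ← hcard]
  -- Besides F, the tree has only the edges above the tops of the blocks and the parent edges of
  -- vertices of R. It can thus be read off from its code.
  have htree : ∀ x ∈ X ×ˢ R, ∀ e, e ∈ x.1 ↔ e ∈ F ∨ (∃ U ∈ P, e = s(t x U, f x (t x U))) ∨
      ∃ v ∈ R.erase x.2, e = s(v, f x v) := by
    rintro ⟨E, ρ⟩ hx e
    have hEF : E ∩ pairsIn S = F := (mem_filter.1 (mem_product.1 hx).1).2
    have hρ : ρ ∈ R := (mem_product.1 hx).2
    have hpe := hfE _ hx
    have hpm := hf _ hx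
    have htx := ht _ hx
    set g := f (E, ρ)
    set τ := t (E, ρ)
    change parentEdges A ρ g = E at hpe
    change IsParentMap A ρ g at hpm
    change e ∈ E ↔ e ∈ F ∨ _ ∨ ∃ v ∈ R.erase ρ, _
    have hin : ∀ v ∈ A.erase ρ, s(v, g v) ∈ E := fun v hv => by
      rw [← hpe]; exact mem_image.2 ⟨v, hv, rfl⟩
    constructor
    · intro he
      rw [← hpe] at he
      obtain ⟨v, hv, rfl⟩ := mem_image.1 he
      by_cases hvS : v ∈ S
      · obtain ⟨U, hU, hvU⟩ := exists_block hP hvS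
        by_cases hvt : v = τ U
        · exact Or.inr (Or.inl ⟨U, hU, by rw [hvt]⟩)
        · left
          rw [← hEF]
          refine mem_inter.2 ⟨hin v hv, mem_pairsIn.2 ⟨hvS,
            subset_of_mem_partitions hP hU ((htx U hU).2.2 v hvU hvt), ?_⟩⟩
          exact (mem_pairsIn.1 (hpm.parentEdges_subset he)).2.2
      · right; right
        exact ⟨v, mem_erase.2 ⟨(mem_erase.1 hv).1, Finset.mem_sdiff.2 ⟨mem_of_mem_erase hv, hvS⟩⟩,
          rfl⟩
    · rintro (h | ⟨U, hU, rfl⟩ | ⟨v, hv, rfl⟩)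
      · rw [← hEF] at h
        exact (mem_inter.1 h).1
      · have htU := subset_of_mem_partitions hP hU (htx U hU).1
        refine hin _ (mem_erase.2 ⟨?_, hS htU⟩)
        intro hc
        exact hdisj ρ hρ (hc ▸ htU)
      · exact hin v (mem_erase.2 ⟨(mem_erase.1 hv).1, hRA (mem_of_mem_erase hv)⟩)
  refine card_le_card_of_injOn (fun x => ⟨fun U _ => (t x U, f x (t x U)),
    fun v => if v ∈ R.erase x.2 then some (f x v) else none⟩) ?_ ?_
  · rintro ⟨E, ρ⟩ hx
    have hx : (E, ρ) ∈ X ×ˢ R := hx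
    have hρ : ρ ∈ R := (mem_product.1 hx).2
    have hpm := hf _ hx
    have htx := ht _ hx
    rw [mem_coe, mem_sigma]
    dsimp only
    set g := f (E, ρ)
    set τ := t (E, ρ)
    change IsParentMap A ρ g at hpm
    have ha : (fun U (_ : U ∈ P) => (τ U, g (τ U))) ∈ P.pi fun U => U ×ˢ R :=
      mem_pi.2 fun U hU => mem_product.2 ⟨(htx U hU).1, (htx U hU).2.1⟩
    have hAer : ∀ v ∈ R.erase ρ, v ∈ A.erase ρ := fun v hv =>
      mem_erase.2 ⟨(mem_erase.1 hv).1, hRA (mem_of_mem_erase hv)⟩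
    refine ⟨ha, mem_rootedForests.2 ⟨?_, ?_⟩⟩
    · obtain ⟨hgA, h, hh⟩ := hpm
      refine ⟨fun v w hvw => ?_, h, fun v w hvw => ?_⟩
      · dsimp only at hvw
        split_ifs at hvw with hv
        rw [← Option.some.inj hvw]
        exact ⟨mem_of_mem_erase hv, hgA v (hAer v hv)⟩
      · dsimp only at hvw
        split_ifs at hvw with hv
        have hw : g v = w := Option.some.inj hvw
        have h1 := hh v (hAer v hv)
        rw [hw] at h1
        by_cases hwS : w ∈ S
        · obtain ⟨U, hU, hwU⟩ := exists_block hP hwS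
          rw [attachMap_of_mem hP _ hU hwU]
          have hUA : ∀ u ∈ U, u ∈ A.erase ρ := by
            intro u hu
            have huS := subset_of_mem_partitions hP hU hu
            refine mem_erase.2 ⟨?_, hS huS⟩
            rintro rfl
            exact hdisj _ hρ huS
          -- Parents stay inside the block until the top is reached, so the top is lowest in its
          -- block and the attachment point is lower still. The height therefore decreases along the
          -- contracted map as well.
          have hdesc : ∀ m, ∀ u ∈ U, h u ≤ m → h (τ U) ≤ h u := by
            intro m
            induction m with
            | zero =>
              intro u hu hm
              have := hh u (hUA u hu)
              omega
            | succ m ih =>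
              intro u hu hm
              by_cases hut : u = τ U
              · rw [hut]
              · have h2 := hh u (hUA u hu)
                have h3 := ih (g u) ((htx U hU).2.2 u hu hut) (by omega)
                omega
          have h2 := hdesc _ w hwU le_rfl
          have h3 := hh (τ U) (hUA _ (htx U hU).1)
          dsimp only
          omega
        · rw [attachMap_of_notMem hP _ hwS]
          exact h1
    · rw [← card_erase_of_mem hρ]
      congr 1
      ext v
      rw [mem_definedAt]
      by_cases hv : v ∈ R.erase ρ <;> simp [hv]
  · rintro ⟨E, ρ⟩ hx ⟨E', ρ'⟩ hx' heq
    have hx : (E, ρ) ∈ X ×ˢ R := hx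
    have hx' : (E', ρ') ∈ X ×ˢ R := hx'
    simp only [Sigma.mk.injEq, heq_eq_eq] at heq
    obtain ⟨ha, hφ⟩ := heq
    have hρ : ρ = ρ' := by
      by_contra hne
      have h1 := congrFun hφ ρ
      have h2 : ρ ∈ R.erase ρ' := mem_erase.2 ⟨hne, (mem_product.1 hx).2⟩
      simp [h2] at h1
    subst hρ
    have hE : E = E' := by
      ext e
      have h1 := htree _ hx e
      have h2 := htree _ hx' e
      simp only at h1 h2
      rw [h1, h2]
      have h3 : ∀ U ∈ P, s(t (E, ρ) U, f (E, ρ) (t (E, ρ) U)) =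
          s(t (E', ρ) U, f (E', ρ) (t (E', ρ) U)) := by
        intro U hU
        have := congrFun (congrFun ha U) hU
        simp only [Prod.mk.injEq] at this
        rw [this.2, this.1]
      have h4 : ∀ v ∈ R.erase ρ, f (E, ρ) v = f (E', ρ) v := by
        intro v hv
        have := congrFun hφ v
        rw [if_pos hv, if_pos hv] at this
        exact Option.some.inj this
      refine or_congr Iff.rfl (or_congr ?_ ?_)
      · exact exists_congr fun U => and_congr_right fun hU => by rw [h3 U hU]
      · exact exists_congr fun v => and_congr_right fun hv => by rw [h4 v hv]
    rw [hE]

end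

section

variable {V : Type*} [Fintype V] [DecidableEq V]

/-! ### Pairs of trees that agree on the intersection of their vertex sets -/

/-- The number of partitions of `S` into `c` blocks together with a self-map of each block; this is
also the number of forests on `S` with `c` components and two marked vertices in each component. -/
def blockSum (S : Finset V) (c : ℕ) : ℝ :=
  ∑ P ∈ partitions S c, ∏ U ∈ P, (U.card : ℝ) ^ U.card

lemma erase_mem_partitions {S : Finset V} {c : ℕ} {P : Finset (Finset V)}
    (hP : P ∈ partitions S (c + 1)) {U : Finset V} (hU : U ∈ P) :
    P.erase U ∈ partitions (S \ U) c := by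
  obtain ⟨h1, h2, h3, h4⟩ := mem_partitions.1 hP
  refine mem_partitions.2 ⟨h1.subset (coe_subset.2 (erase_subset _ _)), ?_,
    fun h => h3 (mem_of_mem_erase h), by rw [card_erase_of_mem hU, h4]; rfl⟩
  ext v
  simp only [mem_biUnion, mem_erase, id, Finset.mem_sdiff]
  constructor
  · rintro ⟨U', ⟨hne, hU'⟩, hv⟩
    exact ⟨subset_of_mem_partitions hP hU' hv, fun hvU => hne (block_unique hP hU' hU hv hvU)⟩
  · rintro ⟨hv, hvU⟩
    obtain ⟨U', hU', hv'⟩ := exists_block hP hv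
    exact ⟨U', ⟨by rintro rfl; exact hvU hv', hU'⟩, hv'⟩

/-- Double counting of partitions with a marked block: removing the marked block U leaves a
partition of the rest into c blocks. -/
lemma blockSum_succ_le (S : Finset V) (c : ℕ) :
    (c + 1) * blockSum S (c + 1) ≤
      ∑ U ∈ S.powerset.erase ∅, (U.card : ℝ) ^ U.card * blockSum (S \ U) c := by
  have h1 : (c + 1) * blockSum S (c + 1) =
      ∑ P ∈ partitions S (c + 1), ∑ U ∈ P,
        (U.card : ℝ) ^ U.card * ∏ U' ∈ P.erase U, (U'.card : ℝ) ^ U'.card := by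
    rw [blockSum, mul_sum]
    refine sum_congr rfl fun P hP => ?_
    rw [sum_congr rfl fun U hU => mul_prod_erase P (fun U => (U.card : ℝ) ^ U.card) hU, sum_const,
      (mem_partitions.1 hP).2.2.2, nsmul_eq_mul]
    push_cast
    rfl
  rw [h1, sum_comm' (t' := S.powerset.erase ∅)
    (s' := fun U => (partitions S (c + 1)).filter fun P => U ∈ P)]
  · refine sum_le_sum fun U hU => ?_
    rw [← mul_sum]
    refine mul_le_mul_of_nonneg_left ?_ (by positivity)
    have hinj : Set.InjOn (fun P : Finset (Finset V) => P.erase U)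
        ((partitions S (c + 1)).filter fun P => U ∈ P) := by
      intro P hP P' hP' h
      have h1 := (mem_filter.1 hP).2
      have h2 := (mem_filter.1 hP').2
      rw [← insert_erase h1, ← insert_erase h2]
      exact congrArg (insert U) h
    rw [← sum_image (f := fun P : Finset (Finset V) => ∏ U' ∈ P, (U'.card : ℝ) ^ U'.card) hinj]
    refine sum_le_sum_of_subset_of_nonneg ?_ fun _ _ _ => prod_nonneg fun _ _ => by positivity
    intro P hP
    obtain ⟨P', hP', rfl⟩ := mem_image.1 hP
    exact erase_mem_partitions (mem_filter.1 hP').1 (mem_filter.1 hP').2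
  · intro P U
    simp only [mem_filter, mem_erase, mem_powerset]
    constructor
    · rintro ⟨hP, hU⟩
      refine ⟨⟨hP, hU⟩, ?_, subset_of_mem_partitions hP hU⟩
      rintro rfl
      exact (mem_partitions.1 hP).2.2.1 hU
    · rintro ⟨h, -⟩
      exact h

/-- By Cayley's formula a block carries |U|^(|U|-2) trees, and the square supplies the missing |U|².
The case |U| = 1 is separate because the exponent is truncated there. -/
lemma card_forests_mul_le {S : Finset V} {c : ℕ} {P : Finset (Finset V)}
    (hP : P ∈ partitions S c) (X : Finset (Finset (Sym2 V))) (hX : ∀ F ∈ X, IsForestOn P F) :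
    (X.card : ℝ) * (∏ U ∈ P, (U.card : ℝ)) ^ 2 ≤ ∏ U ∈ P, (U.card : ℝ) ^ U.card := by
  have h1 : X.card ≤ ∏ U ∈ P, (treesOn U).card := by
    rw [← card_pi]
    refine card_le_card_of_injOn (fun F U _ => F ∩ pairsIn U) ?_ ?_
    · intro F hF
      exact mem_coe.2 (mem_pi.2 fun U hU => (hX F hF).1 U hU)
    · intro F hF F' hF' h
      rw [(hX F hF).eq_biUnion, (hX F' hF').eq_biUnion]
      exact biUnion_congr rfl fun U hU => congrFun (congrFun h U) hU
  calc (X.card : ℝ) * (∏ U ∈ P, (U.card : ℝ)) ^ 2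
      ≤ (∏ U ∈ P, ((treesOn U).card : ℝ)) * (∏ U ∈ P, (U.card : ℝ)) ^ 2 := by
        gcongr
        exact_mod_cast h1
    _ = ∏ U ∈ P, (U.card : ℝ) ^ U.card := by
        rw [← prod_pow, ← prod_mul_distrib]
        refine prod_congr rfl fun U hU => ?_
        have hne : U.Nonempty := by
          rw [nonempty_iff_ne_empty]
          rintro rfl
          exact (mem_partitions.1 hP).2.2.1 hU
        rw [card_treesOn U hne]
        have hpos := card_pos.2 hne
        rcases Nat.lt_or_ge U.card 2 with h | h
        · have : U.card = 1 := by omega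
          simp [this]
        · push_cast
          rw [← pow_add]
          congr 1
          omega

/-- The trees on `A` and on `B` that agree on `S`, weighted by a function of the number of
components of their restriction to `S`. -/
lemma sum_matching_le {A B S : Finset V} {k l r : ℕ} (hSA : S ⊆ A) (hSB : S ⊆ B) (hA : A.card = k)
    (hB : B.card = k) (hS : S.card = l) (hr : l + r = k) (hl : 1 ≤ l) (hr1 : 1 ≤ r) (g : ℕ → ℝ)
    (hg : ∀ c, 0 ≤ g c) :
    ∑ E₁ ∈ treesOn A, ∑ E₂ ∈ treesOn B with E₂ ∩ pairsIn S = E₁ ∩ pairsIn S,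
        g (l - (E₁ ∩ pairsIn S).card) ≤
      ∑ c ∈ Icc 1 l, blockSum S c * ((r : ℝ) ^ (c - 1) * (k : ℝ) ^ (r - 1)) ^ 2 * g c := by
  classical
  set res : Finset (Sym2 V) → Finset (Sym2 V) := fun E => E ∩ pairsIn S with hres
  set 𝓕 := (treesOn A).image res with hI
  have hcomp : ∀ F ∈ 𝓕, ∃ P ∈ partitions S (l - F.card), IsForestOn P F := by
    intro F hF
    obtain ⟨E, hE, rfl⟩ := mem_image.1 hF
    obtain ⟨c, P, hP, hPF⟩ := exists_isForestOn hSA hE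
    have := hPF.card_add hP
    refine ⟨P, ?_, hPF⟩
    rw [show l - (res E).card = c by simp only [hres]; omega]
    exact hP
  choose! part hpart hforest using hcomp
  have hc1 : ∀ F ∈ 𝓕, l - F.card ∈ Icc 1 l := by
    intro F hF
    rw [mem_Icc]
    refine ⟨?_, Nat.sub_le _ _⟩
    have h1 := hpart F hF
    by_contra hlt
    have h0 : (part F).card = 0 := by rw [(mem_partitions.1 h1).2.2.2]; omega
    have h2 := (mem_partitions.1 h1).2.1
    rw [card_eq_zero.1 h0, biUnion_empty] at h2
    rw [← h2, card_empty] at hS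
    omega
  -- The extension bound serves both A and B. Its left side counts trees with a root in C \ S, and
  -- dividing by these r roots turns r^c into r^(c-1).
  have hN : ∀ (C : Finset V), S ⊆ C → C.card = k → ∀ F ∈ 𝓕,
      (((treesOn C).filter fun E => res E = F).card : ℝ) ≤
        (∏ U ∈ part F, (U.card : ℝ)) * ((r : ℝ) ^ (l - F.card - 1) * (k : ℝ) ^ (r - 1)) := by
    intro C hSC hC F hF
    have hR : (C \ S).card = r := by rw [card_sdiff_of_subset hSC]; omega
    have hne : (C \ S).Nonempty := by rw [← card_pos]; omega
    have h := card_trees_extending_le hSC hne (hpart F hF) (hforest F hF)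
    rw [hR, hC] at h
    have hr0 : (0 : ℝ) < r := by exact_mod_cast hr1
    have h' : (((treesOn C).filter fun E => res E = F).card : ℝ) * r ≤
        (∏ U ∈ part F, (U.card : ℝ)) * (r : ℝ) ^ (l - F.card) * (k : ℝ) ^ (r - 1) := by
      exact_mod_cast h
    refine le_of_mul_le_mul_right (h'.trans_eq ?_) hr0
    have h1 := (mem_Icc.1 (hc1 F hF)).1
    rw [show l - F.card = (l - F.card - 1) + 1 by omega, pow_succ, Nat.add_sub_cancel]
    ring
  calc ∑ E₁ ∈ treesOn A, ∑ E₂ ∈ treesOn B with res E₂ = res E₁, g (l - (res E₁).card)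
      = ∑ F ∈ 𝓕, (((treesOn A).filter fun E => res E = F).card : ℝ) *
          (((treesOn B).filter fun E => res E = F).card : ℝ) * g (l - F.card) := by
        rw [← sum_fiberwise_of_maps_to (g := res) (t := 𝓕) fun E hE => mem_image_of_mem _ hE]
        refine sum_congr rfl fun F hF => ?_
        rw [sum_congr rfl (g := fun _ => (((treesOn B).filter fun E => res E = F).card : ℝ) *
          g (l - F.card))]
        · rw [sum_const, nsmul_eq_mul, mul_assoc]
        · intro E hE
          rw [sum_const, nsmul_eq_mul, (mem_filter.1 hE).2]
    _ ≤ ∑ F ∈ 𝓕, (∏ U ∈ part F, (U.card : ℝ)) ^ 2 *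
          ((r : ℝ) ^ (l - F.card - 1) * (k : ℝ) ^ (r - 1)) ^ 2 * g (l - F.card) := by
        refine sum_le_sum fun F hF => mul_le_mul_of_nonneg_right ?_ (hg _)
        rw [← mul_pow, sq]
        have hnn : (0 : ℝ) ≤ ∏ U ∈ part F, (U.card : ℝ) := prod_nonneg fun _ _ => by positivity
        have hnn' : (0 : ℝ) ≤ (r : ℝ) ^ (l - F.card - 1) * (k : ℝ) ^ (r - 1) := by positivity
        exact mul_le_mul (hN A hSA hA F hF) (hN B hSB hB F hF) (Nat.cast_nonneg _)
          (mul_nonneg hnn hnn')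
    _ = ∑ c ∈ Icc 1 l, (∑ F ∈ 𝓕 with l - F.card = c, (∏ U ∈ part F, (U.card : ℝ)) ^ 2) *
          ((r : ℝ) ^ (c - 1) * (k : ℝ) ^ (r - 1)) ^ 2 * g c := by
        rw [← sum_fiberwise_of_maps_to (g := fun F => l - F.card) (t := Icc 1 l) hc1]
        refine sum_congr rfl fun c hc => ?_
        rw [sum_mul, sum_mul]
        refine sum_congr rfl fun F hF => ?_
        rw [(mem_filter.1 hF).2]
    _ ≤ _ := by
        refine sum_le_sum fun c hc => ?_
        refine mul_le_mul_of_nonneg_right (mul_le_mul_of_nonneg_right ?_ (by positivity)) (hg c)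
        have hmaps : ∀ F ∈ 𝓕.filter fun F => l - F.card = c, part F ∈ partitions S c := by
          intro F hF
          obtain ⟨h1, h2⟩ := mem_filter.1 hF
          rw [← h2]
          exact hpart F h1
        -- The two extension counts give (∏|U|)² for each forest, and by `card_forests_mul_le` all
        -- forests with the same blocks together give at most ∏|U|^|U|.
        rw [← sum_fiberwise_of_maps_to hmaps, blockSum]
        refine sum_le_sum fun P hP => ?_
        rw [sum_congr rfl (g := fun _ => (∏ U ∈ P, (U.card : ℝ)) ^ 2) fun F hF => by
          rw [(mem_filter.1 hF).2], sum_const, nsmul_eq_mul]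
        refine card_forests_mul_le hP _ fun F hF => ?_
        obtain ⟨h1, h2⟩ := mem_filter.1 hF
        rw [← h2]
        exact hforest F (mem_filter.1 h1).1

end

section

variable {V : Type*} [Fintype V] [DecidableEq V] {p : ℝ}

/-! ### Independence -/

/-- The graph property `P` is determined by the edges in `D`. -/
def DependsOn (D : Finset (Sym2 V)) (P : SimpleGraph V → Prop) : Prop :=
  ∀ G G' : SimpleGraph V, edges G ∩ D = edges G' ∩ D → (P G ↔ P G')

lemma DependsOn.mono {D D' : Finset (Sym2 V)} {P : SimpleGraph V → Prop} (h : DependsOn D P)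
    (hD : D ⊆ D') : DependsOn D' P := by
  intro G G' hG
  refine h G G' ?_
  rw [← inter_eq_right.2 hD, ← inter_assoc, ← inter_assoc, hG]

lemma DependsOn.and {D D' : Finset (Sym2 V)} {P Q : SimpleGraph V → Prop} (hP : DependsOn D P)
    (hQ : DependsOn D' Q) : DependsOn (D ∪ D') fun G => P G ∧ Q G := fun G G' hG =>
  and_congr (hP.mono subset_union_left G G' hG) (hQ.mono subset_union_right G G' hG)

lemma inter_eq_iff {X D E : Finset (Sym2 V)} (hE : E ⊆ D) :
    X ∩ D = E ↔ E ⊆ X ∧ Disjoint (D \ E) X := by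
  constructor
  · rintro rfl
    refine ⟨inter_subset_left, ?_⟩
    rw [disjoint_left]
    intro e he h
    rw [Finset.mem_sdiff, mem_inter] at he
    exact he.2 ⟨h, he.1⟩
  · rintro ⟨h1, h2⟩
    ext e
    rw [mem_inter]
    refine ⟨fun h => ?_, fun h => ⟨h1 h, hE h⟩⟩
    by_contra hc
    exact disjoint_left.1 h2 (Finset.mem_sdiff.2 ⟨h.2, hc⟩) h.1

lemma pr_inter_eq {D E : Finset (Sym2 V)} (hD : D ⊆ pairsIn univ) (hE : E ⊆ D) :
    pr p (fun G : SimpleGraph V => edges G ∩ D = E) = p ^ E.card * (1 - p) ^ (D.card - E.card) := by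
  simp_rw [inter_eq_iff hE]
  rw [pr_cylinder (hE.trans hD) (sdiff_subset.trans hD) disjoint_sdiff, card_sdiff_of_subset hE]

open scoped Classical in
/-- The edge sets in `D` for which `P` holds. -/
def patterns (D : Finset (Sym2 V)) (P : SimpleGraph V → Prop) : Finset (Finset (Sym2 V)) :=
  D.powerset.filter fun E => P (SimpleGraph.fromEdgeSet (E : Set (Sym2 V)))

lemma DependsOn.iff_exists {D : Finset (Sym2 V)} (hD : D ⊆ pairsIn univ)
    {P : SimpleGraph V → Prop} (hP : DependsOn D P) (G : SimpleGraph V) :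
    P G ↔ ∃ E ∈ patterns D P, edges G ∩ D = E := by
  have key : P G ↔ P (SimpleGraph.fromEdgeSet ((edges G ∩ D : Finset (Sym2 V)) : Set (Sym2 V))) := by
    refine hP _ _ ?_
    rw [edges_fromEdgeSet (inter_subset_right.trans hD), inter_assoc, inter_self]
  constructor
  · intro h
    refine ⟨_, ?_, rfl⟩
    simp only [patterns, mem_filter, mem_powerset]
    exact ⟨inter_subset_right, key.1 h⟩
  · rintro ⟨E, hE, rfl⟩
    simp only [patterns, mem_filter, mem_powerset] at hE
    exact key.2 hE.2

lemma DependsOn.pr_eq {D : Finset (Sym2 V)} (hD : D ⊆ pairsIn univ)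
    {P : SimpleGraph V → Prop} (hP : DependsOn D P) :
    pr p P = ∑ E ∈ patterns D P, p ^ E.card * (1 - p) ^ (D.card - E.card) := by
  rw [show P = fun G => ∃ E ∈ patterns D P, edges G ∩ D = E from
    funext fun G => propext (hP.iff_exists hD G), pr_exists_eq]
  · rw [show (fun G => ∃ E ∈ patterns D P, edges G ∩ D = E) = P from
      funext fun G => propext (hP.iff_exists hD G).symm]
    refine sum_congr rfl fun E hE => pr_inter_eq hD ?_
    simp only [patterns, mem_filter, mem_powerset] at hE
    exact hE.1
  · rintro G E - E' - rfl rfl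
    rfl

/-- Properties that depend on disjoint sets of pairs are independent. -/
lemma pr_and_of_disjoint {D D' : Finset (Sym2 V)} (hD : D ⊆ pairsIn univ)
    (hD' : D' ⊆ pairsIn univ) (hdisj : Disjoint D D') {P Q : SimpleGraph V → Prop}
    (hP : DependsOn D P) (hQ : DependsOn D' Q) :
    pr p (fun G => P G ∧ Q G) = pr p P * pr p Q := by
  have h1 : (fun G => P G ∧ Q G) = fun G => ∃ x ∈ patterns D P ×ˢ patterns D' Q,
      edges G ∩ D = x.1 ∧ edges G ∩ D' = x.2 := by
    funext G
    rw [hP.iff_exists hD G, hQ.iff_exists hD' G]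
    refine propext ⟨?_, ?_⟩
    · rintro ⟨⟨E, hE, h1⟩, E', hE', h2⟩
      exact ⟨(E, E'), mem_product.2 ⟨hE, hE'⟩, h1, h2⟩
    · rintro ⟨⟨E, E'⟩, hx, h1, h2⟩
      exact ⟨⟨E, (mem_product.1 hx).1, h1⟩, E', (mem_product.1 hx).2, h2⟩
  rw [h1, pr_exists_eq, hP.pr_eq hD, hQ.pr_eq hD', sum_mul_sum, ← sum_product']
  · refine sum_congr rfl fun x hx => ?_
    obtain ⟨hE, hE'⟩ := mem_product.1 hx
    simp only [patterns, mem_filter, mem_powerset] at hE hE'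
    have h2 : (fun G : SimpleGraph V => edges G ∩ D = x.1 ∧ edges G ∩ D' = x.2) =
        fun G => x.1 ∪ x.2 ⊆ edges G ∧ Disjoint ((D \ x.1) ∪ (D' \ x.2)) (edges G) := by
      funext G
      rw [inter_eq_iff hE.1, inter_eq_iff hE'.1, union_subset_iff, disjoint_union_left]
      exact propext ⟨fun h => ⟨⟨h.1.1, h.2.1⟩, h.1.2, h.2.2⟩, fun h => ⟨⟨h.1.1, h.2.1⟩, h.1.2, h.2.2⟩⟩
    have hx12 : Disjoint x.1 x.2 := disjoint_of_subset_left hE.1 (disjoint_of_subset_right hE'.1 hdisj)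
    rw [h2, pr_cylinder (union_subset (hE.1.trans hD) (hE'.1.trans hD'))
      (union_subset (sdiff_subset.trans hD) (sdiff_subset.trans hD')),
      card_union_of_disjoint hx12, card_union_of_disjoint
        (disjoint_of_subset_left sdiff_subset (disjoint_of_subset_right sdiff_subset hdisj)),
      card_sdiff_of_subset hE.1, card_sdiff_of_subset hE'.1]
    · ring
    · rw [disjoint_union_left, disjoint_union_right, disjoint_union_right]
      exact ⟨⟨disjoint_sdiff, disjoint_of_subset_left hE.1 (disjoint_of_subset_right sdiff_subset hdisj)⟩,
        disjoint_of_subset_left hE'.1 (disjoint_of_subset_right sdiff_subset hdisj.symm),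
        disjoint_sdiff⟩
  · rintro G ⟨E, E'⟩ - ⟨E₂, E₂'⟩ - ⟨h1, h2⟩ ⟨h3, h4⟩
    simp only at h1 h2 h3 h4
    rw [← h1, ← h2, ← h3, ← h4]

/-! ### The vertices outside an induced tree -/

/-- The probability that a given set of `k` vertices induces a tree. -/
def treeProb (p : ℝ) (k : ℕ) : ℝ :=
  (k : ℝ) ^ (k - 2) * (p ^ (k - 1) * (1 - p) ^ (k.choose 2 - (k - 1)))

lemma dependsOn_edgesIn (A : Finset V) (Q : Finset (Sym2 V) → Prop) :
    DependsOn (pairsIn A) fun G => Q (edgesIn G A) := by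
  intro G G' h
  simp only [edgesIn, h]

lemma pairsIn_subset_univ (A : Finset V) : pairsIn A ⊆ pairsIn univ := pairsIn_mono (subset_univ A)

lemma pr_edgesIn_mem_treesOn {A : Finset V} (hA : A.Nonempty) :
    pr p (fun G => edgesIn G A ∈ treesOn A) = treeProb p A.card := by
  have h1 : (fun G : SimpleGraph V => edgesIn G A ∈ treesOn A) =
      fun G => ∃ E ∈ treesOn A, edges G ∩ pairsIn A = E := by
    funext G
    simp [edgesIn]
  rw [h1, pr_exists_eq, sum_congr rfl (g := fun _ => p ^ (A.card - 1) *
    (1 - p) ^ (A.card.choose 2 - (A.card - 1))), sum_const, card_treesOn A hA, nsmul_eq_mul, treeProb]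
  · push_cast; rfl
  · intro E hE
    have := card_add_one_of_mem_treesOn hE
    rw [pr_inter_eq (pairsIn_subset_univ A) (subset_pairsIn_of_mem_treesOn hE), card_pairsIn,
      show E.card = A.card - 1 by omega]
  · rintro G E - E' - rfl rfl
    rfl

open scoped Classical in
/-- The neighbours of `v` in `A`. -/
def nbrsIn (G : SimpleGraph V) (A : Finset V) (v : V) : Finset V := A.filter fun u => G.Adj u v

lemma mem_nbrsIn {G : SimpleGraph V} {A : Finset V} {u v : V} :
    u ∈ nbrsIn G A v ↔ u ∈ A ∧ G.Adj u v := by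
  simp [nbrsIn]

lemma nbrsIn_subset (G : SimpleGraph V) (A : Finset V) (v : V) : nbrsIn G A v ⊆ A :=
  fun _ h => (mem_nbrsIn.1 h).1

/-- The pairs of `v` with the elements of `A`. -/
def star (A : Finset V) (v : V) : Finset (Sym2 V) := A.image fun u => s(u, v)

lemma mk_mem_star {A : Finset V} {a v : V} : s(a, v) ∈ star A v ↔ a ∈ A := by
  simp only [star, mem_image]
  constructor
  · rintro ⟨u, hu, h⟩
    rcases Sym2.eq_iff.1 h with ⟨rfl, -⟩ | ⟨rfl, rfl⟩ <;> exact hu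
  · exact fun h => ⟨a, h, rfl⟩

lemma card_star (A : Finset V) (v : V) : (star A v).card = A.card := by
  refine card_image_of_injective _ fun a b h => ?_
  rcases Sym2.eq_iff.1 h with ⟨h, -⟩ | ⟨rfl, rfl⟩
  · exact h
  · rfl

lemma star_subset_pairsIn {A : Finset V} {v : V} (hv : v ∉ A) : star A v ⊆ pairsIn univ := by
  intro e he
  obtain ⟨u, hu, rfl⟩ := mem_image.1 he
  exact mem_pairsIn.2 ⟨mem_univ _, mem_univ _, by rintro rfl; exact hv hu⟩

lemma disjoint_pairsIn_star {A : Finset V} {v : V} (hv : v ∉ A) :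
    Disjoint (pairsIn A) (star A v) := by
  rw [disjoint_right]
  intro e he h
  obtain ⟨u, hu, rfl⟩ := mem_image.1 he
  exact hv (mem_pairsIn.1 h).2.1

lemma disjoint_star_star {A : Finset V} {v w : V} (hv : v ∉ A) (hvw : v ≠ w) :
    Disjoint (star A v) (star A w) := by
  rw [disjoint_left]
  intro e he h
  obtain ⟨u, hu, rfl⟩ := mem_image.1 he
  obtain ⟨u', hu', h⟩ := mem_image.1 h
  rcases Sym2.eq_iff.1 h with ⟨-, h⟩ | ⟨rfl, -⟩
  · exact hvw h.symm
  · exact hv hu'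

lemma edges_inter_star (G : SimpleGraph V) (A : Finset V) (v : V) :
    edges G ∩ star A v = star (nbrsIn G A v) v := by
  ext e
  rw [mem_inter]
  constructor
  · rintro ⟨h1, h2⟩
    obtain ⟨u, hu, rfl⟩ := mem_image.1 h2
    exact mk_mem_star.2 (mem_nbrsIn.2 ⟨hu, by simpa using h1⟩)
  · intro h
    obtain ⟨u, hu, rfl⟩ := mem_image.1 h
    obtain ⟨h1, h2⟩ := mem_nbrsIn.1 hu
    exact ⟨by simpa using h2, mk_mem_star.2 h1⟩

lemma dependsOn_nbrsIn (A : Finset V) (v : V) (Q : ℕ → Prop) :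
    DependsOn (star A v) fun G => Q (nbrsIn G A v).card := by
  intro G G' h
  rw [edges_inter_star, edges_inter_star] at h
  simp only
  rw [← card_star (nbrsIn G A v) v, h, card_star]

/-- The number of neighbours of an outside vertex is binomially distributed. -/
lemma pr_card_nbrsIn_eq {A : Finset V} {v : V} (hv : v ∉ A) (j : ℕ) :
    pr p (fun G => (nbrsIn G A v).card = j) =
      A.card.choose j * (p ^ j * (1 - p) ^ (A.card - j)) := by
  have h1 : (fun G : SimpleGraph V => (nbrsIn G A v).card = j) =
      fun G => ∃ N ∈ powersetCard j A, edges G ∩ star A v = star N v := by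
    funext G
    refine propext ⟨fun h => ⟨_, mem_powersetCard.2 ⟨nbrsIn_subset G A v, h⟩, edges_inter_star G A v⟩,
      ?_⟩
    rintro ⟨N, hN, h⟩
    rw [edges_inter_star] at h
    rw [← card_star _ v, h, card_star]
    exact (mem_powersetCard.1 hN).2
  rw [h1, pr_exists_eq, sum_congr rfl (g := fun _ => p ^ j * (1 - p) ^ (A.card - j)), sum_const,
    card_powersetCard, nsmul_eq_mul]
  · intro N hN
    obtain ⟨h2, h3⟩ := mem_powersetCard.1 hN
    have h4 : star N v ⊆ star A v := image_subset_image h2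
    rw [pr_inter_eq (star_subset_pairsIn hv) h4, card_star, card_star, h3]
  · rintro G N - N' - h h'
    have h'' : star N v = star N' v := h.symm.trans h'
    ext u
    rw [← mk_mem_star (v := v), h'', mk_mem_star]

/-- No vertex outside the tree on `A` has exactly one neighbour in `A`. -/
def IsMaximalTree (G : SimpleGraph V) (A : Finset V) : Prop :=
  edgesIn G A ∈ treesOn A ∧ ∀ v ∈ Aᶜ, (nbrsIn G A v).card ≠ 1

/-- The pairs inside A and the stars from the outside vertices to A are pairwise disjoint, so all
the events are independent. An outside vertex has exactly one neighbour with the binomial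
probability |A| p (1-p)^(|A|-1). -/
lemma pr_isMaximalTree {A : Finset V} (hA : A.Nonempty) :
    pr p (fun G => IsMaximalTree G A) = treeProb p A.card *
      (1 - A.card * (p * (1 - p) ^ (A.card - 1))) ^ (Fintype.card V - A.card) := by
  -- Outside vertices are added one at a time. The set D of pairs used so far stays disjoint from
  -- the stars still to come.
  have key : ∀ s : Finset V, s ⊆ Aᶜ → ∃ D ⊆ pairsIn univ, (∀ v ∈ Aᶜ \ s, Disjoint D (star A v)) ∧
      DependsOn D (fun G => edgesIn G A ∈ treesOn A ∧ ∀ v ∈ s, (nbrsIn G A v).card ≠ 1) ∧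
      pr p (fun G => edgesIn G A ∈ treesOn A ∧ ∀ v ∈ s, (nbrsIn G A v).card ≠ 1) =
        treeProb p A.card * (1 - A.card * (p * (1 - p) ^ (A.card - 1))) ^ s.card := by
    intro s
    induction s using Finset.induction_on with
    | empty =>
      intro _
      refine ⟨pairsIn A, pairsIn_subset_univ A, fun v hv => ?_, ?_, ?_⟩
      · rw [sdiff_empty, mem_compl] at hv
        exact disjoint_pairsIn_star hv
      · simpa using dependsOn_edgesIn A fun E => E ∈ treesOn A
      · simpa using pr_edgesIn_mem_treesOn hA
    | insert v s hvs ih =>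
      intro hs
      obtain ⟨D, hD, hdisj, hdep, hpr⟩ := ih ((subset_insert v s).trans hs)
      have hvA : v ∉ A := mem_compl.1 (hs (mem_insert_self v s))
      have heq : (fun G => edgesIn G A ∈ treesOn A ∧ ∀ u ∈ insert v s, (nbrsIn G A u).card ≠ 1) =
          fun G => (edgesIn G A ∈ treesOn A ∧ ∀ u ∈ s, (nbrsIn G A u).card ≠ 1) ∧
            (nbrsIn G A v).card ≠ 1 := by
        funext G
        rw [forall_mem_insert]
        exact propext ⟨fun h => ⟨⟨h.1, h.2.2⟩, h.2.1⟩, fun h => ⟨h.1.1, h.2, h.1.2⟩⟩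
      have hq := dependsOn_nbrsIn A v fun j => j ≠ 1
      have hone : pr p (fun G => (nbrsIn G A v).card ≠ 1) =
          1 - A.card * (p * (1 - p) ^ (A.card - 1)) := by
        have h1 := pr_and_add_pr_and_not (p := p) (fun _ : SimpleGraph V => True)
          (fun G => (nbrsIn G A v).card = 1)
        simp only [true_and] at h1
        rw [pr_true, pr_card_nbrsIn_eq hvA] at h1
        rw [Nat.choose_one_right, pow_one] at h1
        exact eq_sub_of_add_eq' h1
      refine ⟨D ∪ star A v, union_subset hD (star_subset_pairsIn hvA), fun u hu => ?_, ?_, ?_⟩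
      · rw [Finset.mem_sdiff, mem_insert, not_or] at hu
        rw [disjoint_union_left]
        exact ⟨hdisj u (Finset.mem_sdiff.2 ⟨hu.1, hu.2.2⟩),
          disjoint_star_star hvA (Ne.symm hu.2.1)⟩
      · rw [heq]
        exact hdep.and hq
      · rw [heq, pr_and_of_disjoint hD (star_subset_pairsIn hvA)
          (hdisj v (Finset.mem_sdiff.2 ⟨hs (mem_insert_self v s), hvs⟩)) hdep hq, hpr, hone,
          card_insert_of_notMem hvs, pow_succ]
        ring
  obtain ⟨-, -, -, -, h⟩ := key Aᶜ Subset.rfl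
  rw [card_compl] at h
  exact h

/-- The set `A` induces a tree and every outside vertex has at least four neighbours in `A`. -/
def IsGoodTree (G : SimpleGraph V) (A : Finset V) : Prop :=
  edgesIn G A ∈ treesOn A ∧ ∀ v ∈ Aᶜ, 4 ≤ (nbrsIn G A v).card

/-- Union bound over the outside vertices: the degree of each of them into A is independent of the
tree on A. -/
lemma le_pr_isGoodTree (hp : 0 ≤ p) (hp1 : p ≤ 1) {A : Finset V} (hA : A.Nonempty) :
    treeProb p A.card * (1 - Fintype.card V *
      ∑ j ∈ range 4, A.card.choose j * (p ^ j * (1 - p) ^ (A.card - j))) ≤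
    pr p (fun G => IsGoodTree G A) := by
  have h1 := pr_and_add_pr_and_not (p := p) (fun G : SimpleGraph V => edgesIn G A ∈ treesOn A)
    (fun G => ∀ v ∈ Aᶜ, 4 ≤ (nbrsIn G A v).card)
  rw [pr_edgesIn_mem_treesOn hA] at h1
  have ht : 0 ≤ treeProb p A.card := by
    rw [← pr_edgesIn_mem_treesOn hA]
    exact pr_nonneg hp hp1 _
  set tail := ∑ j ∈ range 4, (A.card.choose j : ℝ) * (p ^ j * (1 - p) ^ (A.card - j)) with htail
  have ht0 : 0 ≤ tail := sum_nonneg fun j _ => mul_nonneg (by positivity)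
    (mul_nonneg (by positivity) (pow_nonneg (by linarith) _))
  have h2 : pr p (fun G => edgesIn G A ∈ treesOn A ∧ ¬ ∀ v ∈ Aᶜ, 4 ≤ (nbrsIn G A v).card) ≤
      ∑ v ∈ Aᶜ, treeProb p A.card * tail := by
    calc pr p (fun G => edgesIn G A ∈ treesOn A ∧ ¬ ∀ v ∈ Aᶜ, 4 ≤ (nbrsIn G A v).card)
        ≤ pr p (fun G => ∃ v ∈ Aᶜ, edgesIn G A ∈ treesOn A ∧ (nbrsIn G A v).card < 4) := by
          refine pr_mono hp hp1 fun G hG => ?_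
          obtain ⟨h, h'⟩ := hG
          push Not at h'
          obtain ⟨v, hv, hlt⟩ := h'
          exact ⟨v, hv, h, hlt⟩
      _ ≤ ∑ v ∈ Aᶜ, pr p (fun G => edgesIn G A ∈ treesOn A ∧ (nbrsIn G A v).card < 4) :=
          pr_exists_le hp hp1 _ _
      _ ≤ _ := by
          refine sum_le_sum fun v hv => ?_
          have hvA := mem_compl.1 hv
          rw [pr_and_of_disjoint (pairsIn_subset_univ A) (star_subset_pairsIn hvA)
            (disjoint_pairsIn_star hvA) (dependsOn_edgesIn A fun E => E ∈ treesOn A)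
            (dependsOn_nbrsIn A v fun j => j < 4), pr_edgesIn_mem_treesOn hA]
          refine mul_le_mul_of_nonneg_left ?_ ht
          calc pr p (fun G => (nbrsIn G A v).card < 4)
              ≤ pr p (fun G => ∃ j ∈ range 4, (nbrsIn G A v).card = j) :=
                pr_mono hp hp1 fun G hG => ⟨_, mem_range.2 hG, rfl⟩
            _ ≤ ∑ j ∈ range 4, pr p (fun G => (nbrsIn G A v).card = j) := pr_exists_le hp hp1 _ _
            _ = tail := sum_congr rfl fun j _ => pr_card_nbrsIn_eq hvA j
  rw [sum_const, nsmul_eq_mul] at h2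
  have h3 : ((Aᶜ).card : ℝ) * (treeProb p A.card * tail) ≤
      Fintype.card V * (treeProb p A.card * tail) := by
    gcongr
    exact card_le_univ _
  have h4 : pr p (fun G => IsGoodTree G A) = pr p (fun G => edgesIn G A ∈ treesOn A ∧
      ∀ v ∈ Aᶜ, 4 ≤ (nbrsIn G A v).card) := rfl
  rw [h4]
  nlinarith

end

section

variable {V : Type*} [Fintype V] [DecidableEq V] {p : ℝ}

/-! ### Pairs of induced trees -/

/-- The pairs with one element in `X` and one in `Y`. -/
def crossPairs (X Y : Finset V) : Finset (Sym2 V) := Y.biUnion fun b => star X b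

lemma exists_of_mem_crossPairs {X Y : Finset V} {e : Sym2 V} (he : e ∈ crossPairs X Y) :
    ∃ a ∈ X, ∃ b ∈ Y, e = s(a, b) := by
  obtain ⟨b, hb, h⟩ := mem_biUnion.1 he
  obtain ⟨a, ha, rfl⟩ := mem_image.1 h
  exact ⟨a, ha, b, hb, rfl⟩

lemma card_crossPairs {X Y : Finset V} (h : Disjoint X Y) :
    (crossPairs X Y).card = X.card * Y.card := by
  rw [crossPairs, card_biUnion, sum_congr rfl fun b _ => card_star X b, sum_const, smul_eq_mul,
    mul_comm]
  exact fun b hb b' _ hne => disjoint_star_star (disjoint_right.1 h hb) hne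

lemma sum_card_nbrsIn {X Y : Finset V} (h : Disjoint X Y) (G : SimpleGraph V) :
    ∑ b ∈ Y, (nbrsIn G X b).card = (edges G ∩ crossPairs X Y).card := by
  rw [crossPairs, inter_biUnion, card_biUnion]
  · exact sum_congr rfl fun b _ => by rw [edges_inter_star, card_star]
  · intro b hb b' _ hne
    exact disjoint_of_subset_left inter_subset_right (disjoint_of_subset_right inter_subset_right
      (disjoint_star_star (disjoint_right.1 h hb) hne))

lemma pr_le_one (hp : 0 ≤ p) (hp1 : p ≤ 1) (P : SimpleGraph V → Prop) : pr p P ≤ 1 := by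
  rw [← pr_true (V := V) (p := p)]
  exact pr_mono hp hp1 fun _ _ => trivial

lemma pr_le_card_inter_le (hp : 0 ≤ p) (hp1 : p ≤ 1) {D : Finset (Sym2 V)} (hD : D ⊆ pairsIn univ)
    (j : ℕ) :
    pr p (fun G : SimpleGraph V => j ≤ (edges G ∩ D).card) ≤ min 1 (D.card.choose j * p ^ j) := by
  refine le_min (pr_le_one hp hp1 _) ?_
  calc pr p (fun G : SimpleGraph V => j ≤ (edges G ∩ D).card)
      ≤ pr p (fun G => ∃ J ∈ powersetCard j D, J ⊆ edges G ∧ Disjoint ∅ (edges G)) := by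
        refine pr_mono hp hp1 fun G hG => ?_
        obtain ⟨J, hJ, hc⟩ := exists_subset_card_eq hG
        exact ⟨J, mem_powersetCard.2 ⟨hJ.trans inter_subset_right, hc⟩,
          hJ.trans inter_subset_left, disjoint_empty_left _⟩
    _ ≤ ∑ J ∈ powersetCard j D, pr p (fun G => J ⊆ edges G ∧ Disjoint ∅ (edges G)) :=
        pr_exists_le hp hp1 _ _
    _ = _ := by
        rw [sum_congr rfl (g := fun _ => p ^ j), sum_const, card_powersetCard, nsmul_eq_mul]
        intro J hJ
        obtain ⟨h1, h2⟩ := mem_powersetCard.1 hJ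
        rw [pr_cylinder (h1.trans hD) (empty_subset _) (disjoint_empty_right _), h2]
        simp

/-- A bound for the probability that two overlapping sets induce two given trees agreeing on the
intersection, where they have `c` components, and have many edges between their differences. -/
def pairWeight (p : ℝ) (k l r c : ℕ) : ℝ :=
  p ^ (2 * (k - 1) - (l - c)) * (1 - p) ^ (2 * (k.choose 2 - (k - 1)) - (l.choose 2 - (l - c))) *
    min 1 ((r * r).choose (3 * r + 1 - c) * p ^ (3 * r + 1 - c))

lemma pairWeight_nonneg (hp : 0 ≤ p) (hp1 : p ≤ 1) (k l r c : ℕ) : 0 ≤ pairWeight p k l r c :=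
  mul_nonneg (mul_nonneg (pow_nonneg hp _) (pow_nonneg (by linarith) _))
    (le_min zero_le_one (by positivity))

/-- The pairs inside A ∩ B are prescribed by both trees, consistently, so they are counted once:
hence the subtractions in both exponents. -/
lemma pr_two_trees {A B : Finset V} {E₁ E₂ : Finset (Sym2 V)}
    (hE₁ : E₁ ∈ treesOn A) (hE₂ : E₂ ∈ treesOn B)
    (h : E₂ ∩ pairsIn (A ∩ B) = E₁ ∩ pairsIn (A ∩ B)) :
    pr p (fun G => edges G ∩ pairsIn A = E₁ ∧ edges G ∩ pairsIn B = E₂) =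
      p ^ ((A.card - 1) + (B.card - 1) - (E₁ ∩ pairsIn (A ∩ B)).card) *
      (1 - p) ^ ((A.card.choose 2 - (A.card - 1)) + (B.card.choose 2 - (B.card - 1)) -
        ((A ∩ B).card.choose 2 - (E₁ ∩ pairsIn (A ∩ B)).card)) := by
  have hs₁ := subset_pairsIn_of_mem_treesOn hE₁
  have hs₂ := subset_pairsIn_of_mem_treesOn hE₂
  have hc₁ := card_add_one_of_mem_treesOn hE₁
  have hc₂ := card_add_one_of_mem_treesOn hE₂
  set F := E₁ ∩ pairsIn (A ∩ B) with hF
  have hmem : ∀ e, e ∈ pairsIn A → e ∈ pairsIn B → (e ∈ E₁ ↔ e ∈ E₂) := by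
    intro e hA hB
    have hAB : e ∈ pairsIn (A ∩ B) := by rw [pairsIn_inter]; exact mem_inter.2 ⟨hA, hB⟩
    have h1 : e ∈ E₁ ↔ e ∈ F := by rw [hF, mem_inter]; exact ⟨fun h => ⟨h, hAB⟩, fun h => h.1⟩
    have h2 : e ∈ E₂ ↔ e ∈ F := by rw [← h, mem_inter]; exact ⟨fun h => ⟨h, hAB⟩, fun h => h.1⟩
    rw [h1, h2]
  have hinter : E₁ ∩ E₂ = F := by
    ext e
    rw [hF, mem_inter, mem_inter, pairsIn_inter, mem_inter]
    constructor
    · exact fun h => ⟨h.1, hs₁ h.1, hs₂ h.2⟩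
    · exact fun h => ⟨h.1, (hmem e h.2.1 h.2.2).1 h.1⟩
  have hinter0 : (pairsIn A \ E₁) ∩ (pairsIn B \ E₂) = pairsIn (A ∩ B) \ F := by
    ext e
    rw [hF, mem_inter, Finset.mem_sdiff, Finset.mem_sdiff, Finset.mem_sdiff, mem_inter,
      pairsIn_inter, mem_inter]
    have := hmem e
    tauto
  have h2 : (fun G : SimpleGraph V => edges G ∩ pairsIn A = E₁ ∧ edges G ∩ pairsIn B = E₂) =
      fun G => E₁ ∪ E₂ ⊆ edges G ∧ Disjoint ((pairsIn A \ E₁) ∪ (pairsIn B \ E₂)) (edges G) := by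
    funext G
    rw [inter_eq_iff hs₁, inter_eq_iff hs₂, union_subset_iff, disjoint_union_left]
    exact propext ⟨fun h => ⟨⟨h.1.1, h.2.1⟩, h.1.2, h.2.2⟩, fun h => ⟨⟨h.1.1, h.2.1⟩, h.1.2, h.2.2⟩⟩
  rw [h2, pr_cylinder]
  · congr 2
    · have := card_union_add_card_inter E₁ E₂
      rw [hinter] at this
      omega
    · have := card_union_add_card_inter (pairsIn A \ E₁) (pairsIn B \ E₂)
      rw [hinter0, card_sdiff_of_subset hs₁, card_sdiff_of_subset hs₂,
        card_sdiff_of_subset (show F ⊆ pairsIn (A ∩ B) from inter_subset_right), card_pairsIn, card_pairsIn, card_pairsIn,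
        show E₁.card = A.card - 1 by omega, show E₂.card = B.card - 1 by omega] at this
      omega
  · exact union_subset (hs₁.trans (pairsIn_subset_univ A)) (hs₂.trans (pairsIn_subset_univ B))
  · exact union_subset (sdiff_subset.trans (pairsIn_subset_univ A))
      (sdiff_subset.trans (pairsIn_subset_univ B))
  · rw [disjoint_union_left, disjoint_union_right, disjoint_union_right]
    refine ⟨⟨disjoint_sdiff, ?_⟩, ?_, disjoint_sdiff⟩
    · rw [disjoint_left]
      intro e he h'
      rw [Finset.mem_sdiff] at h'
      exact h'.2 ((hmem e (hs₁ he) h'.1).1 he)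
    · rw [disjoint_left]
      intro e he h'
      rw [Finset.mem_sdiff] at h'
      exact h'.2 ((hmem e h'.1 (hs₂ he)).2 he)

/-- Each of the r vertices of B \ A has at least four neighbours in A. The tree on B has k - 1
edges, l - c of them inside S, so at most r + c - 1 edges join S to B \ A. At least 3r + 1 - c edges
are left between A \ B and B \ A, among r² pairs disjoint from those inside A or B, so the
probability factorises. If 3r + 1 - c truncates to 0 the extra factor is 1. -/
lemma pr_isGoodTree_pair_le (hp : 0 ≤ p) (hp1 : p ≤ 1) {A B : Finset V} {k l r : ℕ}
    (hA : A.card = k) (hB : B.card = k) (hS : (A ∩ B).card = l) (hr : l + r = k) (hl : 1 ≤ l)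
    (hr1 : 1 ≤ r) :
    pr p (fun G => IsGoodTree G A ∧ IsGoodTree G B) ≤
      ∑ c ∈ Icc 1 l, blockSum (A ∩ B) c * ((r : ℝ) ^ (c - 1) * (k : ℝ) ^ (r - 1)) ^ 2 *
        pairWeight p k l r c := by
  classical
  set S := A ∩ B with hSdef
  set D := crossPairs (A \ B) (B \ A) with hD
  have hAB : Disjoint (A \ B) (B \ A) := disjoint_sdiff_sdiff
  have hcA : (A \ B).card = r := by
    have := card_sdiff_add_card_inter A B
    rw [← hSdef] at this
    omega
  have hcB : (B \ A).card = r := by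
    have := card_sdiff_add_card_inter B A
    rw [inter_comm, ← hSdef] at this
    omega
  have hDcard : D.card = r * r := by rw [hD, card_crossPairs hAB, hcA, hcB]
  have hDuniv : D ⊆ pairsIn univ := by
    intro e he
    obtain ⟨a, ha, b, hb, rfl⟩ := exists_of_mem_crossPairs he
    refine mem_pairsIn.2 ⟨mem_univ _, mem_univ _, ?_⟩
    rintro rfl
    exact disjoint_left.1 hAB ha hb
  have hDdisj : Disjoint (pairsIn A ∪ pairsIn B) D := by
    rw [disjoint_right]
    intro e he h
    obtain ⟨a, ha, b, hb, rfl⟩ := exists_of_mem_crossPairs he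
    rcases mem_union.1 h with h | h
    · exact (Finset.mem_sdiff.1 hb).2 (mem_pairsIn.1 h).2.1
    · exact (Finset.mem_sdiff.1 ha).2 (mem_pairsIn.1 h).1
  have hFl : ∀ E ∈ treesOn A, (E ∩ pairsIn S).card ≤ l := by
    intro E hE
    obtain ⟨c, P, hP, hPF⟩ := exists_isForestOn (S := S) inter_subset_left hE
    have := hPF.card_add hP
    omega
  set J : Finset (Sym2 V) → ℕ := fun E => 3 * r + 1 - (l - (E ∩ pairsIn S).card) with hJ
  calc pr p (fun G => IsGoodTree G A ∧ IsGoodTree G B)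
      ≤ pr p (fun G => ∃ x ∈ (treesOn A).sigma fun E₁ => (treesOn B).filter fun E₂ =>
          E₂ ∩ pairsIn S = E₁ ∩ pairsIn S, (edges G ∩ pairsIn A = x.1 ∧ edges G ∩ pairsIn B = x.2) ∧
            J x.1 ≤ (edges G ∩ D).card) := by
        refine pr_mono hp hp1 fun G hG => ?_
        obtain ⟨⟨hTA, hdeg⟩, hTB, -⟩ := hG
        refine ⟨⟨edgesIn G A, edgesIn G B⟩, mem_sigma.2 ⟨hTA, mem_filter.2 ⟨hTB, ?_⟩⟩, ⟨rfl, rfl⟩, ?_⟩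
        · dsimp only
          rw [edgesIn_inter G inter_subset_left, edgesIn_inter G inter_subset_right]
        · have h1 : 4 * r ≤ ∑ b ∈ B \ A, (nbrsIn G A b).card := by
            rw [← hcB, mul_comm, ← smul_eq_mul]
            refine card_nsmul_le_sum _ _ _ fun b hb => hdeg b (mem_compl.2 (Finset.mem_sdiff.1 hb).2)
          have hSd : Disjoint S (B \ A) := by
            rw [disjoint_left]
            intro v hv hv'
            exact (Finset.mem_sdiff.1 hv').2 (mem_inter.1 hv).1
          have h2 : ∑ b ∈ B \ A, (nbrsIn G A b).card =
              ∑ b ∈ B \ A, (nbrsIn G S b).card + ∑ b ∈ B \ A, (nbrsIn G (A \ B) b).card := by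
            rw [← sum_add_distrib]
            refine sum_congr rfl fun b _ => ?_
            rw [← card_union_of_disjoint]
            · congr 1
              ext u
              simp only [mem_nbrsIn, mem_union, Finset.mem_sdiff, hSdef, mem_inter]
              tauto
            · rw [disjoint_left]
              intro u hu hu'
              exact (Finset.mem_sdiff.1 (mem_nbrsIn.1 hu').1).2 (mem_inter.1 (mem_nbrsIn.1 hu).1).2
          rw [sum_card_nbrsIn hSd, sum_card_nbrsIn hAB, ← hD] at h2
          have h3 : edges G ∩ crossPairs S (B \ A) ⊆ edgesIn G B \ edgesIn G S := by
            intro e he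
            obtain ⟨he1, he2⟩ := mem_inter.1 he
            obtain ⟨a, ha, b, hb, rfl⟩ := exists_of_mem_crossPairs he2
            have hadj : G.Adj a b := by simpa using he1
            refine Finset.mem_sdiff.2 ⟨mk_mem_edgesIn.2 ⟨hadj, (mem_inter.1 ha).2,
              (Finset.mem_sdiff.1 hb).1⟩, fun hc => ?_⟩
            exact disjoint_left.1 hSd (mk_mem_edgesIn.1 hc).2.2 hb
          have hsub : edgesIn G S ⊆ edgesIn G B := by
            rw [← edgesIn_inter G (S := S) (A := B) inter_subset_right]
            exact inter_subset_left
          have h4 := card_le_card h3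
          rw [card_sdiff_of_subset hsub] at h4
          have h5 := card_add_one_of_mem_treesOn hTB
          have h6 := hFl _ hTA
          simp only [hJ]
          rw [edgesIn_inter G (S := S) (A := A) inter_subset_left] at h6 ⊢
          omega
    _ ≤ ∑ x ∈ (treesOn A).sigma fun E₁ => (treesOn B).filter fun E₂ =>
          E₂ ∩ pairsIn S = E₁ ∩ pairsIn S, pr p (fun G =>
            (edges G ∩ pairsIn A = x.1 ∧ edges G ∩ pairsIn B = x.2) ∧
            J x.1 ≤ (edges G ∩ D).card) := pr_exists_le hp hp1 _ _
    _ ≤ ∑ x ∈ (treesOn A).sigma fun E₁ => (treesOn B).filter fun E₂ =>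
          E₂ ∩ pairsIn S = E₁ ∩ pairsIn S, pairWeight p k l r (l - (x.1 ∩ pairsIn S).card) := by
        refine sum_le_sum fun x hx => ?_
        obtain ⟨hE₁, hx2⟩ := mem_sigma.1 hx
        obtain ⟨hE₂, hmatch⟩ := mem_filter.1 hx2
        rw [pr_and_of_disjoint (union_subset (pairsIn_subset_univ A) (pairsIn_subset_univ B)) hDuniv
          hDdisj (P := fun G => edges G ∩ pairsIn A = x.1 ∧ edges G ∩ pairsIn B = x.2)
          (Q := fun G => J x.1 ≤ (edges G ∩ D).card)
          (DependsOn.and (fun G G' h => by rw [h]) (fun G G' h => by rw [h]))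
          (fun G G' h => by simp only [h]), pr_two_trees hE₁ hE₂ hmatch, pairWeight, hA, hB, ← hSdef, hS]
        have h1 := hFl _ hE₁
        rw [show l - (l - (x.1 ∩ pairsIn S).card) = (x.1 ∩ pairsIn S).card by omega, ← two_mul,
          ← two_mul]
        refine mul_le_mul_of_nonneg_left ?_ (mul_nonneg (pow_nonneg hp _) (pow_nonneg (by linarith) _))
        refine (pr_le_card_inter_le hp hp1 hDuniv _).trans_eq ?_
        rw [hDcard]
    _ ≤ _ := by
        rw [sum_sigma]
        exact sum_matching_le inter_subset_left inter_subset_right hA hB hS hr hl hr1 _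
          (pairWeight_nonneg hp hp1 k l r)

/-! ### First and second moments -/

lemma card_filter_card_inter (A : Finset V) (k l : ℕ) (hl : l ≤ k) :
    ((powersetCard k (univ : Finset V)).filter fun B => (A ∩ B).card = l).card =
      A.card.choose l * (Fintype.card V - A.card).choose (k - l) := by
  rw [← card_compl, ← card_powersetCard, ← card_powersetCard (k - l), ← card_product]
  refine card_bij' (fun B _ => (A ∩ B, B \ A)) (fun x _ => x.1 ∪ x.2) ?_ ?_ ?_ ?_
  · intro B hB
    obtain ⟨h1, h2⟩ := mem_filter.1 hB
    have h3 := (mem_powersetCard.1 h1).2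
    have h4 := card_sdiff_add_card_inter B A
    rw [inter_comm] at h4
    refine mem_product.2 ⟨mem_powersetCard.2 ⟨inter_subset_left, h2⟩, mem_powersetCard.2 ⟨?_, ?_⟩⟩
    · intro v hv
      exact mem_compl.2 (Finset.mem_sdiff.1 hv).2
    · dsimp only; omega
  · rintro ⟨X, Y⟩ hx
    obtain ⟨h1, h2⟩ := mem_product.1 hx
    obtain ⟨hX, hXc⟩ := mem_powersetCard.1 h1
    obtain ⟨hY, hYc⟩ := mem_powersetCard.1 h2
    have hAY : Disjoint A Y := disjoint_right.2 fun v hv => mem_compl.1 (hY hv)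
    dsimp only at *
    refine mem_filter.2 ⟨mem_powersetCard.2 ⟨subset_univ _, ?_⟩, ?_⟩
    · rw [card_union_of_disjoint (disjoint_of_subset_left hX hAY)]
      omega
    · rw [inter_union_distrib_left, inter_eq_right.2 hX, disjoint_iff_inter_eq_empty.1 hAY,
        union_empty, hXc]
  · intro B _
    ext v
    simp only [mem_union, mem_inter, Finset.mem_sdiff]
    tauto
  · rintro ⟨X, Y⟩ hx
    obtain ⟨h1, h2⟩ := mem_product.1 hx
    obtain ⟨hX, -⟩ := mem_powersetCard.1 h1
    obtain ⟨hY, -⟩ := mem_powersetCard.1 h2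
    have hAY : ∀ v ∈ Y, v ∉ A := fun v hv => mem_compl.1 (hY hv)
    dsimp only at *
    congr 1
    · ext v
      simp only [mem_union, mem_inter]
      exact ⟨fun h => h.2.elim id fun h' => absurd h.1 (hAY v h'), fun h => ⟨hX h, Or.inl h⟩⟩
    · ext v
      simp only [mem_union, Finset.mem_sdiff]
      exact ⟨fun h => h.1.elim (fun h' => absurd (hX h') h.2) id, fun h => ⟨Or.inr h, hAY v h⟩⟩

/-- The expected number of induced trees with `k` vertices. -/
def meanTrees (n : ℕ) (p : ℝ) (k : ℕ) : ℝ := n.choose k * treeProb p k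

lemma treeProb_nonneg (hp : 0 ≤ p) (hp1 : p ≤ 1) (k : ℕ) : 0 ≤ treeProb p k :=
  mul_nonneg (by positivity) (mul_nonneg (by positivity) (pow_nonneg (by linarith) _))

lemma meanTrees_nonneg (hp : 0 ≤ p) (hp1 : p ≤ 1) (n k : ℕ) : 0 ≤ meanTrees n p k :=
  mul_nonneg (by positivity) (treeProb_nonneg hp hp1 k)

/-- The contribution to the second moment, relative to the number of pairs, of the pairs of sets
with `l` common elements, where `b c` bounds the number of forests with `c` components. -/
def overlapTerm (p : ℝ) (b : ℕ → ℕ → ℝ) (k l : ℕ) : ℝ :=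
  ∑ c ∈ Icc 1 l, b l c * (((k - l : ℕ) : ℝ) ^ (c - 1) * (k : ℝ) ^ (k - l - 1)) ^ 2 *
    pairWeight p k l (k - l) c

/-- Pairs are sorted by l = |A ∩ B|. Disjoint sets are independent and give at most the squared
mean, l = k forces B = A and gives at most the mean, and the rest are the overlap terms. -/
lemma sum_pr_isGoodTree_pair_le (hp : 0 ≤ p) (hp1 : p ≤ 1) {k : ℕ} (hk : 1 ≤ k) {b : ℕ → ℕ → ℝ}
    (hb : ∀ (S : Finset V) (c : ℕ), 1 ≤ c → c ≤ S.card → blockSum S c ≤ b S.card c) :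
    ∑ A ∈ powersetCard k (univ : Finset V), ∑ B ∈ powersetCard k (univ : Finset V),
      pr p (fun G => IsGoodTree G A ∧ IsGoodTree G B) ≤
    meanTrees (Fintype.card V) p k ^ 2 + meanTrees (Fintype.card V) p k +
      ∑ l ∈ Icc 1 (k - 1), (Fintype.card V).choose k * (k.choose l *
        (Fintype.card V - k).choose (k - l)) * overlapTerm p b k l := by
  classical
  set n := Fintype.card V
  have htp := treeProb_nonneg hp hp1 k
  have hone : ∀ A ∈ powersetCard k (univ : Finset V),
      ∑ B ∈ powersetCard k (univ : Finset V), pr p (fun G => IsGoodTree G A ∧ IsGoodTree G B) ≤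
      n.choose k * treeProb p k ^ 2 + treeProb p k +
        ∑ l ∈ Icc 1 (k - 1), ((k.choose l * (n - k).choose (k - l) : ℕ) : ℝ) * overlapTerm p b k l := by
    intro A hA
    have hAk := (mem_powersetCard.1 hA).2
    have hAne : A.Nonempty := by rw [← card_pos]; omega
    have hmaps : ∀ B ∈ powersetCard k (univ : Finset V), (A ∩ B).card ∈ range (k + 1) := by
      intro B _
      rw [mem_range]
      have := card_le_card (inter_subset_left : A ∩ B ⊆ A)
      omega
    rw [← sum_fiberwise_of_maps_to hmaps, sum_range_succ,
      show k = (k - 1) + 1 by omega, sum_range_succ', show k - 1 + 1 = k by omega]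
    have h0 : ∑ B ∈ powersetCard k (univ : Finset V) with (A ∩ B).card = 0,
        pr p (fun G => IsGoodTree G A ∧ IsGoodTree G B) ≤ n.choose k * treeProb p k ^ 2 := by
      calc _ ≤ ∑ B ∈ powersetCard k (univ : Finset V) with (A ∩ B).card = 0, treeProb p k ^ 2 := by
            refine sum_le_sum fun B hB => ?_
            obtain ⟨hB1, hB2⟩ := mem_filter.1 hB
            have hBk := (mem_powersetCard.1 hB1).2
            have hBne : B.Nonempty := by rw [← card_pos]; omega
            have hdis : Disjoint (pairsIn A) (pairsIn B) := by
              rw [disjoint_iff_inter_eq_empty, ← pairsIn_inter, card_eq_zero.1 hB2]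
              rfl
            calc _ ≤ pr p (fun G => edgesIn G A ∈ treesOn A ∧ edgesIn G B ∈ treesOn B) :=
                  pr_mono hp hp1 fun G hG => ⟨hG.1.1, hG.2.1⟩
              _ = treeProb p k ^ 2 := by
                  rw [pr_and_of_disjoint (pairsIn_subset_univ A) (pairsIn_subset_univ B) hdis
                    (dependsOn_edgesIn A fun E => E ∈ treesOn A)
                    (dependsOn_edgesIn B fun E => E ∈ treesOn B), pr_edgesIn_mem_treesOn hAne,
                    pr_edgesIn_mem_treesOn hBne, hAk, hBk, sq]
        _ ≤ ∑ B ∈ powersetCard k (univ : Finset V), treeProb p k ^ 2 :=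
            sum_le_sum_of_subset_of_nonneg (filter_subset _ _) fun _ _ _ => sq_nonneg _
        _ = _ := by rw [sum_const, card_powersetCard, card_univ, nsmul_eq_mul]
    have hk' : ∑ B ∈ powersetCard k (univ : Finset V) with (A ∩ B).card = k,
        pr p (fun G => IsGoodTree G A ∧ IsGoodTree G B) ≤ treeProb p k := by
      have hsing : (powersetCard k (univ : Finset V)).filter (fun B => (A ∩ B).card = k) = {A} := by
        ext B
        rw [mem_filter, mem_singleton, mem_powersetCard]
        constructor
        · rintro ⟨⟨-, hB⟩, hAB⟩
          have h1 : A ∩ B = A := eq_of_subset_of_card_le inter_subset_left (by omega)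
          have h2 : A ∩ B = B := eq_of_subset_of_card_le inter_subset_right (by omega)
          exact h2.symm.trans h1
        · rintro rfl
          exact ⟨⟨subset_univ _, hAk⟩, by rw [inter_self, hAk]⟩
      rw [hsing, sum_singleton, ← hAk, ← pr_edgesIn_mem_treesOn hAne]
      exact pr_mono hp hp1 fun G hG => hG.1.1
    have hmid : ∑ l ∈ range (k - 1), ∑ B ∈ powersetCard k (univ : Finset V)
          with (A ∩ B).card = l + 1, pr p (fun G => IsGoodTree G A ∧ IsGoodTree G B) ≤
        ∑ l ∈ Icc 1 (k - 1), ((k.choose l * (n - k).choose (k - l) : ℕ) : ℝ) * overlapTerm p b k l := by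
      rw [← Finset.Ico_add_one_right_eq_Icc, sum_Ico_eq_sum_range]
      rw [show (k - 1) + 1 - 1 = k - 1 by omega]
      refine sum_le_sum fun l hl => ?_
      rw [mem_range] at hl
      rw [add_comm 1 l]
      calc _ ≤ ∑ B ∈ powersetCard k (univ : Finset V) with (A ∩ B).card = l + 1,
            overlapTerm p b k (l + 1) := by
            refine sum_le_sum fun B hB => ?_
            obtain ⟨hB1, hB2⟩ := mem_filter.1 hB
            refine (pr_isGoodTree_pair_le hp hp1 (k := k) (l := l + 1) (r := k - (l + 1)) hAk
              (mem_powersetCard.1 hB1).2 hB2 (by omega) (by omega) (by omega)).trans ?_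
            refine sum_le_sum fun c hc => ?_
            rw [mem_Icc] at hc
            refine mul_le_mul_of_nonneg_right (mul_le_mul_of_nonneg_right ?_ (by positivity))
              (pairWeight_nonneg hp hp1 _ _ _ _)
            have := hb (A ∩ B) c hc.1 (by omega)
            rwa [hB2] at this
        _ = _ := by
            rw [sum_const, card_filter_card_inter A k (l + 1) (by omega), nsmul_eq_mul, hAk]
    linarith
  calc _ ≤ ∑ A ∈ powersetCard k (univ : Finset V), (n.choose k * treeProb p k ^ 2 + treeProb p k +
        ∑ l ∈ Icc 1 (k - 1), ((k.choose l * (n - k).choose (k - l) : ℕ) : ℝ) * overlapTerm p b k l) :=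
        sum_le_sum hone
    _ = _ := by
        rw [sum_const, card_powersetCard, card_univ, nsmul_eq_mul, mul_add, mul_add, mul_sum,
          meanTrees]
        congr 1
        · ring
        · refine sum_congr rfl fun l _ => ?_
          push_cast
          ring

/-- The second moment method for good trees. -/
lemma sq_le_pr_mul (hp : 0 ≤ p) (hp1 : p ≤ 1) (k : ℕ) :
    (∑ A ∈ powersetCard k (univ : Finset V), pr p (fun G => IsGoodTree G A)) ^ 2 ≤
      pr p (fun G => ∃ A ∈ powersetCard k (univ : Finset V), edgesIn G A ∈ treesOn A) *
      ∑ A ∈ powersetCard k (univ : Finset V), ∑ B ∈ powersetCard k (univ : Finset V),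
        pr p (fun G => IsGoodTree G A ∧ IsGoodTree G B) := by
  classical
  set 𝓐 := powersetCard k (univ : Finset V)
  let Y : SimpleGraph V → ℝ := fun G => ((𝓐.filter fun A => IsGoodTree G A).card : ℝ)
  let Z : SimpleGraph V → ℝ := fun G => if ∃ A ∈ 𝓐, edgesIn G A ∈ treesOn A then 1 else 0
  have h1 : ∑ A ∈ 𝓐, pr p (fun G => IsGoodTree G A) = ∑ G, weight p G * Y G :=
    (sum_weight_mul_card 𝓐 fun A G => IsGoodTree G A).symm
  have h2 : ∑ A ∈ 𝓐, ∑ B ∈ 𝓐, pr p (fun G => IsGoodTree G A ∧ IsGoodTree G B) =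
      ∑ G, weight p G * Y G ^ 2 := by
    rw [← sum_product', ← sum_weight_mul_card (𝓐 ×ˢ 𝓐) fun x G => IsGoodTree G x.1 ∧ IsGoodTree G x.2]
    refine sum_congr rfl fun G _ => ?_
    have : (𝓐 ×ˢ 𝓐).filter (fun x => IsGoodTree G x.1 ∧ IsGoodTree G x.2) =
        (𝓐.filter fun A => IsGoodTree G A) ×ˢ (𝓐.filter fun A => IsGoodTree G A) := by
      ext x
      simp only [mem_filter, mem_product]
      tauto
    rw [show (Y G) ^ 2 = (((𝓐.filter fun A => IsGoodTree G A) ×ˢ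
      (𝓐.filter fun A => IsGoodTree G A)).card : ℝ) by rw [card_product, sq]; push_cast; rfl, ← this]
    congr!
  have h3 : pr p (fun G => ∃ A ∈ 𝓐, edgesIn G A ∈ treesOn A) = ∑ G, weight p G * Z G := by
    rw [pr_eq_sum_ite]
    refine sum_congr rfl fun G _ => ?_
    congr!
  have hYZ : ∀ G, Y G * Z G = Y G := by
    intro G
    by_cases h : ∃ A ∈ 𝓐, edgesIn G A ∈ treesOn A
    · simp [Z, h]
    · have : Y G = 0 := by
        simp only [Y, Nat.cast_eq_zero, card_eq_zero]
        ext A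
        simp only [mem_filter, notMem_empty, iff_false]
        exact fun hA => h ⟨A, hA.1, hA.2.1⟩
      rw [this, zero_mul]
  have hZZ : ∀ G, Z G ^ 2 = Z G := by
    intro G
    simp only [Z]
    split_ifs <;> simp
  rw [h1, h2, h3]
  have hw : ∀ G : SimpleGraph V, 0 ≤ weight p G := weight_nonneg hp hp1
  -- Y counts good trees and Z indicates that some k-set induces a tree. Since YZ = Y,
  -- Cauchy–Schwarz gives (𝔼 Y)² ≤ 𝔼 Z · 𝔼 Y²; the weight is split into two square roots.
  have hCS := sum_mul_sq_le_sq_mul_sq (univ : Finset (SimpleGraph V))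
    (fun G => √(weight p G) * Z G) (fun G => √(weight p G) * Y G)
  calc _ = (∑ G, √(weight p G) * Z G * (√(weight p G) * Y G)) ^ 2 := by
        congr 1
        refine sum_congr rfl fun G _ => ?_
        rw [show √(weight p G) * Z G * (√(weight p G) * Y G) =
          (√(weight p G) * √(weight p G)) * (Y G * Z G) by ring, Real.mul_self_sqrt (hw G), hYZ]
    _ ≤ _ := hCS
    _ = _ := by
        congr 1
        · refine sum_congr rfl fun G _ => ?_
          rw [mul_pow, Real.sq_sqrt (hw G), hZZ]
        · refine sum_congr rfl fun G _ => ?_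
          rw [mul_pow, Real.sq_sqrt (hw G)]

end

section

variable {V : Type*} [Fintype V] [DecidableEq V] {p : ℝ}

/-! ### Largest induced trees -/

lemma mem_inducedTrees {G : SimpleGraph V} {A : Finset V} :
    A ∈ inducedTrees G ↔ edgesIn G A ∈ treesOn A := by
  rw [← induce_isTree_iff]
  simp [inducedTrees]

/-- The vertex v becomes a leaf below its unique neighbour u, with height one more than that of u.
-/
lemma insert_mem_inducedTrees {G : SimpleGraph V} {A : Finset V} (hA : A ∈ inducedTrees G) {v : V}
    (hv : v ∉ A) (h1 : (nbrsIn G A v).card = 1) : insert v A ∈ inducedTrees G := by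
  rw [mem_inducedTrees] at hA ⊢
  obtain ⟨u, hu⟩ := card_eq_one.1 h1
  have hun : ∀ w, w ∈ A ∧ G.Adj w v ↔ w = u := by
    intro w
    rw [← mem_nbrsIn, hu, mem_singleton]
  obtain ⟨huA, huv⟩ := (hun u).2 rfl
  obtain ⟨ρ, hρ⟩ := nonempty_of_mem_treesOn hA
  obtain ⟨f, ⟨hf, h, hh⟩, hfE⟩ := exists_isParentMap hA hρ
  have hvρ : v ≠ ρ := by rintro rfl; exact hv hρ
  have hfv : ∀ w ∈ A.erase ρ, Function.update f v u w = f w := by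
    intro w hw
    refine Function.update_of_ne ?_ _ _
    rintro rfl
    exact hv (mem_of_mem_erase hw)
  have hhv : ∀ w ∈ A, Function.update h v (h u + 1) w = h w := by
    intro w hw
    refine Function.update_of_ne ?_ _ _
    rintro rfl
    exact hv hw
  have herase : (insert v A).erase ρ = insert v (A.erase ρ) := erase_insert_of_ne hvρ
  have hpm : IsParentMap (insert v A) ρ (Function.update f v u) := by
    refine ⟨fun w hw => ?_, Function.update h v (h u + 1), fun w hw => ?_⟩
    · rw [herase, mem_insert] at hw
      rcases hw with rfl | hw
      · rw [Function.update_self]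
        exact mem_insert_of_mem huA
      · rw [hfv w hw]
        exact mem_insert_of_mem (hf w hw)
    · rw [herase, mem_insert] at hw
      rcases hw with rfl | hw
      · rw [Function.update_self, Function.update_self, hhv u huA]
        omega
      · rw [hfv w hw, hhv _ (hf w hw), hhv w (mem_of_mem_erase hw)]
        exact hh w hw
  have hE : parentEdges (insert v A) ρ (Function.update f v u) = edgesIn G (insert v A) := by
    have h2 : parentEdges (insert v A) ρ (Function.update f v u) = insert s(v, u) (edgesIn G A) := by
      rw [← hfE, parentEdges, parentEdges, herase, image_insert, Function.update_self]
      congr 1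
      exact image_congr fun w hw => by rw [hfv w hw]
    rw [h2]
    ext e
    induction e with
    | _ a b =>
      rw [mem_insert, mk_mem_edgesIn, mk_mem_edgesIn, mem_insert, mem_insert]
      constructor
      · rintro (h3 | h3)
        · rcases Sym2.eq_iff.1 h3 with ⟨rfl, rfl⟩ | ⟨rfl, rfl⟩
          · exact ⟨huv.symm, Or.inl rfl, Or.inr huA⟩
          · exact ⟨huv, Or.inr huA, Or.inl rfl⟩
        · exact ⟨h3.1, Or.inr h3.2.1, Or.inr h3.2.2⟩
      · rintro ⟨hab, rfl | ha, rfl | hb⟩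
        · exact absurd hab G.irrefl
        · rw [(hun b).1 ⟨hb, hab.symm⟩]
          exact Or.inl rfl
        · rw [(hun a).1 ⟨ha, hab⟩]
          exact Or.inl Sym2.eq_swap
        · exact Or.inr ⟨hab, ha, hb⟩
  rw [← hE]
  exact hpm.mem_treesOn (mem_insert_of_mem hρ)

lemma le_maxInducedTree {G : SimpleGraph V} {A : Finset V} (hA : A ∈ inducedTrees G) :
    A.card ≤ maxInducedTree G :=
  Finset.le_sup (f := Finset.card) hA

lemma exists_isMaximalTree (G : SimpleGraph V) (h : 1 ≤ maxInducedTree G) :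
    ∃ A : Finset V, A.card = maxInducedTree G ∧ IsMaximalTree G A := by
  have hne : (inducedTrees G).Nonempty := by
    rw [nonempty_iff_ne_empty]
    intro h0
    rw [maxInducedTree, h0, sup_empty] at h
    exact absurd h (by simp)
  obtain ⟨A, hA, hAs⟩ := exists_mem_eq_sup (inducedTrees G) hne Finset.card
  refine ⟨A, hAs.symm, mem_inducedTrees.1 hA, fun v hv h1 => ?_⟩
  have hv' := mem_compl.1 hv
  have h2 := le_maxInducedTree (insert_mem_inducedTrees hA hv' h1)
  rw [card_insert_of_notMem hv'] at h2
  have h3 : maxInducedTree G = A.card := hAs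
  omega

lemma pr_exists_tree_le_maxInducedTree (hp : 0 ≤ p) (hp1 : p ≤ 1) (k : ℕ) :
    pr p (fun G => ∃ A ∈ powersetCard k (univ : Finset V), edgesIn G A ∈ treesOn A) ≤
      pr p (fun G : SimpleGraph V => k ≤ maxInducedTree G) := by
  refine pr_mono hp hp1 fun G hG => ?_
  obtain ⟨A, hA, hT⟩ := hG
  rw [← (mem_powersetCard.1 hA).2]
  exact le_maxInducedTree (mem_inducedTrees.2 hT)

/-- The expected number of induced trees with `k` vertices that cannot be extended by a vertex. -/
def meanMaximalTrees (n : ℕ) (p : ℝ) (k : ℕ) : ℝ :=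
  meanTrees n p k * (1 - k * (p * (1 - p) ^ (k - 1))) ^ (n - k)

/-- A largest induced tree cannot be extended by a leaf, so it suffices to count maximal trees. This
is what improves on the plain first moment for sparse graphs. -/
lemma pr_le_maxInducedTree_le (hp : 0 ≤ p) (hp1 : p ≤ 1) {m : ℕ} (hm : 1 ≤ m) :
    pr p (fun G : SimpleGraph V => m ≤ maxInducedTree G) ≤
      ∑ k ∈ Icc m (Fintype.card V), meanMaximalTrees (Fintype.card V) p k := by
  calc pr p (fun G : SimpleGraph V => m ≤ maxInducedTree G)
      ≤ pr p (fun G => ∃ k ∈ Icc m (Fintype.card V), ∃ A ∈ powersetCard k (univ : Finset V),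
          IsMaximalTree G A) := by
        refine pr_mono hp hp1 fun G hG => ?_
        obtain ⟨A, hA, hmax⟩ := exists_isMaximalTree G (hm.trans hG)
        exact ⟨A.card, mem_Icc.2 ⟨hA ▸ hG, card_le_univ A⟩, A,
          mem_powersetCard.2 ⟨subset_univ _, rfl⟩, hmax⟩
    _ ≤ ∑ k ∈ Icc m (Fintype.card V), pr p (fun G => ∃ A ∈ powersetCard k (univ : Finset V),
          IsMaximalTree G A) := pr_exists_le hp hp1 _ _
    _ ≤ _ := by
        refine sum_le_sum fun k hk => ?_
        rw [mem_Icc] at hk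
        refine (pr_exists_le hp hp1 _ _).trans_eq ?_
        rw [sum_congr rfl (g := fun _ => treeProb p k *
          (1 - k * (p * (1 - p) ^ (k - 1))) ^ (Fintype.card V - k)), sum_const, card_powersetCard,
          card_univ, nsmul_eq_mul, meanMaximalTrees, meanTrees, mul_assoc]
        intro A hA
        have hAk := (mem_powersetCard.1 hA).2
        rw [pr_isMaximalTree (by rw [← card_pos]; omega), hAk]

/-- For k = 0 the two sides differ: the empty set is not a tree, but the formula gives 1. -/
lemma expectedCount_eq_meanTrees (n : ℕ) (p : I) {k : ℕ} (hk : 1 ≤ k) :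
    expectedCount n p k = meanTrees n p k := by
  classical
  rw [expectedCount, integral_eq_sum_weight]
  have h1 : ∀ G : SimpleGraph (Fin n), (inducedTreeCount k G : ℝ) =
      (((powersetCard k (univ : Finset (Fin n))).filter fun A => edgesIn G A ∈ treesOn A).card : ℝ) := by
    intro G
    rw [inducedTreeCount]
    congr 2
    ext A
    rw [mem_filter, mem_filter, mem_inducedTrees, mem_powersetCard]
    exact ⟨fun h => ⟨⟨subset_univ _, h.2⟩, h.1⟩, fun h => ⟨h.2, h.1.2⟩⟩
  have h2 := sum_weight_mul_card (p := (p : ℝ)) (powersetCard k (univ : Finset (Fin n)))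
    fun A G => edgesIn G A ∈ treesOn A
  simp_rw [h1]
  calc _ = _ := by
        refine sum_congr rfl fun G _ => ?_
        congr!
    _ = _ := h2
    _ = _ := by
        rw [sum_congr rfl (g := fun _ => treeProb p k), sum_const, card_powersetCard, card_univ,
          Fintype.card_fin, nsmul_eq_mul, meanTrees]
        intro A hA
        have hAk := (mem_powersetCard.1 hA).2
        rw [pr_edgesIn_mem_treesOn (by rw [← card_pos]; omega), hAk]

/-- A lower bound for the probability that there is an induced tree with `k` vertices. -/
lemma le_pr_le_maxInducedTree (hp : 0 ≤ p) (hp1 : p ≤ 1) {k : ℕ} (hk : 1 ≤ k) {b : ℕ → ℕ → ℝ}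
    (hb : ∀ (S : Finset V) (c : ℕ), 1 ≤ c → c ≤ S.card → blockSum S c ≤ b S.card c)
    {δ η : ℝ} (hμ : 0 < meanTrees (Fintype.card V) p k)
    (hδ : Fintype.card V * ∑ j ∈ range 4, k.choose j * (p ^ j * (1 - p) ^ (k - j)) ≤ δ)
    (hδ1 : δ ≤ 1)
    (hη : 1 / meanTrees (Fintype.card V) p k + (∑ l ∈ Icc 1 (k - 1), (Fintype.card V).choose k *
      (k.choose l * (Fintype.card V - k).choose (k - l)) * overlapTerm p b k l) /
        meanTrees (Fintype.card V) p k ^ 2 ≤ η) :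
    (1 - δ) ^ 2 / (1 + η) ≤ pr p (fun G : SimpleGraph V => k ≤ maxInducedTree G) := by
  set μ := meanTrees (Fintype.card V) p k with hμdef
  set tot := ∑ l ∈ Icc 1 (k - 1), ((Fintype.card V).choose k : ℝ) *
      (k.choose l * (Fintype.card V - k).choose (k - l)) * overlapTerm p b k l
  have h1 : μ * (1 - δ) ≤ ∑ A ∈ powersetCard k (univ : Finset V), pr p (fun G => IsGoodTree G A) := by
    calc μ * (1 - δ) = ∑ A ∈ powersetCard k (univ : Finset V), treeProb p k * (1 - δ) := by
          rw [sum_const, card_powersetCard, card_univ, nsmul_eq_mul, hμdef, meanTrees, mul_assoc]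
      _ ≤ _ := by
          refine sum_le_sum fun A hA => ?_
          have hAk := (mem_powersetCard.1 hA).2
          have h2 := le_pr_isGoodTree hp hp1 (A := A) (by rw [← card_pos]; omega)
          rw [hAk] at h2
          refine le_trans (mul_le_mul_of_nonneg_left ?_ (treeProb_nonneg hp hp1 k)) h2
          linarith
  have h2 := sum_pr_isGoodTree_pair_le hp hp1 hk hb
  have h3 := sq_le_pr_mul (V := V) hp hp1 k
  have h4 := pr_exists_tree_le_maxInducedTree (V := V) hp hp1 k
  set π := pr p (fun G : SimpleGraph V => k ≤ maxInducedTree G)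
  have hπ : 0 ≤ π := pr_nonneg hp hp1 _
  have h5 : μ ^ 2 + μ + tot ≤ μ ^ 2 * (1 + η) := by
    have : μ ^ 2 * (1 / μ + tot / μ ^ 2) = μ + tot := by field_simp
    nlinarith [mul_le_mul_of_nonneg_left hη (sq_nonneg μ)]
  have h6 : μ ^ 2 * (1 - δ) ^ 2 ≤ π * (μ ^ 2 * (1 + η)) := by
    calc μ ^ 2 * (1 - δ) ^ 2 = (μ * (1 - δ)) ^ 2 := by ring
      _ ≤ (∑ A ∈ powersetCard k (univ : Finset V), pr p (fun G => IsGoodTree G A)) ^ 2 := by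
          refine pow_le_pow_left₀ (mul_nonneg hμ.le (by linarith)) h1 2
      _ ≤ _ := h3
      _ ≤ π * ∑ A ∈ powersetCard k (univ : Finset V), ∑ B ∈ powersetCard k (univ : Finset V),
            pr p (fun G => IsGoodTree G A ∧ IsGoodTree G B) := by
          refine mul_le_mul_of_nonneg_right h4 (sum_nonneg fun A _ => sum_nonneg fun B _ =>
            pr_nonneg hp hp1 _)
      _ ≤ _ := mul_le_mul_of_nonneg_left (h2.trans h5) hπ
  by_cases hη0 : 0 < 1 + η
  · rw [div_le_iff₀ hη0]
    refine le_of_mul_le_mul_left ?_ (pow_pos hμ 2)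
    linarith
  · refine le_trans (div_nonpos_of_nonneg_of_nonpos (sq_nonneg _) (not_lt.1 hη0)) hπ

end

section

/-! ### An upper bound for the number of forests -/

-- The Stirling sequence is decreasing, with value e/√2 at n = 1.
open Nat in
lemma factorial_le_stirling (n : ℕ) (hn : 1 ≤ n) :
    (n ! : ℝ) ≤ Real.exp 1 * √n * (n / Real.exp 1) ^ n := by
  obtain ⟨m, rfl⟩ : ∃ m, n = m + 1 := ⟨n - 1, by omega⟩
  have h := Stirling.stirlingSeq'_antitone (Nat.zero_le m)
  simp only [Function.comp_apply, Nat.succ_eq_add_one, zero_add, Stirling.stirlingSeq_one] at h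
  rw [Stirling.stirlingSeq] at h
  have hpos : (0 : ℝ) < √(2 * ((m + 1 : ℕ) : ℝ)) * (((m + 1 : ℕ) : ℝ) / Real.exp 1) ^ (m + 1) := by
    positivity
  rw [div_le_iff₀ hpos] at h
  refine h.trans_eq ?_
  rw [Real.sqrt_mul (by norm_num)]
  field_simp

-- Stirling from above for l!, and from below for s! and (l-s)!. The constants cancel because e ≤
-- 2π.
open Nat in
lemma choose_mul_pow_mul_pow_le {l s : ℕ} (hs : 1 ≤ s) (hsl : s < l) :
    (l.choose s : ℝ) * (s : ℝ) ^ s * ((l - s : ℕ) : ℝ) ^ (l - s) ≤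
      (l : ℝ) ^ l * (√l / (√s * √(l - s : ℕ))) := by
  obtain ⟨t, rfl⟩ : ∃ t, l = s + t := ⟨l - s, by omega⟩
  have ht : 1 ≤ t := by omega
  rw [Nat.add_sub_cancel_left]
  have hs0 : (0 : ℝ) < s := by exact_mod_cast hs
  have ht0 : (0 : ℝ) < t := by exact_mod_cast ht
  have h1 := factorial_le_stirling (s + t) (by omega)
  have h2 := Stirling.le_factorial_stirling s
  have h3 := Stirling.le_factorial_stirling t
  have hch : ((s + t).choose s : ℝ) * (s ! * t !) = (s + t) ! := by
    have := Nat.choose_mul_factorial_mul_factorial (Nat.le_add_right s t)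
    rw [Nat.add_sub_cancel_left] at this
    rw [← mul_assoc]
    exact_mod_cast this
  set e := Real.exp 1 with he
  have he0 : 0 < e := Real.exp_pos 1
  have hle : e ≤ 2 * Real.pi := by
    have := Real.exp_one_lt_d9
    have := Real.pi_gt_three
    linarith
  have hsq : √(2 * Real.pi * s) * √(2 * Real.pi * t) = 2 * Real.pi * (√s * √t) := by
    rw [Real.sqrt_mul (show (0 : ℝ) ≤ 2 * Real.pi by positivity) (s : ℝ),
      Real.sqrt_mul (show (0 : ℝ) ≤ 2 * Real.pi by positivity) (t : ℝ)]
    have := Real.mul_self_sqrt (show (0 : ℝ) ≤ 2 * Real.pi by positivity)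
    linear_combination √s * √t * this
  have h4 : e * (√s * √t) * (((s : ℝ) / e) ^ s * ((t : ℝ) / e) ^ t) ≤ (s ! : ℝ) * t ! := by
    calc e * (√s * √t) * (((s : ℝ) / e) ^ s * ((t : ℝ) / e) ^ t)
        ≤ 2 * Real.pi * (√s * √t) * (((s : ℝ) / e) ^ s * ((t : ℝ) / e) ^ t) := by gcongr
      _ = (√(2 * Real.pi * s) * ((s : ℝ) / e) ^ s) * (√(2 * Real.pi * t) * ((t : ℝ) / e) ^ t) := by
          rw [← hsq]; ring
      _ ≤ _ := by gcongr
  have h5 : ((s + t).choose s : ℝ) * (e * (√s * √t) * (((s : ℝ) / e) ^ s * ((t : ℝ) / e) ^ t)) ≤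
      e * √(s + t : ℕ) * (((s + t : ℕ) : ℝ) / e) ^ (s + t) := by
    refine le_trans ?_ h1
    rw [← hch]
    gcongr
  have h6 : ((s + t).choose s : ℝ) * (s : ℝ) ^ s * (t : ℝ) ^ t * (√s * √t) ≤
      ((s + t : ℕ) : ℝ) ^ (s + t) * √(s + t : ℕ) := by
    have hk : 0 < e / e ^ (s + t) := by positivity
    refine le_of_mul_le_mul_left ?_ hk
    calc _ = ((s + t).choose s : ℝ) * (e * (√s * √t) * (((s : ℝ) / e) ^ s * ((t : ℝ) / e) ^ t)) := by
          rw [div_pow, div_pow, pow_add]; field_simp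
      _ ≤ _ := h5
      _ = _ := by rw [div_pow]; field_simp
  rw [mul_div_assoc', le_div_iff₀ (by positivity)]
  exact h6

lemma sum_inv_sqrt_le (m : ℕ) : ∑ s ∈ Ico 1 (m + 1), 1 / √(s : ℝ) ≤ 2 * √m := by
  induction m with
  | zero => simp
  | succ m ih =>
    rw [sum_Ico_succ_top (by omega)]
    have h : 1 / √((m + 1 : ℕ) : ℝ) ≤ 2 * √((m + 1 : ℕ) : ℝ) - 2 * √(m : ℝ) := by
      have hpos : 0 < √((m + 1 : ℕ) : ℝ) := by positivity
      rw [div_le_iff₀ hpos]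
      have h1 := Real.mul_self_sqrt (show (0 : ℝ) ≤ ((m + 1 : ℕ) : ℝ) by positivity)
      have h2 := Real.mul_self_sqrt (show (0 : ℝ) ≤ (m : ℝ) by positivity)
      push_cast at *
      nlinarith [sq_nonneg (√(m + 1 : ℝ) - √(m : ℝ))]
    linarith

/-- Discrete version of the integral of t^(c/2-1). The increment (l+1)^(c/2) - l^(c/2) ≥ (c/2)
l^(c/2-1) is Bernoulli's inequality with exponent c/2 ≥ 1. -/
lemma sum_sqrt_pow_le (c l : ℕ) (hc : 2 ≤ c) :
    ∑ t ∈ Ico 1 l, √(t : ℝ) ^ (c - 2) ≤ 2 / c * √(l : ℝ) ^ c := by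
  have hc0 : (0 : ℝ) < c := by positivity
  induction l with
  | zero => simp; positivity
  | succ l ih =>
    rcases Nat.eq_zero_or_pos l with rfl | hl
    · simp
      positivity
    rw [sum_Ico_succ_top (by omega)]
    have hl0 : (0 : ℝ) < l := by exact_mod_cast hl
    have h : √(l : ℝ) ^ (c - 2) * (c / 2) + √(l : ℝ) ^ c ≤ √((l + 1 : ℕ) : ℝ) ^ c := by
      have hB : 1 + (c / 2 : ℝ) * (1 / l) ≤ (1 + 1 / (l : ℝ)) ^ (c / 2 : ℝ) :=
        one_add_mul_self_le_rpow_one_add (by have : (0 : ℝ) ≤ 1 / l := by positivity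
                                             linarith) (by
          rw [le_div_iff₀ (by norm_num)]; exact_mod_cast (by omega : 1 * 2 ≤ c))
      have hsq : ∀ x : ℝ, 0 ≤ x → √x ^ c = x ^ (c / 2 : ℝ) := by
        intro x hx
        rw [Real.sqrt_eq_rpow, ← Real.rpow_natCast, ← Real.rpow_mul hx]
        congr 1
        ring
      have h1 : √(l : ℝ) ^ c = √(l : ℝ) ^ (c - 2) * l := by
        obtain ⟨d, rfl⟩ : ∃ d, c = d + 2 := ⟨c - 2, by omega⟩
        rw [Nat.add_sub_cancel, pow_add, Real.sq_sqrt hl0.le]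
      have h2 : √(l : ℝ) ^ (c - 2) * (c / 2) + √(l : ℝ) ^ c =
          √(l : ℝ) ^ c * (1 + (c / 2 : ℝ) * (1 / l)) := by
        rw [h1]; field_simp; ring
      rw [h2, hsq _ (by positivity), hsq _ (by positivity)]
      calc (l : ℝ) ^ (c / 2 : ℝ) * (1 + (c / 2 : ℝ) * (1 / l))
          ≤ (l : ℝ) ^ (c / 2 : ℝ) * (1 + 1 / (l : ℝ)) ^ (c / 2 : ℝ) := by gcongr
        _ = _ := by
            rw [← Real.mul_rpow hl0.le (by positivity)]
            congr 1
            push_cast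
            field_simp
    have h3 : √(l : ℝ) ^ (c - 2) + 2 / c * √(l : ℝ) ^ c ≤ 2 / c * √((l + 1 : ℕ) : ℝ) ^ c := by
      calc _ = 2 / c * (√(l : ℝ) ^ (c - 2) * (c / 2) + √(l : ℝ) ^ c) := by field_simp
        _ ≤ _ := by gcongr
    linarith

/-- The case c = 1 of the Beta sum below. One of s and l - s is at least l/2, so one factor is at
most √(2/l), and the sum of the other is at most 2√l. -/
lemma sum_inv_sqrt_mul_inv_sqrt_le (l : ℕ) :
    ∑ s ∈ Ico 1 l, 1 / √(s : ℝ) * (1 / √((l - s : ℕ) : ℝ)) ≤ 6 := by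
  rcases Nat.eq_zero_or_pos l with rfl | hl
  · simp
  have hl0 : (0 : ℝ) < l := by exact_mod_cast hl
  have hpt : ∀ s ∈ Ico 1 l, 1 / √(s : ℝ) * (1 / √((l - s : ℕ) : ℝ)) ≤
      √2 / √l * (1 / √(s : ℝ) + 1 / √((l - s : ℕ) : ℝ)) := by
    intro s hs
    rw [mem_Ico] at hs
    have hsum : (s : ℝ) + ((l - s : ℕ) : ℝ) = l := by
      rw [Nat.cast_sub hs.2.le]; ring
    have hs0 : (0 : ℝ) < s := by exact_mod_cast hs.1
    have ht0 : (0 : ℝ) < ((l - s : ℕ) : ℝ) := by exact_mod_cast (by omega : 0 < l - s)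
    have key : ∀ x : ℝ, 0 < x → (l : ℝ) / 2 ≤ x → 1 / √x ≤ √2 / √l := by
      intro x hx h
      rw [div_le_div_iff₀ (Real.sqrt_pos.2 hx) (Real.sqrt_pos.2 hl0), one_mul,
        ← Real.sqrt_mul (by norm_num)]
      exact Real.sqrt_le_sqrt (by linarith)
    have hnn1 : 0 ≤ 1 / √(s : ℝ) := by positivity
    have hnn2 : 0 ≤ 1 / √((l - s : ℕ) : ℝ) := by positivity
    rcases le_total ((l : ℝ) / 2) s with h | h
    · have := key _ hs0 h
      have h0 : 0 ≤ √2 / √(l : ℝ) := by positivity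
      nlinarith
    · have := key ((l - s : ℕ) : ℝ) ht0 (by linarith)
      have h0 : 0 ≤ √2 / √(l : ℝ) := by positivity
      nlinarith
  have hsl : √((l - 1 : ℕ) : ℝ) ≤ √(l : ℝ) := Real.sqrt_le_sqrt (by exact_mod_cast Nat.sub_le l 1)
  have h1 : ∑ s ∈ Ico 1 l, 1 / √(s : ℝ) ≤ 2 * √l := by
    have := sum_inv_sqrt_le (l - 1)
    rw [Nat.sub_add_cancel hl] at this
    linarith
  have h2 : ∑ s ∈ Ico 1 l, 1 / √((l - s : ℕ) : ℝ) = ∑ s ∈ Ico 1 l, 1 / √(s : ℝ) := by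
    refine sum_bij' (fun s _ => l - s) (fun s _ => l - s) ?_ ?_ ?_ ?_ ?_
    · intro s hs; rw [mem_Ico] at hs ⊢; omega
    · intro s hs; rw [mem_Ico] at hs ⊢; omega
    · intro s hs; rw [mem_Ico] at hs; omega
    · intro s hs; rw [mem_Ico] at hs; omega
    · intro s hs; rfl
  calc _ ≤ ∑ s ∈ Ico 1 l, √2 / √l * (1 / √(s : ℝ) + 1 / √((l - s : ℕ) : ℝ)) := sum_le_sum hpt
    _ = √2 / √l * (2 * ∑ s ∈ Ico 1 l, 1 / √(s : ℝ)) := by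
        rw [← mul_sum, sum_add_distrib, h2]; ring
    _ ≤ √2 / √l * (2 * (2 * √l)) := by gcongr
    _ = 4 * √2 := by
        have : √(l : ℝ) ≠ 0 := (Real.sqrt_pos.2 hl0).ne'
        field_simp; ring
    _ ≤ 6 := by
        have : √2 ≤ 1.5 := by
          rw [Real.sqrt_le_left (by norm_num)]; norm_num
        linarith

/-- A discrete Beta integral. -/
lemma sum_inv_sqrt_mul_pow_le {c l : ℕ} (hc : 1 ≤ c) (hl : 1 ≤ l) :
    ∑ s ∈ Ico 1 l, 1 / √(s : ℝ) * (√((l - s : ℕ) : ℝ) ^ (c - 1) / √((l - s : ℕ) : ℝ)) ≤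
      6 / √c * √(l : ℝ) ^ (c - 1) := by
  rcases Nat.lt_or_ge c 2 with h | h
  · have : c = 1 := by omega
    subst this
    simpa using sum_inv_sqrt_mul_inv_sqrt_le l
  have hc0 : (0 : ℝ) < c := by positivity
  have hl0 : (0 : ℝ) < l := by exact_mod_cast hl
  have hsc : 0 < √(c : ℝ) := Real.sqrt_pos.2 hc0
  have hsl : 0 < √(l : ℝ) := Real.sqrt_pos.2 hl0
  have hpow : ∀ x : ℝ, 0 < x → √x ^ (c - 1) / √x = √x ^ (c - 2) := by
    intro x hx
    have := Real.sqrt_pos.2 hx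
    rw [show c - 1 = (c - 2) + 1 by omega, pow_succ, mul_div_assoc, div_self this.ne', mul_one]
  -- The mass of the Beta integrand sits at s of order l/c, so the sum is cut there. Below the cut l
  -- - s is replaced by l; above it 1/√s ≤ √(c/l).
  have hpt : ∀ s ∈ Ico 1 l, 1 / √(s : ℝ) * (√((l - s : ℕ) : ℝ) ^ (c - 1) / √((l - s : ℕ) : ℝ)) ≤
      (if s ≤ l / c then 1 / √(s : ℝ) * √(l : ℝ) ^ (c - 2) else 0) +
        √c / √l * √((l - s : ℕ) : ℝ) ^ (c - 2) := by
    intro s hs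
    rw [mem_Ico] at hs
    have hs0 : (0 : ℝ) < s := by exact_mod_cast hs.1
    rw [hpow _ (by exact_mod_cast (by omega : 0 < l - s))]
    split_ifs with hle
    · have h1 : √((l - s : ℕ) : ℝ) ^ (c - 2) ≤ √(l : ℝ) ^ (c - 2) := by
        gcongr
        omega
      have h2 : 0 ≤ √c / √l * √((l - s : ℕ) : ℝ) ^ (c - 2) := by positivity
      have h3 : 1 / √(s : ℝ) * √((l - s : ℕ) : ℝ) ^ (c - 2) ≤ 1 / √(s : ℝ) * √(l : ℝ) ^ (c - 2) := by
        gcongr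
      linarith
    · rw [zero_add]
      refine mul_le_mul_of_nonneg_right ?_ (by positivity)
      rw [div_le_div_iff₀ (Real.sqrt_pos.2 hs0) hsl, one_mul, ← Real.sqrt_mul hc0.le]
      refine Real.sqrt_le_sqrt ?_
      have h1 : l ≤ c * s := by
        have := Nat.lt_mul_of_div_lt (not_le.1 hle) (by omega : 0 < c)
        linarith
      exact_mod_cast h1
  have hA : ∑ s ∈ Ico 1 l, (if s ≤ l / c then 1 / √(s : ℝ) * √(l : ℝ) ^ (c - 2) else 0) ≤
      2 / √c * √(l : ℝ) ^ (c - 1) := by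
    rw [← sum_filter]
    calc _ ≤ ∑ s ∈ Ico 1 (l / c + 1), 1 / √(s : ℝ) * √(l : ℝ) ^ (c - 2) := by
          refine sum_le_sum_of_subset_of_nonneg ?_ fun _ _ _ => by positivity
          intro s hs
          rw [mem_filter, mem_Ico] at hs
          rw [mem_Ico]
          omega
      _ ≤ 2 * √((l / c : ℕ) : ℝ) * √(l : ℝ) ^ (c - 2) := by
          rw [← sum_mul]
          gcongr
          exact sum_inv_sqrt_le _
      _ ≤ 2 * (√l / √c) * √(l : ℝ) ^ (c - 2) := by
          gcongr
          rw [← Real.sqrt_div hl0.le]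
          exact Real.sqrt_le_sqrt Nat.cast_div_le
      _ = _ := by
          rw [show c - 1 = (c - 2) + 1 by omega, pow_succ]; ring
  have hB : ∑ s ∈ Ico 1 l, √c / √l * √((l - s : ℕ) : ℝ) ^ (c - 2) ≤
      2 / √c * √(l : ℝ) ^ (c - 1) := by
    have h2 : ∑ s ∈ Ico 1 l, √((l - s : ℕ) : ℝ) ^ (c - 2) = ∑ s ∈ Ico 1 l, √(s : ℝ) ^ (c - 2) := by
      refine sum_bij' (fun s _ => l - s) (fun s _ => l - s) ?_ ?_ ?_ ?_ ?_
      · intro s hs; rw [mem_Ico] at hs ⊢; omega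
      · intro s hs; rw [mem_Ico] at hs ⊢; omega
      · intro s hs; rw [mem_Ico] at hs; omega
      · intro s hs; rw [mem_Ico] at hs; omega
      · intro s hs; rfl
    rw [← mul_sum, h2]
    calc _ ≤ √c / √l * (2 / c * √(l : ℝ) ^ c) := by
          gcongr
          exact sum_sqrt_pow_le c l h
      _ = _ := by
          have hcc : (c : ℝ) = √c * √c := (Real.mul_self_sqrt hc0.le).symm
          have hpc : √(l : ℝ) ^ c = √(l : ℝ) ^ (c - 1) * √l := by
            rw [← pow_succ]; congr 1; omega
          rw [hpc]
          field_simp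
          rw [Real.sq_sqrt hc0.le]
  calc _ ≤ _ := sum_le_sum hpt
    _ ≤ 2 / √c * √(l : ℝ) ^ (c - 1) + 2 / √c * √(l : ℝ) ^ (c - 1) := by
        rw [sum_add_distrib]; exact add_le_add hA hB
    _ ≤ _ := by
        have : 0 ≤ 2 / √c * √(l : ℝ) ^ (c - 1) := by positivity
        have h6 : 6 / √c * √(l : ℝ) ^ (c - 1) = 3 * (2 / √c * √(l : ℝ) ^ (c - 1)) := by ring
        linarith

/-- A bound for the number of forests with `c` components and two marked vertices in each
component on `l` vertices. -/
def forestBound (l c : ℕ) : ℝ :=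
  (l : ℝ) ^ l * (6 * √l) ^ (c - 1) / ((c - 1).factorial * √(c - 1).factorial)

lemma forestBound_nonneg (l c : ℕ) : 0 ≤ forestBound l c := by
  unfold forestBound; positivity

/-- `forestBound` is a supersolution of the recursion in `blockSum_succ_le`. Stirling turns the sum
over the size of the marked block into the discrete Beta sum, and a new component multiplies the
bound by 6√l / (c√c). -/
lemma sum_choose_mul_forestBound_le {c l : ℕ} (hc : 1 ≤ c) (hl : 1 ≤ l) :
    ∑ s ∈ Ico 1 l, (l.choose s : ℝ) * ((s : ℝ) ^ s * forestBound (l - s) c) ≤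
      (c + 1) * forestBound l (c + 1) := by
  have hl0 : (0 : ℝ) < l := by exact_mod_cast hl
  have hc0 : (0 : ℝ) < c := by exact_mod_cast hc
  set κ : ℝ := 6 ^ (c - 1) / ((c - 1).factorial * √(c - 1).factorial) with hκ
  have hκ0 : 0 ≤ κ := by positivity
  have hpt : ∀ s ∈ Ico 1 l, (l.choose s : ℝ) * ((s : ℝ) ^ s * forestBound (l - s) c) ≤
      κ * (l : ℝ) ^ l * √l *
        (1 / √(s : ℝ) * (√((l - s : ℕ) : ℝ) ^ (c - 1) / √((l - s : ℕ) : ℝ))) := by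
    intro s hs
    rw [mem_Ico] at hs
    have h := choose_mul_pow_mul_pow_le hs.1 hs.2
    calc _ = κ * √((l - s : ℕ) : ℝ) ^ (c - 1) *
          ((l.choose s : ℝ) * (s : ℝ) ^ s * ((l - s : ℕ) : ℝ) ^ (l - s)) := by
          rw [forestBound, hκ, mul_pow]; ring
      _ ≤ κ * √((l - s : ℕ) : ℝ) ^ (c - 1) * ((l : ℝ) ^ l * (√l / (√s * √(l - s : ℕ)))) := by
          gcongr
      _ = _ := by ring
  calc _ ≤ _ := sum_le_sum hpt
    _ ≤ κ * (l : ℝ) ^ l * √l * (6 / √c * √(l : ℝ) ^ (c - 1)) := by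
        rw [← mul_sum]
        exact mul_le_mul_of_nonneg_left (sum_inv_sqrt_mul_pow_le hc hl) (by positivity)
    _ = c * forestBound l (c + 1) := by
        obtain ⟨d, rfl⟩ : ∃ d, c = d + 1 := ⟨c - 1, by omega⟩
        rw [forestBound, hκ]
        simp only [Nat.add_sub_cancel, Nat.factorial_succ]
        rw [Nat.cast_mul, Real.sqrt_mul (by positivity)]
        have h1 : ((d + 1 : ℕ) : ℝ) ≠ 0 := by positivity
        have h2 : √((d + 1 : ℕ) : ℝ) ≠ 0 := by positivity
        have h3 : (d.factorial : ℝ) ≠ 0 := by positivity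
        have h4 : √(d.factorial : ℝ) ≠ 0 := by positivity
        field_simp
        ring
    _ ≤ _ := by
        refine mul_le_mul_of_nonneg_right (by linarith) (forestBound_nonneg _ _)

variable {V : Type*} [Fintype V] [DecidableEq V]

/-- Induction on c through `blockSum_succ_le`. A marked block equal to S contributes nothing, as no
nonempty block remains. -/
lemma blockSum_le_forestBound (S : Finset V) (c : ℕ) (hc : 1 ≤ c) :
    blockSum S c ≤ forestBound S.card c := by
  classical
  induction c, hc using Nat.le_induction generalizing S with
  | base =>
    have hsub : partitions S 1 ⊆ {{S}} := by
      intro P hP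
      obtain ⟨-, h2, -, h4⟩ := mem_partitions.1 hP
      obtain ⟨U, rfl⟩ := card_eq_one.1 h4
      rw [singleton_biUnion, id] at h2
      rw [h2, mem_singleton]
    calc blockSum S 1 ≤ ∑ P ∈ ({{S}} : Finset (Finset (Finset V))), ∏ U ∈ P, (U.card : ℝ) ^ U.card :=
          sum_le_sum_of_subset_of_nonneg hsub fun _ _ _ => prod_nonneg fun _ _ => by positivity
      _ = _ := by simp [forestBound]
  | succ c hc ih =>
    have hempty : ∀ c, 1 ≤ c → blockSum (∅ : Finset V) c = 0 := by
      intro c hc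
      refine sum_eq_zero fun P hP => ?_
      exfalso
      obtain ⟨-, h2, h3, h4⟩ := mem_partitions.1 hP
      obtain ⟨U, hU⟩ := card_pos.1 (by omega : 0 < P.card)
      have hUe : U = ∅ := by
        have := subset_biUnion_of_mem id hU
        rw [h2] at this
        exact subset_empty.1 this
      exact h3 (hUe ▸ hU)
    rcases Nat.eq_zero_or_pos S.card with h0 | hpos
    · rw [card_eq_zero.1 h0, hempty _ (by omega)]
      exact forestBound_nonneg _ _
    have h1 := blockSum_succ_le S c
    set f : ℕ → ℝ := fun s => if s ∈ Ico 1 S.card then (s : ℝ) ^ s * forestBound (S.card - s) c else 0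
      with hf
    have hf0 : ∀ s, 0 ≤ f s := by
      intro s
      simp only [hf]
      split_ifs
      · exact mul_nonneg (by positivity) (forestBound_nonneg _ _)
      · exact le_rfl
    have h2 : ∑ U ∈ S.powerset.erase ∅, (U.card : ℝ) ^ U.card * blockSum (S \ U) c ≤
        ∑ U ∈ S.powerset, f U.card := by
      calc _ ≤ ∑ U ∈ S.powerset.erase ∅, f U.card := by
            refine sum_le_sum fun U hU => ?_
            obtain ⟨hne, hUS⟩ := mem_erase.1 hU
            rw [mem_powerset] at hUS
            have hU1 : 1 ≤ U.card := card_pos.2 (nonempty_iff_ne_empty.2 hne)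
            by_cases hlt : U.card < S.card
            · simp only [hf]
              rw [if_pos (mem_Ico.2 ⟨hU1, hlt⟩)]
              refine mul_le_mul_of_nonneg_left ?_ (by positivity)
              have := ih (S \ U)
              rwa [card_sdiff_of_subset hUS] at this
            · have hUe : U = S := eq_of_subset_of_card_le hUS (not_lt.1 hlt)
              rw [hUe, Finset.sdiff_self, hempty c hc, mul_zero]
              exact hf0 _
        _ ≤ _ := sum_le_sum_of_subset_of_nonneg (erase_subset _ _) fun _ _ _ => hf0 _
    rw [sum_powerset_apply_card] at h2
    have h3 : ∑ s ∈ range (S.card + 1), S.card.choose s • f s =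
        ∑ s ∈ Ico 1 S.card, (S.card.choose s : ℝ) * ((s : ℝ) ^ s * forestBound (S.card - s) c) := by
      rw [← sum_subset (s₁ := Ico 1 S.card)]
      · refine sum_congr rfl fun s hs => ?_
        simp only [hf]
        rw [if_pos hs, nsmul_eq_mul]
      · intro s hs
        rw [mem_Ico] at hs
        rw [mem_range]
        omega
      · intro s _ hs
        simp only [hf]
        rw [if_neg hs, smul_zero]
    have h4 := sum_choose_mul_forestBound_le hc hpos
    have h5 : ((c : ℝ) + 1) * blockSum S (c + 1) ≤ (c + 1) * forestBound S.card (c + 1) := by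
      linarith
    exact le_of_mul_le_mul_left h5 (by positivity)

end

/-! ### Overlap terms for pairs of trees with a small intersection -/

section

open scoped Nat

/-- Each term is t^(2m)/m! times t^m/√(m!). The second factor is the square root of a term of the
series of exp(t²), hence at most exp(t²/2), and the first factors sum to at most exp(t²). -/
lemma sum_cube_pow_div_le {t : ℝ} (ht : 0 ≤ t) (M : ℕ) :
    ∑ m ∈ range M, (t ^ 3) ^ m / ((m ! : ℝ) * √(m ! : ℝ)) ≤ Real.exp (3 / 2 * t ^ 2) := by
  have h2 : 0 ≤ t ^ 2 := by positivity
  have hterm : ∀ m : ℕ, (t ^ 3) ^ m / ((m ! : ℝ) * √(m ! : ℝ)) ≤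
      (t ^ 2) ^ m / (m ! : ℝ) * Real.exp (t ^ 2 / 2) := by
    intro m
    have h1 : t ^ m / √(m ! : ℝ) ≤ Real.exp (t ^ 2 / 2) := by
      have h3 := Real.pow_div_factorial_le_exp _ h2 m
      have h4 : t ^ m / √(m ! : ℝ) = √((t ^ 2) ^ m / (m ! : ℝ)) := by
        rw [Real.sqrt_div (by positivity), ← pow_mul, mul_comm 2 m, pow_mul,
          Real.sqrt_sq (by positivity)]
      rw [h4]
      calc √((t ^ 2) ^ m / (m ! : ℝ)) ≤ √(Real.exp (t ^ 2)) := Real.sqrt_le_sqrt h3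
        _ = Real.exp (t ^ 2 / 2) := by rw [Real.exp_half]
    calc (t ^ 3) ^ m / ((m ! : ℝ) * √(m ! : ℝ)) =
          (t ^ 2) ^ m / (m ! : ℝ) * (t ^ m / √(m ! : ℝ)) := by
            rw [div_mul_div_comm, ← mul_pow]; ring_nf
      _ ≤ _ := by gcongr
  calc _ ≤ ∑ m ∈ range M, (t ^ 2) ^ m / (m ! : ℝ) * Real.exp (t ^ 2 / 2) :=
        sum_le_sum fun m _ => hterm m
    _ = (∑ m ∈ range M, (t ^ 2) ^ m / (m ! : ℝ)) * Real.exp (t ^ 2 / 2) := by rw [sum_mul]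
    _ ≤ Real.exp (t ^ 2) * Real.exp (t ^ 2 / 2) := by
        gcongr
        exact Real.sum_le_exp_of_nonneg h2 M
    _ = _ := by rw [← Real.exp_add]; ring_nf

/-- A Chernoff bound with a free tilt θ, chosen later according to the size of k - l. -/
lemma choose_mul_pow_le_exp {p θ : ℝ} (hp : 0 ≤ p) (hθ : 0 < θ) (N j : ℕ) :
    (N.choose j : ℝ) * p ^ j ≤ Real.exp (θ * p * N) / θ ^ j := by
  rw [le_div_iff₀ (by positivity)]
  calc (N.choose j : ℝ) * p ^ j * θ ^ j ≤ (N : ℝ) ^ j / (j ! : ℝ) * p ^ j * θ ^ j := by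
        gcongr
        exact Nat.choose_le_pow_div j N
    _ = (θ * p * N) ^ j / (j ! : ℝ) := by rw [mul_pow, mul_pow]; ring
    _ ≤ _ := Real.pow_div_factorial_le_exp _ (by positivity) j

lemma pow_div_factorial_le_pow {a : ℝ} (ha : 0 ≤ a) {r : ℕ} (hr : 1 ≤ r) :
    a ^ r / (r ! : ℝ) ≤ (Real.exp 1 * a / r) ^ r := by
  have hr0 : (0 : ℝ) < r := by exact_mod_cast hr
  have h := Real.pow_div_factorial_le_exp (r : ℝ) hr0.le r
  have h2 : Real.exp r = Real.exp 1 ^ r := by rw [← Real.exp_nat_mul, mul_one]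
  rw [h2] at h
  calc a ^ r / (r ! : ℝ) = (a / r) ^ r * ((r : ℝ) ^ r / (r ! : ℝ)) := by
        rw [div_pow]; field_simp
    _ ≤ (a / r) ^ r * Real.exp 1 ^ r := by gcongr
    _ = _ := by rw [← mul_pow]; ring_nf

lemma choose_le_exp_mul_div_pow (n : ℕ) {r : ℕ} (hr : 1 ≤ r) :
    (n.choose r : ℝ) ≤ (Real.exp 1 * n / r) ^ r :=
  (Nat.choose_le_pow_div r n).trans (pow_div_factorial_le_pow (by positivity) hr)

lemma choose_div_choose_le {n k l : ℕ} (hlk : l ≤ k) (hkn : k ≤ n) :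
    (k.choose l : ℝ) ≤ n.choose l * ((k : ℝ) / n) ^ l := by
  induction l with
  | zero => simp
  | succ l ih =>
    have ih := ih (by omega)
    have hn0 : (0 : ℝ) < n := by exact_mod_cast (by omega : 0 < n)
    have hl0 : (0 : ℝ) < (l + 1 : ℕ) := by positivity
    have h1 : ∀ m : ℕ, l + 1 ≤ m →
        (m.choose (l + 1) : ℝ) * (l + 1 : ℕ) = m.choose l * ((m : ℝ) - l) := by
      intro m hm
      have := Nat.choose_succ_right_eq m l
      rw [← Nat.cast_sub (by omega)]
      exact_mod_cast this
    refine le_of_mul_le_mul_right ?_ hl0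
    rw [h1 k hlk]
    calc (k.choose l : ℝ) * ((k : ℝ) - l)
        ≤ (n.choose l * ((k : ℝ) / n) ^ l) * (((n : ℝ) - l) * (k / n)) := by
          have hk : ((l : ℕ) : ℝ) ≤ k := by exact_mod_cast (by omega : l ≤ k)
          have hkn' : ((k : ℕ) : ℝ) ≤ n := by exact_mod_cast hkn
          have : (k : ℝ) - l ≤ ((n : ℝ) - l) * (k / n) := by
            rw [mul_div_assoc', le_div_iff₀ hn0]
            nlinarith [(Nat.cast_nonneg l : (0 : ℝ) ≤ l)]
          gcongr
      _ = (n.choose l * ((n : ℝ) - l)) * (((k : ℝ) / n) ^ l * (k / n)) := by ring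
      _ = _ := by rw [← h1 n (by omega), pow_succ]; ring

/-- C(n,k) C(k,l) = C(n,l) C(n-l,k-l), and C(k,l)/C(n,l) ≤ (k/n)^l. -/
lemma choose_mul_choose_le {n k l : ℕ} (hlk : l ≤ k) (hkn : k ≤ n) :
    (k.choose l : ℝ) * (n - k).choose (k - l) ≤
      n.choose k * (k.choose l * ((k : ℝ) / n) ^ l) := by
  have h1 : ((n - k).choose (k - l) : ℝ) ≤ (n - l).choose (k - l) := by
    exact_mod_cast Nat.choose_le_choose _ (by omega)
  have h2 : (n.choose k : ℝ) * k.choose l = n.choose l * (n - l).choose (k - l) := by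
    exact_mod_cast Nat.choose_mul hlk
  have h3 := choose_div_choose_le hlk hkn
  calc (k.choose l : ℝ) * (n - k).choose (k - l)
      ≤ (n.choose l * ((k : ℝ) / n) ^ l) * (n - l).choose (k - l) := by gcongr
    _ = (n.choose l * (n - l).choose (k - l)) * ((k : ℝ) / n) ^ l := by ring
    _ = _ := by rw [← h2]; ring

lemma sum_Icc_pred_le {l : ℕ} {g : ℕ → ℝ} {B : ℝ} (h : ∑ m ∈ range l, g m ≤ B) :
    ∑ c ∈ Icc 1 l, g (c - 1) ≤ B := by
  refine le_trans (le_of_eq ?_) h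
  refine sum_bij' (fun c _ => c - 1) (fun m _ => m + 1) ?_ ?_ ?_ ?_ ?_ <;>
    simp only [mem_Icc, mem_range] <;> first | omega | (intros; trivial)

/-- The factor for the cross edges is bounded by 1. The d = l - c shared edges leave p^d and k^(2d)
missing from `treeProb` squared; since kp ≥ 1 gives l ≤ k²p, the factor l^d contained in l^l pays
for both. -/
lemma overlap_summand_far_le {p : ℝ} {k l c : ℕ} (hp : 0 < p) (hp1 : p < 1)
    (hkp : 1 ≤ (k : ℝ) * p) (hl : 1 ≤ l) (hlk : l < k) (hc : 1 ≤ c) (hcl : c ≤ l) :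
    forestBound l c * (((k - l : ℕ) : ℝ) ^ (c - 1) * (k : ℝ) ^ (k - l - 1)) ^ 2 *
        pairWeight p k l (k - l) c ≤
      treeProb p k ^ 2 * (((1 - p)⁻¹) ^ l.choose 2 * l *
        (((2 * √l) ^ 3) ^ (c - 1) / (((c - 1) ! : ℝ) * √((c - 1) ! : ℝ)))) := by
  obtain ⟨m, rfl⟩ : ∃ m, c = m + 1 := ⟨c - 1, by omega⟩
  obtain ⟨d, rfl⟩ : ∃ d, l = m + 1 + d := ⟨l - (m + 1), by omega⟩
  obtain ⟨r, rfl⟩ : ∃ r, k = m + 1 + d + (r + 1) := ⟨k - (m + 1 + d) - 1, by omega⟩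
  set l := m + 1 + d with hldef
  set k := l + (r + 1) with hkdef
  have e1 : k - l = r + 1 := by omega
  have e2 : l - (m + 1) = d := by omega
  have e3 : m + 1 - 1 = m := by omega
  have e4 : r + 1 - 1 = r := by omega
  have hq : 0 < 1 - p := by linarith
  have hk0 : (0 : ℝ) < k := by positivity
  have hl0 : (0 : ℝ) < l := by positivity
  unfold pairWeight forestBound treeProb
  rw [e1, e2, e3, e4]
  have e5 : k - 2 = m + r + d := by omega
  rw [e5]
  set M := k.choose 2 - (k - 1) with hM
  set F : ℝ := (m ! : ℝ) * √(m ! : ℝ) with hF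
  have hF0 : 0 < F := by positivity
  have hrk : ((r + 1 : ℕ) : ℝ) ≤ k := by exact_mod_cast (by omega : r + 1 ≤ k)
  have hsl : √(l : ℝ) * √l = l := Real.mul_self_sqrt hl0.le
  have hq1 : (1 - p) ^ (2 * M - (l.choose 2 - d)) ≤ (1 - p) ^ (2 * M) * ((1 - p)⁻¹) ^ l.choose 2 := by
    rw [inv_pow, ← div_eq_mul_inv, le_div_iff₀ (by positivity), ← pow_add]
    exact pow_le_pow_of_le_one hq.le (by linarith) (by omega)
  have hp2 : p ^ (2 * (k - 1)) = p ^ (2 * (k - 1) - d) * p ^ d := by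
    rw [← pow_add]; congr 1; omega
  have hld : (l : ℝ) ^ d ≤ ((k : ℝ) ^ 2 * p) ^ d := by
    have hlk' : (l : ℝ) ≤ k := by exact_mod_cast hlk.le
    have : (l : ℝ) ≤ (k : ℝ) ^ 2 * p := by nlinarith
    gcongr
  have hll : (l : ℝ) ^ l = l * (l : ℝ) ^ m * (l : ℝ) ^ d := by
    rw [hldef, ← pow_succ', ← pow_add]
  calc (l : ℝ) ^ l * (6 * √l) ^ m / F * (((r + 1 : ℕ) : ℝ) ^ m * (k : ℝ) ^ r) ^ 2 *
        (p ^ (2 * (k - 1) - d) * (1 - p) ^ (2 * M - (l.choose 2 - d)) * min 1 _)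
      ≤ (l * (l : ℝ) ^ m * (((k : ℝ) ^ 2 * p) ^ d)) * (8 * √l) ^ m / F *
        ((k : ℝ) ^ m * (k : ℝ) ^ r) ^ 2 *
        (p ^ (2 * (k - 1) - d) * ((1 - p) ^ (2 * M) * ((1 - p)⁻¹) ^ l.choose 2) * 1) := by
        rw [hll]
        gcongr
        · norm_num
        · exact min_le_left _ _
    _ = _ := by
        have h8 : ((2 * √(l : ℝ)) ^ 3) ^ m = (l : ℝ) ^ m * (8 * √l) ^ m := by
          rw [← mul_pow]
          congr 1
          linear_combination 8 * √(l : ℝ) * hsl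
        rw [h8]
        have hk2 : ((k : ℝ) ^ (m + r + d)) ^ 2 = ((k : ℝ) ^ m * (k : ℝ) ^ r) ^ 2 * ((k : ℝ) ^ 2) ^ d := by
          rw [← pow_add, ← pow_mul, ← pow_mul, ← pow_mul, ← pow_add]; congr 1; ring
        rw [mul_pow ((k : ℝ) ^ (m + r + d)), hk2, mul_pow (p ^ (k - 1)), ← pow_mul (p : ℝ),
          ← pow_mul (1 - p), mul_comm (k - 1) 2, mul_comm M 2, hp2, mul_pow ((k : ℝ) ^ 2) p d]
        ring

lemma overlap_far_le {p : ℝ} {n k l : ℕ} (hp : 0 < p) (hp1 : p < 1) (hkn : k ≤ n)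
    (hkp : 1 ≤ (k : ℝ) * p) (hl : 1 ≤ l) (hlk : l < k) :
    (n.choose k : ℝ) * (k.choose l * (n - k).choose (k - l)) * overlapTerm p forestBound k l ≤
      meanTrees n p k ^ 2 *
        (Real.exp 8 * k ^ 2 / (l * n) * (√(1 - p))⁻¹ ^ l) ^ l := by
  have hq : 0 < 1 - p := by linarith
  have hl0 : (0 : ℝ) < l := by exact_mod_cast hl
  have hn0 : (0 : ℝ) < n := by exact_mod_cast (by omega : 0 < n)
  have h1 : overlapTerm p forestBound k l ≤
      treeProb p k ^ 2 * (((1 - p)⁻¹) ^ l.choose 2 * l * Real.exp (6 * l)) := by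
    unfold overlapTerm
    calc _ ≤ ∑ c ∈ Icc 1 l, treeProb p k ^ 2 * (((1 - p)⁻¹) ^ l.choose 2 * l *
        (((2 * √l) ^ 3) ^ (c - 1) / (((c - 1) ! : ℝ) * √((c - 1) ! : ℝ)))) := by
          refine sum_le_sum fun c hc => ?_
          rw [mem_Icc] at hc
          exact overlap_summand_far_le hp hp1 hkp hl hlk hc.1 hc.2
      _ = treeProb p k ^ 2 * (((1 - p)⁻¹) ^ l.choose 2 * l * ∑ c ∈ Icc 1 l,
          (((2 * √l) ^ 3) ^ (c - 1) / (((c - 1) ! : ℝ) * √((c - 1) ! : ℝ)))) := by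
          rw [mul_sum, mul_sum]
      _ ≤ _ := by
          have := sum_cube_pow_div_le (t := 2 * √(l : ℝ)) (by positivity) l
          rw [show 3 / 2 * (2 * √(l : ℝ)) ^ 2 = 6 * l by
            rw [mul_pow, Real.sq_sqrt hl0.le]; ring] at this
          gcongr
          exact sum_Icc_pred_le (g := fun m => ((2 * √(l : ℝ)) ^ 3) ^ m / ((m ! : ℝ) * √(m ! : ℝ))) this
  have h2 := choose_mul_choose_le hlk.le hkn
  have h3 := choose_le_exp_mul_div_pow k hl
  -- C(l,2) ≤ l²/2. The square root makes the bound an exact l-th power.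
  have hw : ((1 - p)⁻¹) ^ l.choose 2 ≤ ((√(1 - p))⁻¹ ^ l) ^ l := by
    have hs : (1 - p)⁻¹ = ((√(1 - p))⁻¹) ^ 2 := by rw [inv_pow, Real.sq_sqrt hq.le]
    rw [hs, ← pow_mul, ← pow_mul]
    have hone : 1 ≤ (√(1 - p))⁻¹ := by
      rw [one_le_inv₀ (by positivity)]
      exact Real.sqrt_le_one.2 (by linarith)
    refine pow_le_pow_right₀ hone ?_
    rw [Nat.choose_two_right, Nat.mul_div_cancel' (Nat.even_mul_pred_self l).two_dvd]
    exact Nat.mul_le_mul_left _ (Nat.sub_le _ _)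
  have hle : (l : ℝ) ≤ Real.exp 1 ^ l := by
    rw [← Real.exp_nat_mul, mul_one]
    have := Real.add_one_le_exp (l : ℝ)
    linarith
  calc _ ≤ (n.choose k : ℝ) * (n.choose k * ((Real.exp 1 * k / l) ^ l * ((k : ℝ) / n) ^ l)) *
        (treeProb p k ^ 2 * (((√(1 - p))⁻¹ ^ l) ^ l * Real.exp 1 ^ l * Real.exp (6 * l))) := by
        have ho : 0 ≤ overlapTerm p forestBound k l := by
          unfold overlapTerm
          exact sum_nonneg fun c _ => mul_nonneg (mul_nonneg (forestBound_nonneg _ _)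
            (by positivity)) (pairWeight_nonneg hp.le hp1.le _ _ _ _)
        have h2' := h2.trans (mul_le_mul_of_nonneg_left (mul_le_mul_of_nonneg_right h3
          (by positivity : 0 ≤ ((k : ℝ) / n) ^ l)) (by positivity : (0 : ℝ) ≤ n.choose k))
        have h1' := h1.trans (mul_le_mul_of_nonneg_left (mul_le_mul_of_nonneg_right
          (mul_le_mul hw hle (by positivity) (by positivity))
          (by positivity : 0 ≤ Real.exp (6 * l))) (by positivity : 0 ≤ treeProb p k ^ 2))
        gcongr
    _ = _ := by
        unfold meanTrees
        have : Real.exp (6 * l) = Real.exp 6 ^ l := by rw [← Real.exp_nat_mul, mul_comm]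
        rw [this]
        have h8 : Real.exp 8 = Real.exp 1 * Real.exp 1 * Real.exp 6 := by
          rw [← Real.exp_add, ← Real.exp_add]; norm_num
        rw [h8]
        simp only [mul_pow, div_pow, ← pow_mul]
        field_simp
        ring

end

/-! ### Overlap terms for pairs of trees with a large intersection -/

section

open scoped Nat

/-- In the variables c = m + 1, l = c + d, k - l = r + 1: the exponent of 1 - p for two overlapping
trees is at least that of one tree plus k(k-l), up to a deficit of 2(k-l)² + m. -/
lemma near_exponent_le {m d r : ℕ} :
    ((m + 1 + d + (r + 1)).choose 2 - (m + 1 + d + (r + 1) - 1)) +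
        (m + 1 + d + (r + 1)) * (r + 1) ≤
      2 * ((m + 1 + d + (r + 1)).choose 2 - (m + 1 + d + (r + 1) - 1)) -
        ((m + 1 + d).choose 2 - d) + (2 * (r + 1) ^ 2 + m) := by
  have h1 : (m + 1 + d + (r + 1)).choose 2 - (m + 1 + d + (r + 1) - 1) =
      (m + 1 + d + r).choose 2 := by
    have : m + 1 + d + (r + 1) = (m + 1 + d + r) + 1 := by ring
    rw [this, Nat.choose_succ_succ' (m + 1 + d + r) 1, Nat.choose_one_right,
      Nat.add_sub_cancel, Nat.add_sub_cancel_left]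
  have h2 : (m + 1 + d).choose 2 - d + d = (m + 1 + d).choose 2 := by
    apply Nat.sub_add_cancel
    have : m + 1 + d = (m + d) + 1 := by ring
    rw [this, Nat.choose_succ_succ' (m + d) 1, Nat.choose_one_right]
    omega
  rw [h1]
  generalize hy : (m + 1 + d).choose 2 - d = y at *
  have h3 : (m + 1 + d + r).choose 2 = (m + 1 + d).choose 2 + (m + 1 + d) * r + r.choose 2 := by
    have : ((m + 1 + d + r).choose 2 : ℚ) =
        (m + 1 + d).choose 2 + (m + 1 + d) * r + r.choose 2 := by
      simp only [Nat.cast_choose_two]; push_cast; ring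
    exact_mod_cast this
  rw [h3, ← h2]
  have h4 : (m + 1 + d + (r + 1)) * (r + 1) =
      (m + 1 + d) * r + (m + 1 + d) + (r + 1) ^ 2 := by ring
  rw [h4]
  have h5 : r + 1 ≤ (r + 1) ^ 2 := by nlinarith
  omega

lemma min_choose_mul_pow_le {p θ : ℝ} (hp : 0 ≤ p) (hθ : 1 ≤ θ) (r m : ℕ) :
    min 1 (((r * r).choose (3 * r + 1 - (m + 1)) : ℝ) * p ^ (3 * r + 1 - (m + 1))) ≤
      Real.exp (θ * p * r ^ 2) * (θ⁻¹ ^ (3 * r) * θ ^ m) := by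
  have hθ0 : 0 < θ := by linarith
  refine (min_le_right _ _).trans ((choose_mul_pow_le_exp hp hθ0 _ _).trans ?_)
  push_cast
  rw [← sq, div_eq_mul_inv]
  refine mul_le_mul_of_nonneg_left ?_ (by positivity)
  rw [inv_pow, inv_mul_eq_div, inv_eq_one_div, div_le_div_iff₀ (by positivity) (by positivity),
    one_mul, ← pow_add]
  exact pow_le_pow_right₀ hθ (by omega)

lemma inv_one_sub_le_exp {p : ℝ} (hp : 0 ≤ p) (hp2 : p ≤ 1 / 2) :
    (1 - p)⁻¹ ≤ Real.exp (2 * p) := by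
  have h := Real.add_one_le_exp (2 * p)
  refine le_trans ?_ h
  rw [inv_le_comm₀ (by linarith) (by linarith), inv_eq_one_div, div_le_iff₀ (by linarith)]
  nlinarith

/-- One tree is kept as `treeProb` and the cost of the other is spread over the k - l new vertices.
Each contributes kp, (1-p)^k and, for the three cross edges forced per vertex, θ⁻³. The 4 in the
exponential comes from the deficit in `near_exponent_le`, the θ from the Chernoff bound. -/
lemma overlap_summand_near_le {p θ : ℝ} {k l c : ℕ} (hp : 0 < p) (hp1 : p ≤ 1 / 2)
    (hθ : 1 ≤ θ) (hlk : l < k) (hc : 1 ≤ c) (hcl : c ≤ l) :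
    forestBound l c * (((k - l : ℕ) : ℝ) ^ (c - 1) * (k : ℝ) ^ (k - l - 1)) ^ 2 *
        pairWeight p k l (k - l) c ≤
      treeProb p k * (((k * p * ((1 - p) ^ k * Real.exp ((4 + θ) * (p * (k - l : ℕ)))) *
        θ⁻¹ ^ 3) ^ (k - l)) *
        ((12 * √k * ((k - l : ℕ) : ℝ) ^ 2 * p * θ) ^ (c - 1) /
          (((c - 1) ! : ℝ) * √((c - 1) ! : ℝ)))) := by
  obtain ⟨m, rfl⟩ : ∃ m, c = m + 1 := ⟨c - 1, by omega⟩
  obtain ⟨d, rfl⟩ : ∃ d, l = m + 1 + d := ⟨l - (m + 1), by omega⟩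
  obtain ⟨r, rfl⟩ : ∃ r, k = m + 1 + d + (r + 1) := ⟨k - (m + 1 + d) - 1, by omega⟩
  have hexp := near_exponent_le (m := m) (d := d) (r := r)
  set l := m + 1 + d with hldef
  set k := l + (r + 1) with hkdef
  have e1 : k - l = r + 1 := by omega
  have e2 : l - (m + 1) = d := by omega
  have e3 : m + 1 - 1 = m := by omega
  have e4 : r + 1 - 1 = r := by omega
  have hq : 0 < 1 - p := by linarith
  have hk0 : (0 : ℝ) < k := by positivity
  have hl0 : (0 : ℝ) < l := by positivity
  have hθ0 : 0 < θ := by linarith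
  unfold pairWeight forestBound treeProb
  rw [e1, e2, e3, e4]
  have e5 : k - 2 = m + r + d := by omega
  set M := k.choose 2 - (k - 1) with hM
  set F : ℝ := (m ! : ℝ) * √(m ! : ℝ) with hF
  have hF0 : 0 < F := by positivity
  have hlk' : (l : ℝ) ≤ k := by exact_mod_cast hlk.le
  set R : ℝ := ((r + 1 : ℕ) : ℝ) with hR
  have hβ := min_choose_mul_pow_le hp.le hθ (r + 1) m
  rw [← hR] at hβ
  have hqb : (1 - p) ^ (2 * M - (l.choose 2 - d)) ≤
      (1 - p) ^ M * ((1 - p) ^ k) ^ (r + 1) * (Real.exp (4 * (p * R)) ^ (r + 1) * 2 ^ m) := by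
    have hinv : ((1 - p)⁻¹) ^ (2 * (r + 1) ^ 2 + m) ≤ Real.exp (4 * (p * R)) ^ (r + 1) * 2 ^ m := by
      rw [pow_add]
      have h1 : (1 - p)⁻¹ ≤ 2 := by
        rw [inv_le_comm₀ hq (by norm_num)]; linarith
      have h2 : ((1 - p)⁻¹) ^ (2 * (r + 1) ^ 2) ≤ Real.exp (4 * (p * R)) ^ (r + 1) := by
        calc ((1 - p)⁻¹) ^ (2 * (r + 1) ^ 2) ≤ Real.exp (2 * p) ^ (2 * (r + 1) ^ 2) := by
              gcongr
              exact inv_one_sub_le_exp hp.le hp1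
          _ = _ := by
              rw [← Real.exp_nat_mul, ← Real.exp_nat_mul]
              congr 1
              rw [hR]; push_cast; ring
      gcongr
    calc (1 - p) ^ (2 * M - (l.choose 2 - d))
        = (1 - p) ^ (2 * M - (l.choose 2 - d) + (2 * (r + 1) ^ 2 + m)) *
            ((1 - p)⁻¹) ^ (2 * (r + 1) ^ 2 + m) := by
          rw [pow_add _ _ (2 * (r + 1) ^ 2 + m), mul_assoc, ← mul_pow, mul_inv_cancel₀ hq.ne',
            one_pow, mul_one]
      _ ≤ (1 - p) ^ (M + k * (r + 1)) * ((1 - p)⁻¹) ^ (2 * (r + 1) ^ 2 + m) := by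
          gcongr ?_ * _
          exact pow_le_pow_of_le_one hq.le (by linarith) hexp
      _ ≤ (1 - p) ^ (M + k * (r + 1)) * (Real.exp (4 * (p * R)) ^ (r + 1) * 2 ^ m) := by gcongr
      _ = _ := by rw [pow_add, pow_mul]
  have hp2 : p ^ (2 * (k - 1) - d) = p ^ (k - 1) * p ^ (r + 1) * p ^ m := by
    rw [← pow_add, ← pow_add]; congr 1; omega
  have hkk : (l : ℝ) ^ l * ((k : ℝ) ^ r) ^ 2 ≤ (k : ℝ) ^ (k - 2) * (k : ℝ) ^ (r + 1) := by
    calc (l : ℝ) ^ l * ((k : ℝ) ^ r) ^ 2 ≤ (k : ℝ) ^ l * ((k : ℝ) ^ r) ^ 2 := by gcongr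
      _ = _ := by rw [← pow_mul, ← pow_add, ← pow_add]; congr 1; omega
  have hsq : √(l : ℝ) ≤ √(k : ℝ) := Real.sqrt_le_sqrt hlk'
  calc (l : ℝ) ^ l * (6 * √l) ^ m / F * (R ^ m * (k : ℝ) ^ r) ^ 2 *
        (p ^ (2 * (k - 1) - d) * (1 - p) ^ (2 * M - (l.choose 2 - d)) * min 1 _)
      = ((l : ℝ) ^ l * ((k : ℝ) ^ r) ^ 2) * ((6 * √l) ^ m / F * (R ^ m) ^ 2) *
        (p ^ (2 * (k - 1) - d) * (1 - p) ^ (2 * M - (l.choose 2 - d)) * min 1 _) := by ring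
    _ ≤ ((k : ℝ) ^ (k - 2) * (k : ℝ) ^ (r + 1)) * ((6 * √k) ^ m / F * (R ^ m) ^ 2) *
        ((p ^ (k - 1) * p ^ (r + 1) * p ^ m) *
          ((1 - p) ^ M * ((1 - p) ^ k) ^ (r + 1) * (Real.exp (4 * (p * R)) ^ (r + 1) * 2 ^ m)) *
          (Real.exp (θ * p * R ^ 2) * (θ⁻¹ ^ (3 * (r + 1)) * θ ^ m))) := by
        rw [hp2]
        gcongr
    _ = _ := by
        have he : Real.exp (θ * p * R ^ 2) = Real.exp (θ * (p * R)) ^ (r + 1) := by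
          rw [← Real.exp_nat_mul]
          congr 1
          rw [← hR]; ring
        have he2 : Real.exp ((4 + θ) * (p * R)) = Real.exp (4 * (p * R)) * Real.exp (θ * (p * R)) := by
          rw [← Real.exp_add]; ring_nf
        have h12 : (12 * √(k : ℝ) * R ^ 2 * p * θ) ^ m =
            (6 * √(k : ℝ)) ^ m * (R ^ m) ^ 2 * p ^ m * 2 ^ m * θ ^ m := by
          rw [← pow_mul, mul_comm m 2, pow_mul, ← mul_pow, ← mul_pow, ← mul_pow, ← mul_pow]
          congr 1; ring
        rw [he, he2, h12, pow_mul θ⁻¹]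
        simp only [mul_pow]
        ring

/-- The parameter t dominates the cube root of the ratio in the series over c, so that
`sum_cube_pow_div_le` sums it. The two binomial coefficients give e²kn/(k-l)² per new vertex. -/
lemma overlap_near_le {p θ t : ℝ} {n k l : ℕ} (hp : 0 < p) (hp1 : p ≤ 1 / 2) (hθ : 1 ≤ θ)
    (hlk : l < k) (ht : 0 ≤ t)
    (htθ : 12 * √k * ((k - l : ℕ) : ℝ) ^ 2 * p * θ ≤ t ^ 3) :
    (n.choose k : ℝ) * (k.choose l * (n - k).choose (k - l)) * overlapTerm p forestBound k l ≤
      meanTrees n p k * (((Real.exp 2 * (k : ℝ) ^ 2 * (n * p) / ((k - l : ℕ) : ℝ) ^ 2 *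
        ((1 - p) ^ k * Real.exp ((4 + θ) * (p * (k - l : ℕ)))) * θ⁻¹ ^ 3) ^ (k - l)) *
        Real.exp (3 / 2 * t ^ 2)) := by
  have hq : 0 < 1 - p := by linarith
  have hθ0 : 0 < θ := by linarith
  have hr : 1 ≤ k - l := by omega
  have hT := treeProb_nonneg hp.le (by linarith : p ≤ 1) k
  set A : ℝ := k * p * ((1 - p) ^ k * Real.exp ((4 + θ) * (p * (k - l : ℕ)))) * θ⁻¹ ^ 3 with hA
  have hA0 : 0 ≤ A := by positivity
  have h1 : overlapTerm p forestBound k l ≤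
      treeProb p k * (A ^ (k - l) * Real.exp (3 / 2 * t ^ 2)) := by
    unfold overlapTerm
    calc _ ≤ ∑ c ∈ Icc 1 l, treeProb p k * (A ^ (k - l) *
        ((t ^ 3) ^ (c - 1) / (((c - 1) ! : ℝ) * √((c - 1) ! : ℝ)))) := by
          refine sum_le_sum fun c hc => ?_
          rw [mem_Icc] at hc
          refine (overlap_summand_near_le hp hp1 hθ hlk hc.1 hc.2).trans ?_
          gcongr
      _ = treeProb p k * (A ^ (k - l) * ∑ c ∈ Icc 1 l,
          ((t ^ 3) ^ (c - 1) / (((c - 1) ! : ℝ) * √((c - 1) ! : ℝ)))) := by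
          rw [mul_sum, mul_sum]
      _ ≤ _ := by
          gcongr
          exact sum_Icc_pred_le (g := fun m => (t ^ 3) ^ m / ((m ! : ℝ) * √(m ! : ℝ)))
            (sum_cube_pow_div_le ht l)
  have h2 : (k.choose l : ℝ) ≤ (Real.exp 1 * k / (k - l : ℕ)) ^ (k - l) := by
    rw [← Nat.choose_symm hlk.le]
    exact choose_le_exp_mul_div_pow k hr
  have h3 : ((n - k).choose (k - l) : ℝ) ≤ (Real.exp 1 * n / (k - l : ℕ)) ^ (k - l) := by
    refine le_trans ?_ (choose_le_exp_mul_div_pow n hr)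
    exact_mod_cast Nat.choose_le_choose _ (by omega)
  have ho : 0 ≤ overlapTerm p forestBound k l := by
    unfold overlapTerm
    exact sum_nonneg fun c _ => mul_nonneg (mul_nonneg (forestBound_nonneg _ _)
      (by positivity)) (pairWeight_nonneg hp.le (by linarith) _ _ _ _)
  calc _ ≤ (n.choose k : ℝ) * ((Real.exp 1 * k / (k - l : ℕ)) ^ (k - l) *
        (Real.exp 1 * n / (k - l : ℕ)) ^ (k - l)) *
        (treeProb p k * (A ^ (k - l) * Real.exp (3 / 2 * t ^ 2))) := by
        gcongr
    _ = meanTrees n p k * ((Real.exp 1 * k / (k - l : ℕ) *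
        (Real.exp 1 * n / (k - l : ℕ)) * A) ^ (k - l) * Real.exp (3 / 2 * t ^ 2)) := by
        unfold meanTrees
        rw [mul_pow, mul_pow]; ring
    _ = _ := by
        have h8 : Real.exp 2 = Real.exp 1 * Real.exp 1 := by
          rw [← Real.exp_add]; norm_num
        rw [h8, hA]
        congr 3
        field_simp

end

/-! ### Summing the overlap terms near the threshold -/

section

/-- Parameters `n, p, k` for which `k` is close to the threshold `2 log (np) / p`. -/
structure NearThreshold (D : ℝ) (n : ℕ) (p : ℝ) (k : ℕ) : Prop where
  pos : 0 < p
  le_half : p ≤ 1 / 2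
  le_card : k ≤ n
  one_le_const : 1 ≤ D
  one_le_mul : 1 ≤ (n : ℝ) * p
  le_mul : 6144 ^ 2 ≤ (k : ℝ) * p
  pow_mul_le : (1 - p) ^ k * ((n : ℝ) * p) ^ 2 ≤ D
  le_mul_pow : 1 ≤ D * ((n : ℝ) * p) ^ 2 * (1 - p) ^ k

namespace NearThreshold

variable {D p : ℝ} {n k : ℕ}

lemma inv_sqrt_pow_le (h : NearThreshold D n p k) {l : ℕ} (hl : 32 * l ≤ 31 * k) :
    (√(1 - p))⁻¹ ^ l ≤ D * ((n : ℝ) * p) ^ (31 / 32 : ℝ) := by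
  have hp := h.pos
  have hp2 := h.le_half
  have hD := h.one_le_const
  have hx := h.one_le_mul
  have hq : 0 < 1 - p := by linarith
  set x := (n : ℝ) * p with hxdef
  have hx0 : 0 < x := by linarith
  have hinv : (1 - p)⁻¹ ^ k ≤ D * x ^ 2 := by
    rw [inv_pow, inv_le_iff_one_le_mul₀ (by positivity)]
    exact h.le_mul_pow
  have hone : 1 ≤ (1 - p)⁻¹ := by
    rw [one_le_inv₀ hq]; linarith
  -- The 64th power clears the square root and the fraction 31/32 together: the exponent becomes 32l
  -- ≤ 31k.
  refine le_of_pow_le_pow_left₀ (n := 64) (by norm_num) (by positivity) ?_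
  calc ((√(1 - p))⁻¹ ^ l) ^ 64 = (1 - p)⁻¹ ^ (32 * l) := by
        have hs : (1 - p)⁻¹ = ((√(1 - p))⁻¹) ^ 2 := by rw [inv_pow, Real.sq_sqrt hq.le]
        rw [hs, ← pow_mul, ← pow_mul]; congr 1; ring
    _ ≤ (1 - p)⁻¹ ^ (k * 31) := pow_le_pow_right₀ hone (by omega)
    _ = ((1 - p)⁻¹ ^ k) ^ 31 := pow_mul _ _ _
    _ ≤ (D * x ^ 2) ^ 31 := by gcongr
    _ = D ^ 31 * x ^ 62 := by ring
    _ ≤ D ^ 64 * x ^ 62 := by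
        gcongr
        norm_num
    _ = _ := by
        rw [mul_pow D, ← Real.rpow_mul_natCast hx0.le]
        congr 1
        rw [← Real.rpow_natCast]; norm_num

/-- If lp ≤ 1 then (1-p)^(-l/2) ≤ e. Otherwise 1/l ≤ p, and (1-p)^(-l/2) ≤ D(np)^(31/32) still
leaves the power -1/32 of np; this is why l is kept below 31k/32. -/
lemma far_base_le (h : NearThreshold D n p k) {l : ℕ} (hl : 1 ≤ l) (hlk : 32 * l ≤ 31 * k) :
    Real.exp 8 * k ^ 2 / (l * n) * (√(1 - p))⁻¹ ^ l ≤
      Real.exp 9 * k ^ 2 / n + Real.exp 8 * D * (k * p) ^ 2 * ((n : ℝ) * p) ^ (-(1 / 32) : ℝ) := by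
  have hp := h.pos
  have hp2 := h.le_half
  have hD := h.one_le_const
  have hx := h.one_le_mul
  have hq : 0 < 1 - p := by linarith
  have hl0 : (1 : ℝ) ≤ l := by exact_mod_cast hl
  have hn0 : (0 : ℝ) < n := by
    by_contra hn
    have : (n : ℝ) = 0 := le_antisymm (not_lt.1 hn) (Nat.cast_nonneg n)
    rw [this] at hx; norm_num at hx
  have hx0 : 0 < (n : ℝ) * p := by positivity
  rcases le_total ((l : ℝ) * p) 1 with hlp | hlp
  · have hw : (√(1 - p))⁻¹ ^ l ≤ Real.exp 1 := by
      have h1 : (√(1 - p))⁻¹ ≤ Real.exp p := by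
        rw [← Real.sqrt_inv]
        refine Real.sqrt_le_iff.2 ⟨by positivity, ?_⟩
        rw [← Real.exp_nat_mul]
        exact_mod_cast inv_one_sub_le_exp hp.le hp2
      calc (√(1 - p))⁻¹ ^ l ≤ Real.exp p ^ l := by gcongr
        _ = Real.exp (l * p) := by rw [← Real.exp_nat_mul]
        _ ≤ _ := Real.exp_le_exp.2 hlp
    calc _ ≤ Real.exp 8 * k ^ 2 / (1 * n) * Real.exp 1 := by gcongr
      _ = Real.exp 9 * k ^ 2 / n := by
          rw [show (9 : ℝ) = 8 + 1 by norm_num, Real.exp_add]; ring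
      _ ≤ _ := by
          have : 0 ≤ Real.exp 8 * D * (k * p) ^ 2 * ((n : ℝ) * p) ^ (-(1 / 32) : ℝ) := by positivity
          linarith
  · have hw := h.inv_sqrt_pow_le hlk
    have hdiv : Real.exp 8 * (k : ℝ) ^ 2 / (l * n) ≤ Real.exp 8 * (k : ℝ) ^ 2 * p / n := by
      rw [div_le_div_iff₀ (by positivity) hn0]
      have : 0 ≤ Real.exp 8 * (k : ℝ) ^ 2 * n := by positivity
      nlinarith
    calc _ ≤ Real.exp 8 * (k : ℝ) ^ 2 * p / n * (D * ((n : ℝ) * p) ^ (31 / 32 : ℝ)) := by gcongr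
      _ = Real.exp 8 * D * (k * p) ^ 2 * ((n : ℝ) * p) ^ (-(1 / 32) : ℝ) := by
          have : ((n : ℝ) * p) ^ (31 / 32 : ℝ) = ((n : ℝ) * p) * ((n : ℝ) * p) ^ (-(1 / 32) : ℝ) := by
            rw [← Real.rpow_one_add' hx0.le (by norm_num)]; norm_num
          rw [this]
          field_simp
      _ ≤ _ := by
          have : 0 ≤ Real.exp 9 * (k : ℝ) ^ 2 / n := by positivity
          linarith

/-- From e^p (1-p) ≤ 1 one gets e^(kp) ≤ (1-p)^(-k) ≤ D(np)²; then take the power 3/16. -/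
lemma exp_le (h : NearThreshold D n p k) :
    Real.exp (3 / 16 * (k * p)) ≤ D * ((n : ℝ) * p) ^ (3 / 8 : ℝ) := by
  have hp := h.pos
  have hp2 := h.le_half
  have hD := h.one_le_const
  have hx := h.one_le_mul
  have hq : 0 < 1 - p := by linarith
  set x := (n : ℝ) * p with hxdef
  have hx0 : 0 < x := by linarith
  have h1 : Real.exp (k * p) ≤ D * x ^ 2 := by
    have h2 : Real.exp (k * p) * (1 - p) ^ k ≤ 1 := by
      rw [Real.exp_nat_mul, ← mul_pow]
      refine pow_le_one₀ (by positivity) ?_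
      have h3 := Real.one_sub_le_exp_neg p
      calc Real.exp p * (1 - p) ≤ Real.exp p * Real.exp (-p) := by gcongr
        _ = 1 := by rw [← Real.exp_add]; simp
    have h4 := h.le_mul_pow
    have h5 : 0 < (1 - p) ^ k := by positivity
    exact le_of_mul_le_mul_right (h2.trans h4) h5
  calc Real.exp (3 / 16 * (k * p)) = Real.exp (k * p) ^ (3 / 16 : ℝ) := by
        rw [← Real.exp_mul]; ring_nf
    _ ≤ (D * x ^ 2) ^ (3 / 16 : ℝ) := by gcongr
    _ = D ^ (3 / 16 : ℝ) * x ^ (3 / 8 : ℝ) := by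
        rw [Real.mul_rpow (by linarith) (by positivity), ← Real.rpow_natCast_mul hx0.le]
        norm_num
    _ ≤ D * x ^ (3 / 8 : ℝ) := by
        gcongr
        exact Real.rpow_le_self_of_one_le hD (by norm_num)

-- The tilt θ in `overlap_near_le` is large when k - l is small, where the forced cross edges must
-- be exploited, and equal to 1 otherwise.
set_option maxHeartbeats 800000 in
lemma near_le (h : NearThreshold D n p k) {l : ℕ} (hlk : l < k) (hr : 32 * (k - l) ≤ k) :
    (n.choose k : ℝ) * (k.choose l * (n - k).choose (k - l)) * overlapTerm p forestBound k l ≤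
      meanTrees n p k * (Real.exp 21 * D * ((k : ℝ) ^ 3 * √k * p ^ 2 / n) +
        Real.exp 2 * D ^ 2 * (k * p) ^ 4 * ((n : ℝ) * p) ^ (-(5 / 8) : ℝ)) ^ (k - l) := by
  have hp := h.pos
  have hp2 := h.le_half
  have hD := h.one_le_const
  have hx := h.one_le_mul
  have hq : 0 < 1 - p := by linarith
  have hμ := meanTrees_nonneg hp.le (by linarith : p ≤ 1) n k
  have hn0 : (0 : ℝ) < n := by
    by_contra hn
    have : (n : ℝ) = 0 := le_antisymm (not_lt.1 hn) (Nat.cast_nonneg n)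
    rw [this] at hx; norm_num at hx
  have hx0 : 0 < (n : ℝ) * p := by positivity
  have hqk : (1 - p) ^ k ≤ D / ((n : ℝ) * p) ^ 2 := by
    rw [le_div_iff₀ (by positivity)]; exact h.pow_mul_le
  have hk0 : (0 : ℝ) < k := by exact_mod_cast (by omega : 0 < k)
  have hR1 : (1 : ℝ) ≤ (k - l : ℕ) := by exact_mod_cast (by omega : 1 ≤ k - l)
  have hRk : 32 * ((k - l : ℕ) : ℝ) ≤ k := by exact_mod_cast hr
  -- With t = √(k-l)·u the factor exp(3t²/2) is also a (k-l)-th power, so only the base has to be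
  -- estimated.
  have key : ∀ θ u : ℝ, 1 ≤ θ → 0 ≤ u →
      12 * √k * ((k - l : ℕ) : ℝ) ^ 2 * p * θ ≤ (√((k - l : ℕ) : ℝ) * u) ^ 3 →
      ∀ B : ℝ, Real.exp 2 * (k : ℝ) ^ 2 * (n * p) / ((k - l : ℕ) : ℝ) ^ 2 *
        (D / ((n : ℝ) * p) ^ 2 * Real.exp ((4 + θ) * (p * (k - l : ℕ)))) * θ⁻¹ ^ 3 *
        Real.exp (3 / 2 * u ^ 2) ≤ B →
      (n.choose k : ℝ) * (k.choose l * (n - k).choose (k - l)) * overlapTerm p forestBound k l ≤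
        meanTrees n p k * B ^ (k - l) := by
    intro θ u hθ hu h1 B hB
    have hθ0 : 0 < θ := by linarith
    refine (overlap_near_le hp hp2 hθ hlk (by positivity) h1).trans ?_
    gcongr
    have h2 : Real.exp (3 / 2 * (√((k - l : ℕ) : ℝ) * u) ^ 2) = Real.exp (3 / 2 * u ^ 2) ^ (k - l) := by
      rw [← Real.exp_nat_mul, mul_pow, Real.sq_sqrt (by positivity)]; ring_nf
    rw [h2, ← mul_pow]
    refine pow_le_pow_left₀ (by positivity) (le_trans ?_ hB) _
    gcongr
  set R : ℝ := ((k - l : ℕ) : ℝ) with hR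
  have hR0 : 0 < R := by linarith
  have hsR : √R * √R = R := Real.mul_self_sqrt hR0.le
  have hsk : √(k : ℝ) * √k = k := Real.mul_self_sqrt hk0.le
  have hsR1 : 1 ≤ √R := Real.one_le_sqrt.2 hR1
  have hsRk : √R ≤ √(k : ℝ) := Real.sqrt_le_sqrt (by linarith)
  have hE1 : 0 ≤ Real.exp 21 * D * ((k : ℝ) ^ 3 * √k * p ^ 2 / n) := by positivity
  have hE2 : 0 ≤ Real.exp 2 * D ^ 2 * (k * p) ^ 4 * ((n : ℝ) * p) ^ (-(5 / 8) : ℝ) := by positivity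
  -- First case: θ = 1/(√(Rk) p) and u = 3. Then 12√k R²pθ = 12 R^(3/2) ≤ (3√R)³, all exponentials
  -- are bounded, and θ⁻³ turns k²/(npR²) into k^(7/2)p²/(n√R).
  rcases le_total (R * p * (k * p)) 1 with hs | hs
  · have hy0 : 0 < √R * √(k : ℝ) * p := by positivity
    have hy1 : √R * √(k : ℝ) * p ≤ 1 := by
      refine le_of_sq_le_sq ?_ (by norm_num)
      have : (√R * √(k : ℝ) * p) ^ 2 = R * p * (k * p) := by
        linear_combination p ^ 2 * (√(k : ℝ) * √k) * hsR + p ^ 2 * R * hsk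
      linarith
    refine key (√R * √(k : ℝ) * p)⁻¹ 3 ((one_le_inv₀ hy0).2 hy1) (by norm_num) ?_ _ ?_
    · rw [← div_eq_mul_inv, div_le_iff₀ hy0]
      have : (√R * 3) ^ 3 * (√R * √(k : ℝ) * p) = 27 * √k * R ^ 2 * p := by
        linear_combination 27 * √(k : ℝ) * p * (√R * √R + R) * hsR
      rw [this]
      have : 0 ≤ √(k : ℝ) * R ^ 2 * p := by positivity
      nlinarith
    · have hpr : p * R ≤ 1 := by
        refine le_trans ?_ hy1
        nlinarith [mul_le_mul_of_nonneg_left hsRk (Real.sqrt_nonneg R)]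
      have hθpr : (√R * √(k : ℝ) * p)⁻¹ * (p * R) ≤ 1 := by
        rw [inv_mul_le_iff₀ hy0]
        nlinarith [mul_le_mul_of_nonneg_left hsRk (Real.sqrt_nonneg R)]
      calc _ ≤ Real.exp 2 * (k : ℝ) ^ 2 * (n * p) / R ^ 2 *
            (D / ((n : ℝ) * p) ^ 2 * Real.exp 5) * (√R * √(k : ℝ) * p) ^ 3 *
            Real.exp 14 := by
            rw [inv_inv]
            gcongr
            · rw [add_mul]; linarith
            · norm_num
        _ = Real.exp 21 * D * ((k : ℝ) ^ 3 * √k * p ^ 2 / n) / √R := by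
            have h21 : Real.exp 21 = Real.exp 2 * Real.exp 5 * Real.exp 14 := by
              rw [← Real.exp_add, ← Real.exp_add]; norm_num
            rw [h21]
            have h3 : (√R * √(k : ℝ) * p) ^ 3 = R ^ 2 / √R * (k * √k) * p ^ 3 := by
              have : R ^ 2 / √R = R * √R := by
                rw [div_eq_iff (by positivity)]; linear_combination - R * hsR
              rw [this]
              linear_combination √R * √(k : ℝ) * p ^ 3 * (√(k : ℝ) * √k) * hsR +
                √R * √(k : ℝ) * p ^ 3 * R * hsk
            rw [h3]
            field_simp
        _ ≤ Real.exp 21 * D * ((k : ℝ) ^ 3 * √k * p ^ 2 / n) := div_le_self hE1 hsR1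
        _ ≤ _ := by linarith
  -- Second case: θ = 1 and u = √λ/8. Now k ≤ Rλ² removes k²/R², and R ≤ k/32 keeps the exponentials
  -- below e^(3λ/16). The condition on t requires √λ ≥ 12·8³ = 6144, the constant in
  -- `NearThreshold`.
  · set lam : ℝ := k * p with hlam
    have hlam1 : 6144 ^ 2 ≤ lam := h.le_mul
    have hlam0 : 0 < lam := by linarith
    have hsl : 6144 ≤ √lam := by
      rw [Real.le_sqrt (by norm_num) hlam0.le]; exact hlam1
    have hsl2 : √lam * √lam = lam := Real.mul_self_sqrt hlam0.le
    refine key 1 (√lam / 8) le_rfl (by positivity) ?_ _ ?_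
    · have e1 : (√R * (√lam / 8)) ^ 3 = R * √R * lam * √lam / 512 := by
        linear_combination (√R * √lam ^ 3 / 512) * hsR + (R * √R * √lam / 512) * hsl2
      have e2 : 12 * √(k : ℝ) * R ^ 2 * p * 1 = 12 * (R * √R) * (√R * √k * p) := by
        linear_combination -12 * √(k : ℝ) * p * R * hsR
      rw [e1, e2]
      have e3 : √R * √(k : ℝ) * p ≤ lam := by
        rw [hlam]; nlinarith [mul_le_mul_of_nonneg_right hsRk (Real.sqrt_nonneg (k : ℝ))]
      calc 12 * (R * √R) * (√R * √k * p) ≤ 12 * (R * √R) * lam := by gcongr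
        _ = R * √R * lam * 6144 / 512 := by ring
        _ ≤ _ := by gcongr
    · have hk2 : (k : ℝ) ≤ R * lam ^ 2 := by
        calc (k : ℝ) = k * 1 := by ring
          _ ≤ k * (R * p * lam) := by gcongr
          _ = R * lam ^ 2 := by rw [hlam]; ring
      have hexp : Real.exp ((4 + 1) * (p * R)) * Real.exp (3 / 2 * (√lam / 8) ^ 2) ≤
          D * ((n : ℝ) * p) ^ (3 / 8 : ℝ) := by
        refine le_trans ?_ h.exp_le
        rw [← Real.exp_add]
        refine Real.exp_le_exp.2 ?_
        have : (√lam / 8) ^ 2 = lam / 64 := by linear_combination hsl2 / 64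
        rw [this]
        have : p * R ≤ lam / 32 := by rw [hlam]; nlinarith
        rw [← hlam]
        linarith
      calc _ = Real.exp 2 * (k : ℝ) ^ 2 * (n * p) / R ^ 2 * (D / ((n : ℝ) * p) ^ 2) *
            (Real.exp ((4 + 1) * (p * R)) * Real.exp (3 / 2 * (√lam / 8) ^ 2)) := by ring
        _ ≤ Real.exp 2 * (R * lam ^ 2) ^ 2 * (n * p) / R ^ 2 * (D / ((n : ℝ) * p) ^ 2) *
            (D * ((n : ℝ) * p) ^ (3 / 8 : ℝ)) := by gcongr
        _ = Real.exp 2 * D ^ 2 * lam ^ 4 * ((n : ℝ) * p) ^ (-(5 / 8) : ℝ) := by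
            have : ((n : ℝ) * p) ^ (3 / 8 : ℝ) = ((n : ℝ) * p) * ((n : ℝ) * p) ^ (-(5 / 8) : ℝ) := by
              rw [← Real.rpow_one_add' hx0.le (by norm_num)]; norm_num
            rw [this]
            field_simp
        _ ≤ _ := by linarith

end NearThreshold

lemma sum_Icc_pow_le {ρ : ℝ} (h0 : 0 ≤ ρ) (h1 : ρ ≤ 1 / 2) (m : ℕ) :
    ∑ i ∈ Icc 1 m, ρ ^ i ≤ 2 * ρ := by
  suffices ∑ i ∈ Icc 1 m, ρ ^ i ≤ 2 * ρ - 2 * ρ ^ (m + 1) by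
    have : 0 ≤ ρ ^ (m + 1) := by positivity
    linarith
  induction m with
  | zero => simp
  | succ m ih =>
    rw [sum_Icc_succ_top (by omega)]
    have h2 : ρ ^ (m + 1 + 1) ≤ ρ ^ (m + 1) * (1 / 2) := by
      rw [pow_succ]; gcongr
    linarith

/-- Bound for the contribution of pairs of trees with a small intersection. -/
def farError (D : ℝ) (n : ℕ) (p : ℝ) (k : ℕ) : ℝ :=
  Real.exp 9 * k ^ 2 / n + Real.exp 8 * D * (k * p) ^ 2 * ((n : ℝ) * p) ^ (-(1 / 32) : ℝ)

/-- Bound for the contribution of pairs of trees with a large intersection. -/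
def nearError (D : ℝ) (n : ℕ) (p : ℝ) (k : ℕ) : ℝ :=
  Real.exp 21 * D * ((k : ℝ) ^ 3 * √k * p ^ 2 / n) +
    Real.exp 2 * D ^ 2 * (k * p) ^ 4 * ((n : ℝ) * p) ^ (-(5 / 8) : ℝ)

/-- Cut at l = 31k/32: below it a geometric series in l relative to the squared mean, above it one
in k - l relative to the mean. -/
lemma sum_overlap_le {D p : ℝ} {n k : ℕ} (h : NearThreshold D n p k)
    (hf : farError D n p k ≤ 1 / 2) (hn : nearError D n p k ≤ 1 / 2) :
    ∑ l ∈ Icc 1 (k - 1), (n.choose k : ℝ) * (k.choose l * (n - k).choose (k - l)) *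
        overlapTerm p forestBound k l ≤
      meanTrees n p k ^ 2 * (2 * farError D n p k) +
        meanTrees n p k * (2 * nearError D n p k) := by
  have hp := h.pos
  have hp2 := h.le_half
  have hD := h.one_le_const
  have hμ := meanTrees_nonneg hp.le (by linarith : p ≤ 1) n k
  have hf0 : 0 ≤ farError D n p k := by unfold farError; positivity
  have hn0 : 0 ≤ nearError D n p k := by unfold nearError; positivity
  have hkp : 1 ≤ (k : ℝ) * p := le_trans (by norm_num) h.le_mul
  calc _ ≤ ∑ l ∈ Icc 1 (k - 1), (meanTrees n p k ^ 2 * farError D n p k ^ l +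
        meanTrees n p k * nearError D n p k ^ (k - l)) := by
        refine sum_le_sum fun l hl => ?_
        rw [mem_Icc] at hl
        have hlk : l < k := by omega
        by_cases hc : 32 * l ≤ 31 * k
        · refine (overlap_far_le hp (by linarith) h.le_card hkp hl.1 hlk).trans ?_
          have h1 := h.far_base_le hl.1 hc
          have h2 : 0 ≤ meanTrees n p k * nearError D n p k ^ (k - l) := by positivity
          refine le_trans ?_ (le_add_of_nonneg_right h2)
          have hq : 0 < 1 - p := by linarith
          gcongr
          exact h1
        · have h1 := h.near_le hlk (by omega)
          have h2 : 0 ≤ meanTrees n p k ^ 2 * farError D n p k ^ l := by positivity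
          exact le_trans h1 (le_add_of_nonneg_left h2)
    _ = meanTrees n p k ^ 2 * ∑ l ∈ Icc 1 (k - 1), farError D n p k ^ l +
        meanTrees n p k * ∑ l ∈ Icc 1 (k - 1), nearError D n p k ^ l := by
        rw [sum_add_distrib, mul_sum, mul_sum]
        congr 1
        refine sum_bij' (fun l _ => k - l) (fun l _ => k - l) ?_ ?_ ?_ ?_ ?_ <;>
          simp only [mem_Icc] <;> first | omega | (intros; trivial)
    _ ≤ _ := by
        gcongr
        · exact sum_Icc_pow_le hf0 hf _
        · exact sum_Icc_pow_le hn0 hn _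

end

/-! ### Size and growth of the expected number of induced trees -/

section

section MeanTrees

variable {p : ℝ} {n k : ℕ}

lemma choose_two_sub_pred {k : ℕ} (hk : 1 ≤ k) : k.choose 2 - (k - 1) = (k - 1).choose 2 := by
  obtain ⟨j, rfl⟩ : ∃ j, k = j + 1 := ⟨k - 1, by omega⟩
  rw [Nat.choose_succ_succ' j 1, Nat.choose_one_right, Nat.add_sub_cancel,
    Nat.add_sub_cancel_left]

lemma meanTrees_mul_eq (hk : 1 ≤ k) :
    meanTrees n p k * (k ^ 2 * p) =
      n.choose k * (k * p) ^ k * (1 - p) ^ (k - 1).choose 2 := by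
  unfold meanTrees treeProb
  rw [choose_two_sub_pred hk]
  have h1 : (k : ℝ) ^ (k - 2) * k ^ 2 = (k : ℝ) ^ k := by
    rcases Nat.lt_or_ge k 2 with h | h
    · obtain rfl : k = 1 := by omega
      norm_num
    · rw [← pow_add]; congr 1; omega
  have h2 : p ^ (k - 1) * p = p ^ k := by rw [← pow_succ]; congr 1; omega
  rw [mul_pow, ← h1, ← h2]
  ring

lemma two_mul_choose_two_pred (k : ℕ) : 2 * (k - 1).choose 2 = (k - 1) * (k - 2) := by
  rw [Nat.choose_two_right, Nat.mul_div_cancel' (Nat.even_mul_pred_self _).two_dvd]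
  rfl

lemma meanTrees_mul_le (hp : 0 ≤ p) (hp1 : p ≤ 1) (hk : 1 ≤ k) :
    meanTrees n p k * (k ^ 2 * p) ≤
      (Real.exp 1 * (n * p)) ^ k * (1 - p) ^ (k - 1).choose 2 := by
  have hq : 0 ≤ 1 - p := by linarith
  have hk0 : (0 : ℝ) < k := by exact_mod_cast hk
  rw [meanTrees_mul_eq hk]
  calc _ ≤ (Real.exp 1 * n / k) ^ k * (k * p) ^ k * (1 - p) ^ (k - 1).choose 2 := by
        gcongr
        exact choose_le_exp_mul_div_pow n hk
    _ = _ := by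
        rw [← mul_pow]
        congr 2
        field_simp

lemma le_meanTrees_mul (hp : 0 ≤ p) (hp1 : p ≤ 1) (hk : 1 ≤ k) (hkn : k ≤ n) :
    ((n : ℝ) * p) ^ k * (1 - p) ^ (k - 1).choose 2 ≤ meanTrees n p k * (k ^ 2 * p) := by
  have hq : 0 ≤ 1 - p := by linarith
  have hk0 : (0 : ℝ) < k := by exact_mod_cast hk
  have hn0 : (0 : ℝ) < n := by exact_mod_cast (by omega : 0 < n)
  rw [meanTrees_mul_eq hk]
  have h1 := choose_div_choose_le (le_refl k) hkn
  rw [Nat.choose_self, Nat.cast_one] at h1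
  gcongr
  calc ((n : ℝ) * p) ^ k = 1 * (n * p) ^ k := by ring
    _ ≤ n.choose k * ((k : ℝ) / n) ^ k * (n * p) ^ k := by gcongr
    _ = _ := by
        rw [mul_assoc, ← mul_pow]
        congr 2
        field_simp

/-- C(n,k) ≤ (en/k)^k gives (enp)^k (1-p)^C(k-1,2) ≥ μ_k k²p. If the right side is at least 1,
square and take k-th roots; the exponent k - 3 comes from (k-1)(k-2) ≥ k(k-3). -/
lemma one_le_mul_pow_of_one_le_meanTrees (hp : 0 < p) (hp1 : p < 1) (hx : 1 ≤ (n : ℝ) * p)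
    (hk : 1 ≤ k) (hμ : 1 ≤ meanTrees n p k) :
    1 ≤ (Real.exp 1 * (n * p)) ^ 2 * (1 - p) ^ (k - 3) := by
  have hq : 0 < 1 - p := by linarith
  have he : 2 ≤ Real.exp 1 := by
    have := Real.add_one_le_exp (1 : ℝ); linarith
  have hy : 2 ≤ Real.exp 1 * (n * p) := by nlinarith
  rcases Nat.lt_or_ge 3 k with h3 | h3
  · have hk0 : (4 : ℝ) ≤ k := by exact_mod_cast h3
    rcases le_total 1 ((k : ℝ) ^ 2 * p) with hkp | hkp
    · have h1 : 1 ≤ (Real.exp 1 * (n * p)) ^ k * (1 - p) ^ (k - 1).choose 2 := by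
        refine le_trans ?_ (meanTrees_mul_le hp.le hp1.le hk)
        nlinarith
      have h2 : 1 ≤ ((Real.exp 1 * (n * p)) ^ 2 * (1 - p) ^ (k - 3)) ^ k := by
        calc 1 ≤ ((Real.exp 1 * (n * p)) ^ k * (1 - p) ^ (k - 1).choose 2) ^ 2 := one_le_pow₀ h1
          _ = ((Real.exp 1 * (n * p)) ^ 2) ^ k * (1 - p) ^ ((k - 1) * (k - 2)) := by
              rw [mul_pow, ← pow_mul (1 - p), mul_comm _ 2, two_mul_choose_two_pred, ← pow_mul,
                ← pow_mul, mul_comm k 2]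
          _ ≤ ((Real.exp 1 * (n * p)) ^ 2) ^ k * (1 - p) ^ ((k - 3) * k) := by
              gcongr ?_ * ?_
              refine pow_le_pow_of_le_one hq.le (by linarith) ?_
              obtain ⟨j, rfl⟩ : ∃ j, k = j + 4 := ⟨k - 4, by omega⟩
              rw [show j + 4 - 3 = j + 1 by omega, show j + 4 - 1 = j + 3 by omega,
                show j + 4 - 2 = j + 2 by omega]
              nlinarith
          _ = _ := by rw [pow_mul, ← mul_pow]
      by_contra hlt
      exact absurd h2 (not_le.2 (pow_lt_one₀ (by positivity) (not_le.1 hlt) (by omega)))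
    -- If k²p ≤ 1 then kp ≤ 1/4, so (1-p)^k stays away from 0 and the size of np suffices.
    · have h1 : 1 - (k : ℝ) * p ≤ (1 - p) ^ k := by
        have := one_add_mul_le_pow (a := -p) (by linarith) k
        calc 1 - (k : ℝ) * p = 1 + k * -p := by ring
          _ ≤ _ := this
          _ = _ := by ring
      have h2 : (1 - p) ^ k ≤ (1 - p) ^ (k - 3) := pow_le_pow_of_le_one hq.le (by linarith) (by omega)
      have h3 : (k : ℝ) * p ≤ 1 / 4 := by nlinarith
      nlinarith
  · rw [show k - 3 = 0 by omega, pow_zero]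
    nlinarith

/-- C(n,k) ≥ (n/k)^k gives (np)^k (1-p)^C(k-1,2) ≤ k²p ≤ e^(2k). Squaring and taking k-th roots
yields e⁴. -/
lemma mul_pow_le_of_meanTrees_le_one (hp : 0 < p) (hp1 : p < 1) (hk : 1 ≤ k) (hkn : k ≤ n)
    (hμ : meanTrees n p k ≤ 1) : (1 - p) ^ k * ((n : ℝ) * p) ^ 2 ≤ Real.exp 4 := by
  have hq : 0 < 1 - p := by linarith
  have hk0 : (0 : ℝ) < k := by exact_mod_cast hk
  have h1 : ((n : ℝ) * p) ^ k * (1 - p) ^ (k - 1).choose 2 ≤ Real.exp 2 ^ k := by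
    refine (le_meanTrees_mul hp.le hp1.le hk hkn).trans ?_
    have h2 : (k : ℝ) ≤ Real.exp 1 ^ k := by
      rw [← Real.exp_nat_mul, mul_one]
      have := Real.add_one_le_exp (k : ℝ)
      linarith
    calc meanTrees n p k * (k ^ 2 * p) ≤ 1 * ((Real.exp 1 ^ k) ^ 2 * 1) := by gcongr
      _ = _ := by
          rw [one_mul, mul_one, ← pow_mul, mul_comm, pow_mul, ← Real.exp_nat_mul]; norm_num
  refine le_of_pow_le_pow_left₀ (n := k) (by omega) (by positivity) ?_
  calc ((1 - p) ^ k * ((n : ℝ) * p) ^ 2) ^ k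
      = (((n : ℝ) * p) ^ k) ^ 2 * (1 - p) ^ (k * k) := by
        rw [mul_pow, ← pow_mul, ← pow_mul, ← pow_mul, mul_comm 2 k]; ring
    _ ≤ (((n : ℝ) * p) ^ k) ^ 2 * (1 - p) ^ ((k - 1) * (k - 2)) := by
        gcongr ?_ * ?_
        exact pow_le_pow_of_le_one hq.le (by linarith)
          (Nat.mul_le_mul (Nat.sub_le _ _) (Nat.sub_le _ _))
    _ = (((n : ℝ) * p) ^ k * (1 - p) ^ (k - 1).choose 2) ^ 2 := by
        rw [mul_pow _ _ 2, ← pow_mul (1 - p), mul_comm _ 2, two_mul_choose_two_pred]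
    _ ≤ (Real.exp 2 ^ k) ^ 2 := by gcongr
    _ = _ := by
        rw [← pow_mul, mul_comm, pow_mul, ← Real.exp_nat_mul]; norm_num

lemma meanTrees_succ_eq (hk : 2 ≤ k) (hkn : k ≤ n) :
    meanTrees n p (k + 1) =
      meanTrees n p k * (((n : ℝ) - k) * p * (1 - p) ^ (k - 1)) * (1 + 1 / (k : ℝ)) ^ (k - 2) := by
  unfold meanTrees treeProb
  have hk0 : (0 : ℝ) < k := by positivity
  rw [choose_two_sub_pred (by omega), choose_two_sub_pred (by omega : 1 ≤ k)]
  obtain ⟨j, rfl⟩ : ∃ j, k = j + 2 := ⟨k - 2, by omega⟩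
  rw [show j + 2 + 1 - 2 = j + 1 by omega, show j + 2 - 2 = j by omega,
    show j + 2 + 1 - 1 = j + 2 by omega, show j + 2 - 1 = j + 1 by omega]
  have h1 : (n.choose (j + 2 + 1) : ℝ) * (j + 2 + 1 : ℕ) = n.choose (j + 2) * ((n : ℝ) - (j + 2 : ℕ)) := by
    have := Nat.choose_succ_right_eq n (j + 2)
    rw [← Nat.cast_sub hkn]
    exact_mod_cast this
  have h2 : (j + 2).choose 2 = (j + 1).choose 2 + (j + 1) := by
    rw [Nat.choose_succ_succ' (j + 1) 1, Nat.choose_one_right]; ring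
  have h3 : (1 + 1 / ((j + 2 : ℕ) : ℝ)) ^ j = ((j + 2 + 1 : ℕ) : ℝ) ^ j / ((j + 2 : ℕ) : ℝ) ^ j := by
    rw [← div_pow]; congr 1; push_cast; field_simp
  rw [h2, h3, pow_add (1 - p)]
  have h4 : ((j + 2 : ℕ) : ℝ) ^ j ≠ 0 := by positivity
  field_simp
  rw [pow_succ (((j + 2 + 1 : ℕ) : ℝ))]
  linear_combination ((j + 2 + 1 : ℕ) : ℝ) ^ j * p ^ (j + 2) *
    ((1 - p) ^ (j + 1).choose 2 * (1 - p) ^ (j + 1)) * h1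

lemma meanTrees_succ_le (hp : 0 ≤ p) (hp1 : p ≤ 1) (hk : 2 ≤ k) :
    meanTrees n p (k + 1) ≤ Real.exp 1 * (n * p) * (1 - p) ^ (k - 1) * meanTrees n p k := by
  have hq : 0 ≤ 1 - p := by linarith
  have hμ := meanTrees_nonneg hp hp1 n k
  have hk0 : (0 : ℝ) < k := by positivity
  rcases Nat.lt_or_ge n k with h | h
  · have : meanTrees n p (k + 1) = 0 := by
      unfold meanTrees
      rw [Nat.choose_eq_zero_of_lt (by omega)]; simp
    rw [this]; positivity
  rw [meanTrees_succ_eq hk h]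
  have h1 : (1 + 1 / (k : ℝ)) ^ (k - 2) ≤ Real.exp 1 := by
    calc (1 + 1 / (k : ℝ)) ^ (k - 2) ≤ (1 + 1 / (k : ℝ)) ^ k := by
          refine pow_le_pow_right₀ ?_ (by omega)
          have : 0 ≤ 1 / (k : ℝ) := by positivity
          linarith
      _ ≤ Real.exp (1 / k) ^ k := by
          gcongr
          have := Real.add_one_le_exp (1 / (k : ℝ))
          linarith
      _ = Real.exp 1 := by rw [← Real.exp_nat_mul]; congr 1; field_simp
  have hkn : (0 : ℝ) ≤ (n : ℝ) - k := by
    have : (k : ℝ) ≤ n := by exact_mod_cast h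
    linarith
  calc _ ≤ meanTrees n p k * ((n : ℝ) * p * (1 - p) ^ (k - 1)) * Real.exp 1 := by
        gcongr
        linarith
    _ = _ := by ring

lemma le_meanTrees_succ (hp : 0 ≤ p) (hp1 : p ≤ 1) (hk : 2 ≤ k) (hkn : k ≤ n) :
    ((n : ℝ) - k) * p * (1 - p) ^ (k - 1) * meanTrees n p k ≤ meanTrees n p (k + 1) := by
  have hq : 0 ≤ 1 - p := by linarith
  have hμ := meanTrees_nonneg hp hp1 n k
  have hkn' : (0 : ℝ) ≤ (n : ℝ) - k := by
    have : (k : ℝ) ≤ n := by exact_mod_cast hkn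
    linarith
  rw [meanTrees_succ_eq hk hkn, mul_comm (meanTrees n p k)]
  refine le_mul_of_one_le_right (by positivity) (one_le_pow₀ ?_)
  have : 0 ≤ 1 / (k : ℝ) := by positivity
  linarith

lemma meanTrees_one : meanTrees n p 1 = n := by
  simp [meanTrees, treeProb]

lemma meanTrees_eq_zero_of_lt (h : n < k) : meanTrees n p k = 0 := by
  unfold meanTrees
  rw [Nat.choose_eq_zero_of_lt h]; simp

end MeanTrees

end

/-! ### The threshold and the two-point window -/

section

open scoped Classical in
/-- The largest `k` for which the expected number of induced trees on `k` vertices is at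
least `1`. -/
def threshold (n : ℕ) (p : ℝ) : ℕ := Nat.findGreatest (fun k => 1 ≤ meanTrees n p k) n

open scoped Classical in
/-- The smaller one of the two concentration values of the maximum size of an induced tree. -/
def lowThreshold (n : ℕ) (p : ℝ) : ℕ :=
  if (√(n * p))⁻¹ ≤ meanTrees n p (threshold n p + 1) then threshold n p else threshold n p - 1

section Threshold

variable {p : ℝ} {n k : ℕ}

lemma one_le_meanTrees_threshold (hn : 1 ≤ n) : 1 ≤ meanTrees n p (threshold n p) := by
  classical
  unfold threshold
  exact Nat.findGreatest_spec (P := fun k => 1 ≤ meanTrees n p k) (m := 1) hn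
    (by rw [meanTrees_one]; exact_mod_cast hn)

lemma one_le_threshold (hn : 1 ≤ n) : 1 ≤ threshold n p := by
  classical
  unfold threshold
  exact Nat.le_findGreatest hn (by rw [meanTrees_one]; exact_mod_cast hn)

/-- The search up to n misses nothing, as the mean vanishes for k > n. -/
lemma le_threshold (hk : 1 ≤ meanTrees n p k) : k ≤ threshold n p := by
  classical
  unfold threshold
  refine Nat.le_findGreatest ?_ hk
  by_contra h
  rw [meanTrees_eq_zero_of_lt (not_le.1 h)] at hk
  norm_num at hk

lemma meanTrees_succ_threshold_lt : meanTrees n p (threshold n p + 1) < 1 := by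
  by_contra h
  have := le_threshold (not_lt.1 h)
  omega

lemma isGreatest_threshold (p : I) (hn : 1 ≤ n) :
    IsGreatest {k : ℕ | 1 ≤ expectedCount n p k} (threshold n p) := by
  constructor
  · rw [Set.mem_ofPred_eq, expectedCount_eq_meanTrees n p (one_le_threshold hn)]
    exact one_le_meanTrees_threshold hn
  · intro k hk
    rw [Set.mem_ofPred_eq] at hk
    rcases Nat.eq_zero_or_pos k with rfl | h
    · exact Nat.zero_le _
    · rw [expectedCount_eq_meanTrees n p h] at hk
      exact le_threshold hk

lemma lowThreshold_eq_or (hn : 1 ≤ n) :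
    threshold n p = lowThreshold n p ∨ threshold n p = lowThreshold n p + 1 := by
  have := one_le_threshold (p := p) hn
  unfold lowThreshold
  split_ifs
  · left; rfl
  · right; omega

lemma sum_Icc_le_of_ratio {a : ℕ → ℝ} {ρ : ℝ} {m : ℕ} (N : ℕ) (ha : ∀ i, 0 ≤ a i)
    (hρ : ρ ≤ 1 / 2) (h : ∀ i, m ≤ i → a (i + 1) ≤ ρ * a i) :
    ∑ i ∈ Icc m N, a i ≤ 2 * a m := by
  rcases Nat.lt_or_ge N m with hN | hN
  · rw [Icc_eq_empty (by omega), sum_empty]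
    have := ha m
    positivity
  suffices ∑ i ∈ Icc m N, a i ≤ 2 * a m - a N by
    have := ha N
    linarith
  induction N, hN using Nat.le_induction with
  | base => rw [Icc_self, sum_singleton]; linarith
  | succ N hN ih =>
    rw [sum_Icc_succ_top (by omega)]
    have h1 := h N hN
    have h2 := ha N
    nlinarith

lemma hundred_le_log (hx : Real.exp 100 ≤ n * p) : 100 ≤ Real.log (n * p) := by
  rw [Real.le_log_iff_exp_le (lt_of_lt_of_le (Real.exp_pos _) hx)]
  exact hx

lemma fifty_mul_log_le (hx : Real.exp 100 ≤ n * p) : 50 * Real.log (n * p) ≤ n * p := by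
  have hx0 : 0 < (n : ℝ) * p := lt_of_lt_of_le (Real.exp_pos _) hx
  have hl := hundred_le_log hx
  have h := Real.quadratic_le_exp_of_nonneg (by linarith : 0 ≤ Real.log (n * p))
  rw [Real.exp_log hx0] at h
  nlinarith

lemma one_le_card (hx : Real.exp 100 ≤ n * p) : 1 ≤ n := by
  by_contra h
  obtain rfl : n = 0 := by omega
  have := Real.exp_pos 100
  simp at hx
  linarith

lemma one_le_mul_pow_threshold_sub (hp : 0 < p) (hp2 : p ≤ 1 / 2)
    (hx : Real.exp 100 ≤ n * p) :
    1 ≤ (Real.exp 1 * (n * p)) ^ 2 * (1 - p) ^ (threshold n p - 3) := by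
  have hn := one_le_card hx
  have := Real.add_one_le_exp (100 : ℝ)
  exact one_le_mul_pow_of_one_le_meanTrees hp (by linarith) (by linarith) (one_le_threshold hn)
    (one_le_meanTrees_threshold hn)

lemma one_le_mul_pow_threshold (hp : 0 < p) (hp2 : p ≤ 1 / 2)
    (hx : Real.exp 100 ≤ n * p) :
    1 ≤ (1 - p)⁻¹ ^ 3 * (Real.exp 1 * (n * p)) ^ 2 * (1 - p) ^ threshold n p := by
  have hq : 0 < 1 - p := by linarith
  have h := one_le_mul_pow_threshold_sub hp hp2 hx
  have h2 : (1 - p) ^ (threshold n p - 3) ≤ (1 - p)⁻¹ ^ 3 * (1 - p) ^ threshold n p := by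
    rw [inv_pow, inv_mul_eq_div, le_div_iff₀ (by positivity), ← pow_add]
    exact pow_le_pow_of_le_one hq.le (by linarith) (by omega)
  calc 1 ≤ _ := h
    _ ≤ (Real.exp 1 * (n * p)) ^ 2 * ((1 - p)⁻¹ ^ 3 * (1 - p) ^ threshold n p) := by gcongr
    _ = _ := by ring

lemma threshold_mul_le (hp : 0 < p) (hp2 : p ≤ 1 / 2)
    (hx : Real.exp 100 ≤ n * p) : threshold n p * p ≤ 4 + 2 * Real.log (n * p) := by
  have hq : 0 < 1 - p := by linarith
  have hx0 : 0 < (n : ℝ) * p := lt_of_lt_of_le (Real.exp_pos _) hx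
  have h := one_le_mul_pow_threshold_sub hp hp2 hx
  have h1 : (1 - p) ^ (threshold n p - 3) ≤ Real.exp (-((threshold n p - 3 : ℕ) * p)) := by
    calc (1 - p) ^ (threshold n p - 3) ≤ Real.exp (-p) ^ (threshold n p - 3) := by
          gcongr
          exact Real.one_sub_le_exp_neg p
      _ = _ := by rw [← Real.exp_nat_mul]; ring_nf
  have h2 : Real.exp ((threshold n p - 3 : ℕ) * p) ≤ Real.exp (2 + 2 * Real.log (n * p)) := by
    have h3 : Real.exp (2 + 2 * Real.log (n * p)) = (Real.exp 1 * (n * p)) ^ 2 := by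
      rw [Real.exp_add, mul_pow, ← Real.exp_nat_mul, mul_comm 2 (Real.log _), Real.exp_mul,
        Real.exp_log hx0]
      norm_num
    rw [h3]
    have h4 : 1 ≤ (Real.exp 1 * (n * p)) ^ 2 * Real.exp (-((threshold n p - 3 : ℕ) * p)) :=
      h.trans (by gcongr)
    rw [Real.exp_neg, ← div_eq_mul_inv, le_div_iff₀ (Real.exp_pos _), one_mul] at h4
    exact h4
  have h5 := Real.exp_le_exp.1 h2
  have h6 : (threshold n p : ℝ) ≤ (threshold n p - 3 : ℕ) + 3 := by
    exact_mod_cast (by omega : threshold n p ≤ threshold n p - 3 + 3)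
  nlinarith

/-- Keeps K + 1 inside the vertex set and n - k at least n/2. It holds since Kp is at most 4 + 2
log(np), far below np. -/
lemma two_mul_succ_threshold_le (hp : 0 < p) (hp2 : p ≤ 1 / 2)
    (hx : Real.exp 100 ≤ n * p) : 2 * (threshold n p + 1) ≤ n := by
  have h1 := threshold_mul_le hp hp2 hx
  have h2 := fifty_mul_log_le hx
  have h3 := hundred_le_log hx
  have : (2 * ((threshold n p : ℝ) + 1)) * p ≤ n * p := by nlinarith
  have := le_of_mul_le_mul_right this hp
  exact_mod_cast this

lemma pow_succ_threshold_mul_le (hp : 0 < p) (hp2 : p ≤ 1 / 2)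
    (hx : Real.exp 100 ≤ n * p) :
    (1 - p) ^ (threshold n p + 1) * ((n : ℝ) * p) ^ 2 ≤ Real.exp 4 := by
  have := two_mul_succ_threshold_le hp hp2 hx
  exact mul_pow_le_of_meanTrees_le_one hp (by linarith) (by omega) (by omega)
    meanTrees_succ_threshold_lt.le

/-- The logarithm of (1-p)^(K+1) (np)² ≤ e⁴, with -log(1-p) ≤ p/(1-p). -/
lemma le_succ_threshold_mul (hp : 0 < p) (hp2 : p ≤ 1 / 2)
    (hx : Real.exp 100 ≤ n * p) :
    (1 - p) * (2 * Real.log (n * p) - 4) ≤ (threshold n p + 1) * p := by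
  have hq : 0 < 1 - p := by linarith
  have hx0 : 0 < (n : ℝ) * p := lt_of_lt_of_le (Real.exp_pos _) hx
  have h := pow_succ_threshold_mul_le hp hp2 hx
  have h1 : (1 - p)⁻¹ ≤ Real.exp (p / (1 - p)) := by
    have := Real.add_one_le_exp (p / (1 - p))
    have h2 : (1 - p)⁻¹ = p / (1 - p) + 1 := by field_simp; ring
    rw [h2]; exact this
  have h2 : ((n : ℝ) * p) ^ 2 ≤ Real.exp 4 * Real.exp ((threshold n p + 1) * (p / (1 - p))) := by
    calc ((n : ℝ) * p) ^ 2 = ((1 - p) ^ (threshold n p + 1) * ((n : ℝ) * p) ^ 2) *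
          (1 - p)⁻¹ ^ (threshold n p + 1) := by
          rw [mul_right_comm, ← mul_pow, mul_inv_cancel₀ hq.ne', one_pow, one_mul]
      _ ≤ Real.exp 4 * Real.exp (p / (1 - p)) ^ (threshold n p + 1) := by gcongr
      _ = _ := by rw [← Real.exp_nat_mul]; push_cast; rfl
  have h3 := Real.log_le_log (by positivity) h2
  rw [← Real.exp_add, Real.log_exp, Real.log_pow] at h3
  push_cast at h3
  have h4 : (1 - p) * ((threshold n p + 1) * (p / (1 - p))) = (threshold n p + 1) * p := by
    field_simp
  nlinarith

lemma log_sub_le_threshold_mul (hp : 0 < p) (hp2 : p ≤ 1 / 2)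
    (hx : Real.exp 100 ≤ n * p) : Real.log (n * p) - 3 ≤ threshold n p * p := by
  have h := le_succ_threshold_mul hp hp2 hx
  have h3 := hundred_le_log hx
  nlinarith

lemma hundred_le_threshold (hp : 0 < p) (hp2 : p ≤ 1 / 2)
    (hx : Real.exp 100 ≤ n * p) : 100 ≤ threshold n p := by
  have h := log_sub_le_threshold_mul hp hp2 hx
  have h3 := hundred_le_log hx
  have : (100 : ℝ) ≤ threshold n p := by nlinarith
  exact_mod_cast this

lemma pow_threshold_le (hp : 0 < p) (hp2 : p ≤ 1 / 2)
    (hx : Real.exp 100 ≤ n * p) : (1 - p) ^ threshold n p ≤ 2 * Real.exp 4 / ((n : ℝ) * p) ^ 2 := by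
  have hq : 0 < 1 - p := by linarith
  have hx0 : 0 < (n : ℝ) * p := lt_of_lt_of_le (Real.exp_pos _) hx
  have h := pow_succ_threshold_mul_le hp hp2 hx
  rw [le_div_iff₀ (by positivity)]
  rw [pow_succ] at h
  have h1 : 0 ≤ (1 - p) ^ threshold n p * ((n : ℝ) * p) ^ 2 := by positivity
  nlinarith

lemma meanTrees_succ_le_of_threshold_lt (hp : 0 < p) (hp2 : p ≤ 1 / 2)
    (hx : Real.exp 100 ≤ n * p) (hk : threshold n p < k) :
    meanTrees n p (k + 1) ≤ 2 * Real.exp 5 / (n * p) * meanTrees n p k := by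
  have hq : 0 < 1 - p := by linarith
  have hx0 : 0 < (n : ℝ) * p := lt_of_lt_of_le (Real.exp_pos _) hx
  have hK := hundred_le_threshold hp hp2 hx
  have hμ := meanTrees_nonneg hp.le (by linarith : p ≤ 1) n k
  refine (meanTrees_succ_le hp.le (by linarith) (by omega)).trans ?_
  gcongr
  calc Real.exp 1 * (n * p) * (1 - p) ^ (k - 1)
      ≤ Real.exp 1 * (n * p) * (2 * Real.exp 4 / ((n : ℝ) * p) ^ 2) := by
        gcongr
        refine le_trans ?_ (pow_threshold_le hp hp2 hx)
        exact pow_le_pow_of_le_one hq.le (by linarith) (by omega)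
    _ = _ := by
        rw [show (5 : ℝ) = 1 + 4 by norm_num, Real.exp_add]; field_simp

lemma ratio_le_half (hx : Real.exp 100 ≤ n * p) : 2 * Real.exp 5 / (n * p) ≤ 1 / 2 := by
  have hx0 : 0 < (n : ℝ) * p := lt_of_lt_of_le (Real.exp_pos _) hx
  rw [div_le_iff₀ hx0]
  have h1 : Real.exp 100 = Real.exp 95 * Real.exp 5 := by rw [← Real.exp_add]; norm_num
  have h2 := Real.add_one_le_exp (95 : ℝ)
  have h3 := Real.exp_pos 5
  nlinarith

lemma sum_meanTrees_succ_threshold_le (hp : 0 < p) (hp2 : p ≤ 1 / 2)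
    (hx : Real.exp 100 ≤ n * p) (N : ℕ) :
    ∑ k ∈ Icc (threshold n p + 1) N, meanTrees n p k ≤
      2 * meanTrees n p (threshold n p + 1) :=
  sum_Icc_le_of_ratio N (meanTrees_nonneg hp.le (by linarith) n) (ratio_le_half hx)
    fun _ hi => meanTrees_succ_le_of_threshold_lt hp hp2 hx (by omega)

lemma sum_meanTrees_threshold_add_two_le (hp : 0 < p) (hp2 : p ≤ 1 / 2)
    (hx : Real.exp 100 ≤ n * p) (N : ℕ) :
    ∑ k ∈ Icc (threshold n p + 2) N, meanTrees n p k ≤ 4 * Real.exp 5 / (n * p) := by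
  have hx0 : 0 < (n : ℝ) * p := lt_of_lt_of_le (Real.exp_pos _) hx
  have h1 := sum_Icc_le_of_ratio (m := threshold n p + 2) N
    (meanTrees_nonneg hp.le (by linarith) n) (ratio_le_half hx)
    fun i hi => meanTrees_succ_le_of_threshold_lt (k := i) hp hp2 hx (by omega)
  have h2 := meanTrees_succ_le_of_threshold_lt hp hp2 hx (Nat.lt_succ_self (threshold n p))
  have h3 := (meanTrees_succ_threshold_lt (p := p) (n := n)).le
  have h4 : 2 * Real.exp 5 / (n * p) * meanTrees n p (threshold n p + 1) ≤
      2 * Real.exp 5 / (n * p) := mul_le_of_le_one_right (by positivity) h3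
  calc _ ≤ _ := h1
    _ ≤ 2 * (2 * Real.exp 5 / (n * p)) := by
        have := h2.trans h4
        linarith
    _ = _ := by ring

/-- If k₀ = K the sum starts at K + 2, where the mean is already O(1/(np)). If k₀ = K - 1 it starts
at K + 1, whose mean is below (np)^(-1/2) by the choice of k₀. -/
lemma sum_meanTrees_lowThreshold_le (hp : 0 < p) (hp2 : p ≤ 1 / 2)
    (hx : Real.exp 100 ≤ n * p) (N : ℕ) :
    ∑ k ∈ Icc (lowThreshold n p + 2) N, meanTrees n p k ≤
      4 * Real.exp 5 / (n * p) + 2 * (√(n * p))⁻¹ := by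
  have hx0 : 0 < (n : ℝ) * p := lt_of_lt_of_le (Real.exp_pos _) hx
  have hK := hundred_le_threshold hp hp2 hx
  have e1 : 0 ≤ 4 * Real.exp 5 / (n * p) := by positivity
  have e2 : 0 ≤ 2 * (√((n : ℝ) * p))⁻¹ := by positivity
  unfold lowThreshold
  split_ifs with h
  · have := sum_meanTrees_threshold_add_two_le hp hp2 hx N
    linarith
  · rw [show threshold n p - 1 + 2 = threshold n p + 1 by omega]
    have := sum_meanTrees_succ_threshold_le hp hp2 hx N
    linarith [not_le.1 h]

/-- One step down multiplies the mean by at least np/(8e⁵). It starts from a mean of at least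
(np)^(-1/2) at K + 1, or of at least 1 at K; the first case gives √(np) and the second even more. -/
lemma sqrt_le_meanTrees_lowThreshold (hp : 0 < p) (hp2 : p ≤ 1 / 2)
    (hx : Real.exp 100 ≤ n * p) :
    √(n * p) / (8 * Real.exp 5) ≤ meanTrees n p (lowThreshold n p) := by
  have hq : 0 < 1 - p := by linarith
  have hx0 : 0 < (n : ℝ) * p := lt_of_lt_of_le (Real.exp_pos _) hx
  have hK := hundred_le_threshold hp hp2 hx
  have hx1 : 1 ≤ (n : ℝ) * p := by linarith [Real.add_one_le_exp (100 : ℝ)]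
  have hss : √((n : ℝ) * p) * √(n * p) = n * p := Real.mul_self_sqrt hx0.le
  have hs1 : 1 ≤ √((n : ℝ) * p) := Real.one_le_sqrt.2 hx1
  have key : ∀ k, threshold n p ≤ k + 1 → 2 ≤ k →
      meanTrees n p (k + 1) * (n * p) / (8 * Real.exp 5) ≤ meanTrees n p k := by
    intro k hk hk2
    have hμ := meanTrees_nonneg hp.le (by linarith : p ≤ 1) n k
    have h1 := meanTrees_succ_le (n := n) (k := k) hp.le (by linarith) hk2
    have h2 : (1 - p) ^ (k - 1) ≤ 8 * Real.exp 4 / ((n : ℝ) * p) ^ 2 := by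
      have h3 := pow_threshold_le hp hp2 hx
      have h4 : (1 - p) ^ (k - 1) * (1 / 4) ≤ (1 - p) ^ threshold n p := by
        calc (1 - p) ^ (k - 1) * (1 / 4) ≤ (1 - p) ^ (k - 1) * (1 - p) ^ 2 := by
              gcongr; nlinarith
          _ = (1 - p) ^ (k - 1 + 2) := by rw [pow_add]
          _ ≤ _ := pow_le_pow_of_le_one hq.le (by linarith) (by omega)
      calc (1 - p) ^ (k - 1) ≤ 4 * (2 * Real.exp 4 / ((n : ℝ) * p) ^ 2) := by linarith
        _ = _ := by ring
    rw [div_le_iff₀ (by positivity), ← le_div_iff₀ hx0]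
    calc _ ≤ _ := h1
      _ ≤ Real.exp 1 * (n * p) * (8 * Real.exp 4 / ((n : ℝ) * p) ^ 2) * meanTrees n p k := by gcongr
      _ = _ := by
          rw [show (5 : ℝ) = 1 + 4 by norm_num, Real.exp_add]; field_simp
  unfold lowThreshold
  split_ifs with h
  · refine le_trans ?_ (key _ (by omega) (by omega))
    gcongr
    calc √((n : ℝ) * p) = (√((n : ℝ) * p))⁻¹ * (n * p) := by
          rw [inv_mul_eq_div, eq_div_iff (by positivity)]; exact hss
      _ ≤ _ := by gcongr
  · refine le_trans ?_ (key _ (by omega) (by omega))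
    rw [show threshold n p - 1 + 1 = threshold n p by omega]
    gcongr
    have h1 := one_le_meanTrees_threshold (p := p) (one_le_card hx)
    nlinarith

lemma threshold_le_lowThreshold_add_one
    (hx : Real.exp 100 ≤ n * p) : threshold n p ≤ lowThreshold n p + 1 := by
  rcases lowThreshold_eq_or (p := p) (one_le_card hx) with h | h <;> omega

lemma lowThreshold_le_threshold
    (hx : Real.exp 100 ≤ n * p) : lowThreshold n p ≤ threshold n p := by
  rcases lowThreshold_eq_or (p := p) (one_le_card hx) with h | h <;> omega

lemma nearThreshold_lowThreshold (hp : 0 < p) (hp2 : p ≤ 1 / 2)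
    (hx : Real.exp 100 ≤ n * p) (hx' : 6144 ^ 2 + 10 ≤ Real.log (n * p)) :
    NearThreshold (8 * Real.exp 4) n p (lowThreshold n p) := by
  have hq : 0 < 1 - p := by linarith
  have hx0 : 0 < (n : ℝ) * p := lt_of_lt_of_le (Real.exp_pos _) hx
  have hx1 : 1 ≤ (n : ℝ) * p := by linarith [Real.add_one_le_exp (100 : ℝ)]
  have h1 := threshold_le_lowThreshold_add_one hx
  have h2 := lowThreshold_le_threshold hx
  have h3 := two_mul_succ_threshold_le hp hp2 hx
  have h4 := log_sub_le_threshold_mul hp hp2 hx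
  have h1' : (threshold n p : ℝ) ≤ lowThreshold n p + 1 := by exact_mod_cast h1
  have he : 1 ≤ Real.exp 4 := Real.one_le_exp (by norm_num)
  refine ⟨hp, hp2, by omega, by linarith, hx1, by nlinarith, ?_, ?_⟩
  · have h5 := pow_succ_threshold_mul_le hp hp2 hx
    have h6 : (1 - p) ^ lowThreshold n p * (1 / 4) ≤ (1 - p) ^ (threshold n p + 1) := by
      calc (1 - p) ^ lowThreshold n p * (1 / 4) ≤ (1 - p) ^ lowThreshold n p * (1 - p) ^ 2 := by
            gcongr; nlinarith
        _ = (1 - p) ^ (lowThreshold n p + 2) := by rw [pow_add]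
        _ ≤ _ := pow_le_pow_of_le_one hq.le (by linarith) (by omega)
    have h7 : (1 - p) ^ lowThreshold n p * ((n : ℝ) * p) ^ 2 ≤
        4 * ((1 - p) ^ (threshold n p + 1) * ((n : ℝ) * p) ^ 2) := by
      have : 0 ≤ ((n : ℝ) * p) ^ 2 := by positivity
      nlinarith
    linarith
  · have h5 := one_le_mul_pow_threshold hp hp2 hx
    have h6 : (1 - p)⁻¹ ≤ 2 := by rw [inv_le_comm₀ hq (by norm_num)]; linarith
    calc 1 ≤ _ := h5
      _ ≤ 2 ^ 3 * (Real.exp 1 * (n * p)) ^ 2 * (1 - p) ^ lowThreshold n p := by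
          have := pow_le_pow_of_le_one hq.le (by linarith) h2
          gcongr
      _ = 8 * Real.exp 2 * ((n : ℝ) * p) ^ 2 * (1 - p) ^ lowThreshold n p := by
          rw [mul_pow, ← Real.exp_nat_mul, Nat.cast_ofNat, mul_one]; ring
      _ ≤ _ := by gcongr; norm_num

/-- A step down multiplies the mean by at most 128np: (1-p)⁻³ ≤ 8 and e² ≤ 8 bound (1-p)^(-K) by
64(np)², and n - k ≥ n/2 costs a factor 2. -/
lemma meanTrees_threshold_sub_le (hp : 0 < p) (hp2 : p ≤ 1 / 2)
    (hx : Real.exp 100 ≤ n * p) {i : ℕ} (hi : i + 1 ≤ threshold n p) :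
    meanTrees n p (threshold n p + 1 - i) ≤ (128 * (n * p)) ^ i := by
  have hq : 0 < 1 - p := by linarith
  have hx0 : 0 < (n : ℝ) * p := lt_of_lt_of_le (Real.exp_pos _) hx
  have hn := two_mul_succ_threshold_le hp hp2 hx
  have h5 := one_le_mul_pow_threshold hp hp2 hx
  have h6 : (1 - p)⁻¹ ≤ 2 := by rw [inv_le_comm₀ hq (by norm_num)]; linarith
  have he : Real.exp 1 ^ 2 ≤ 8 := by
    have := Real.exp_one_lt_d9
    have := Real.exp_pos 1
    nlinarith
  have h7 : 1 ≤ 64 * ((n : ℝ) * p) ^ 2 * (1 - p) ^ threshold n p := by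
    calc 1 ≤ _ := h5
      _ ≤ 2 ^ 3 * (Real.exp 1 * (n * p)) ^ 2 * (1 - p) ^ threshold n p := by gcongr
      _ = 8 * Real.exp 1 ^ 2 * ((n : ℝ) * p) ^ 2 * (1 - p) ^ threshold n p := by ring
      _ ≤ 8 * 8 * ((n : ℝ) * p) ^ 2 * (1 - p) ^ threshold n p := by gcongr
      _ = _ := by ring
  induction i with
  | zero => simpa using meanTrees_succ_threshold_lt.le
  | succ i ih =>
    have ih := ih (by omega)
    set k := threshold n p + 1 - (i + 1) with hk
    have hk1 : threshold n p + 1 - i = k + 1 := by omega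
    rw [hk1] at ih
    have hμ := meanTrees_nonneg hp.le (by linarith : p ≤ 1) n k
    have h1 := le_meanTrees_succ (n := n) (k := k) hp.le (by linarith) (by omega) (by omega)
    have h2 : (n : ℝ) / 2 ≤ (n : ℝ) - k := by
      have : 2 * (k : ℝ) ≤ n := by exact_mod_cast (by omega : 2 * k ≤ n)
      linarith
    have h3 : (1 - p) ^ threshold n p ≤ (1 - p) ^ (k - 1) :=
      pow_le_pow_of_le_one hq.le (by linarith) (by omega)
    have h4 : (n : ℝ) / 2 * p * (1 - p) ^ threshold n p * meanTrees n p k ≤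
        meanTrees n p (k + 1) := by
      refine le_trans ?_ h1
      have h0 : (0 : ℝ) ≤ (n : ℝ) - k := le_trans (by positivity) h2
      gcongr
    calc meanTrees n p k = 1 * meanTrees n p k := by ring
      _ ≤ 64 * ((n : ℝ) * p) ^ 2 * (1 - p) ^ threshold n p * meanTrees n p k := by gcongr
      _ = 128 * (n * p) * ((n : ℝ) / 2 * p * (1 - p) ^ threshold n p * meanTrees n p k) := by ring
      _ ≤ 128 * (n * p) * (128 * (n * p)) ^ i := by gcongr; exact h4.trans ih
      _ = _ := by ring

end Threshold

end

/-! ### Probability bounds for fixed n -/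

section

section Bounds

variable {p : ℝ} {n k : ℕ}

/-- A single term of the binomial expansion of 1. It makes the base in `meanMaximalTrees`
nonnegative. -/
lemma mul_pow_pred_le_one (hp : 0 ≤ p) (hp1 : p ≤ 1) (hk : 1 ≤ k) :
    k * (p * (1 - p) ^ (k - 1)) ≤ 1 := by
  have hq : 0 ≤ 1 - p := by linarith
  have h := add_pow (1 - p) p k
  rw [sub_add_cancel, one_pow] at h
  refine le_trans (le_of_eq ?_) ((single_le_sum
    (f := fun m => (1 - p) ^ m * p ^ (k - m) * k.choose m) (fun m _ => by positivity)
    (mem_range.2 (by omega : k - 1 < k + 1))).trans h.ge)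
  have h1 : k - (k - 1) = 1 := by omega
  have h2 : k.choose (k - 1) = k := by
    rw [← Nat.choose_symm_of_eq_add (show k = 1 + (k - 1) by omega), Nat.choose_one_right]
  simp only [h1, h2]
  ring

lemma meanMaximalTrees_le_exp (hp : 0 ≤ p) (hp1 : p ≤ 1) (hk : 1 ≤ k) :
    meanMaximalTrees n p k ≤
      meanTrees n p k * Real.exp (-((n - k : ℕ) * (k * (p * (1 - p) ^ (k - 1))))) := by
  unfold meanMaximalTrees
  have h := mul_pow_pred_le_one hp hp1 hk
  refine mul_le_mul_of_nonneg_left ?_ (meanTrees_nonneg hp hp1 n k)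
  calc _ ≤ Real.exp (-(k * (p * (1 - p) ^ (k - 1)))) ^ (n - k) :=
        pow_le_pow_left₀ (by linarith) (Real.one_sub_le_exp_neg _) _
    _ = _ := by rw [← Real.exp_nat_mul]; ring_nf

lemma meanMaximalTrees_le (hp : 0 ≤ p) (hp1 : p ≤ 1) (hk : 1 ≤ k) :
    meanMaximalTrees n p k ≤ meanTrees n p k := by
  refine (meanMaximalTrees_le_exp hp hp1 hk).trans
    (mul_le_of_le_one_right (meanTrees_nonneg hp hp1 n k) ?_)
  rw [Real.exp_le_one_iff]
  have hq : 0 ≤ 1 - p := by linarith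
  have : 0 ≤ ((n - k : ℕ) : ℝ) * (k * (p * (1 - p) ^ (k - 1))) := by positivity
  linarith

/-- Bound for the probability that some vertex outside a given set of `k` vertices has at most
three neighbours in it. -/
def fewNbrsError (D : ℝ) (n : ℕ) (p : ℝ) (k : ℕ) : ℝ :=
  32 * D * ((k * p) ^ 3 / (n * p ^ 2))

/-- For j ≤ 3, C(k,j)p^j ≤ (kp)³ and (1-p)^(k-j) ≤ 8(1-p)^k. Four such terms give the constant 32.
-/
lemma NearThreshold.sum_few_nbrs_le {D : ℝ} (h : NearThreshold D n p k) :
    n * ∑ j ∈ range 4, k.choose j * (p ^ j * (1 - p) ^ (k - j)) ≤ fewNbrsError D n p k := by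
  have hp := h.pos
  have hp2 := h.le_half
  have hD := h.one_le_const
  have hx := h.one_le_mul
  have hq : 0 < 1 - p := by linarith
  have hkp : 1 ≤ (k : ℝ) * p := le_trans (by norm_num) h.le_mul
  have hx0 : 0 < (n : ℝ) * p := by linarith
  have hn0 : (0 : ℝ) < n := pos_of_mul_pos_left hx0 hp.le
  have hk4 : 4 ≤ k := by
    have : (4 : ℝ) ≤ k := by nlinarith [h.le_mul]
    exact_mod_cast this
  have hterm : ∀ j ∈ range 4, (k.choose j : ℝ) * (p ^ j * (1 - p) ^ (k - j)) ≤
      (k * p) ^ 3 * (8 * (D / ((n : ℝ) * p) ^ 2)) := by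
    intro j hj
    have hj3 : j ≤ 3 := by have := mem_range.1 hj; omega
    have h1 : (k.choose j : ℝ) * p ^ j ≤ (k * p) ^ 3 := by
      calc (k.choose j : ℝ) * p ^ j ≤ (k : ℝ) ^ j * p ^ j := by
            gcongr
            exact_mod_cast Nat.choose_le_pow k j
        _ = (k * p) ^ j := by rw [mul_pow]
        _ ≤ _ := pow_le_pow_right₀ hkp hj3
    have h2 : (1 - p) ^ (k - j) ≤ 8 * (D / ((n : ℝ) * p) ^ 2) := by
      have h3 : (1 - p) ^ (k - j) * (1 / 8) ≤ (1 - p) ^ k := by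
        calc (1 - p) ^ (k - j) * (1 / 8) ≤ (1 - p) ^ (k - j) * (1 - p) ^ 3 := by
              gcongr
              calc (1 / 8 : ℝ) = (1 / 2) ^ 3 := by norm_num
                _ ≤ _ := by gcongr; linarith
          _ = (1 - p) ^ (k - j + 3) := by rw [pow_add]
          _ ≤ _ := pow_le_pow_of_le_one hq.le (by linarith) (by omega)
      have h4 : (1 - p) ^ k ≤ D / ((n : ℝ) * p) ^ 2 := by
        rw [le_div_iff₀ (by positivity)]; exact h.pow_mul_le
      linarith
    calc (k.choose j : ℝ) * (p ^ j * (1 - p) ^ (k - j)) =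
          (k.choose j : ℝ) * p ^ j * (1 - p) ^ (k - j) := by ring
      _ ≤ _ := by gcongr
  calc n * ∑ j ∈ range 4, (k.choose j : ℝ) * (p ^ j * (1 - p) ^ (k - j))
      ≤ n * ∑ j ∈ range 4, (k * p) ^ 3 * (8 * (D / ((n : ℝ) * p) ^ 2)) := by
        exact mul_le_mul_of_nonneg_left (sum_le_sum hterm) hn0.le
    _ = _ := by
        rw [sum_const, card_range, fewNbrsError, nsmul_eq_mul]
        push_cast
        field_simp
        norm_num

/-- In units of the squared mean, the diagonal and the large overlaps each cost at most the inverse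
mean, and the small overlaps twice `farError`. -/
lemma NearThreshold.le_pr {D : ℝ} (h : NearThreshold D n p k)
    (hf : farError D n p k ≤ 1 / 2) (hn : nearError D n p k ≤ 1 / 2)
    (hδ : fewNbrsError D n p k ≤ 1) (hμ : 0 < meanTrees n p k) :
    (1 - fewNbrsError D n p k) ^ 2 /
        (1 + (2 * farError D n p k + 2 * (meanTrees n p k)⁻¹)) ≤
      pr p (fun G : SimpleGraph (Fin n) => k ≤ maxInducedTree G) := by
  have hp := h.pos
  have hp2 := h.le_half
  have hk : 1 ≤ k := by
    have : (1 : ℝ) ≤ k := by nlinarith [h.le_mul]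
    exact_mod_cast this
  have key := le_pr_le_maxInducedTree (V := Fin n) (p := p) hp.le (by linarith) hk
    (b := forestBound) (fun S c hc _ => blockSum_le_forestBound S c hc)
    (δ := fewNbrsError D n p k) (η := 2 * farError D n p k + 2 * (meanTrees n p k)⁻¹)
  rw [Fintype.card_fin] at key
  refine key hμ h.sum_few_nbrs_le hδ ?_
  have h1 := sum_overlap_le h hf hn
  have h2 : (∑ l ∈ Icc 1 (k - 1), (n.choose k : ℝ) * (k.choose l * (n - k).choose (k - l)) *
        overlapTerm p forestBound k l) / meanTrees n p k ^ 2 ≤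
      2 * farError D n p k + (meanTrees n p k)⁻¹ := by
    rw [div_le_iff₀ (by positivity)]
    refine h1.trans ?_
    rw [add_mul]
    have h3 : (meanTrees n p k)⁻¹ * meanTrees n p k ^ 2 = meanTrees n p k := by
      field_simp
    rw [h3]
    nlinarith
  rw [one_div]
  linarith

lemma pr_lowThreshold_add_two_le (hp : 0 < p) (hp2 : p ≤ 1 / 2) (hx : Real.exp 100 ≤ n * p) :
    pr p (fun G : SimpleGraph (Fin n) => lowThreshold n p + 2 ≤ maxInducedTree G) ≤
      4 * Real.exp 5 / (n * p) + 2 * (√(n * p))⁻¹ := by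
  have h := pr_le_maxInducedTree_le (V := Fin n) (p := p) hp.le (by linarith)
    (m := lowThreshold n p + 2) (by omega)
  rw [Fintype.card_fin] at h
  refine h.trans ((sum_le_sum fun k hk => meanMaximalTrees_le hp.le (by linarith) ?_).trans
    (sum_meanTrees_lowThreshold_le hp hp2 hx n))
  have := mem_Icc.1 hk
  omega

lemma le_pr_lowThreshold (hp : 0 ≤ p) (hp1 : p ≤ 1) :
    pr p (fun G : SimpleGraph (Fin n) => k ≤ maxInducedTree G) -
        pr p (fun G : SimpleGraph (Fin n) => k + 2 ≤ maxInducedTree G) ≤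
      pr p (fun G : SimpleGraph (Fin n) => maxInducedTree G = k ∨ maxInducedTree G = k + 1) := by
  have h1 := pr_and_add_pr_and_not (p := p) (fun G : SimpleGraph (Fin n) => k ≤ maxInducedTree G)
    (fun G => k + 2 ≤ maxInducedTree G)
  have h2 : pr p (fun G : SimpleGraph (Fin n) => k ≤ maxInducedTree G ∧ k + 2 ≤ maxInducedTree G) ≤
      pr p (fun G : SimpleGraph (Fin n) => k + 2 ≤ maxInducedTree G) :=
    pr_mono hp hp1 fun G hG => hG.2
  have h3 : pr p (fun G : SimpleGraph (Fin n) => k ≤ maxInducedTree G ∧ ¬ k + 2 ≤ maxInducedTree G) ≤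
      pr p (fun G : SimpleGraph (Fin n) => maxInducedTree G = k ∨ maxInducedTree G = k + 1) :=
    pr_mono hp hp1 fun G hG => by omega
  linarith

/-- Below the threshold by at most `1 / (4np²)`, the induced trees on so many vertices can whp be
extended by a vertex with exactly one neighbour in them. -/
lemma pr_le_of_sparse (hp : 0 < p) (hp2 : p ≤ 1 / 1000) (hL : 1000 ≤ Real.log (n * p)) {s : ℝ}
    (hs : s = 1 / (4 * n * p ^ 2)) (hs1 : 80 ≤ s) {m : ℕ} (hm : (threshold n p : ℝ) - 1 - s ≤ m) :
    pr p (fun G : SimpleGraph (Fin n) => m ≤ maxInducedTree G) ≤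
      Real.exp (-s) + 4 * Real.exp 5 / (n * p) := by
  have hp2' : p ≤ 1 / 2 := by linarith
  have hx0 : 0 < (n : ℝ) * p := by
    by_contra h
    have h1 : Real.log (n * p) ≤ 0 := by
      have : (n : ℝ) * p = 0 := le_antisymm (not_lt.1 h) (by positivity)
      rw [this]; simp
    linarith
  have hx : Real.exp 100 ≤ n * p := by
    rw [← Real.le_log_iff_exp_le hx0]; linarith
  have hn0 : (0 : ℝ) < n := pos_of_mul_pos_left hx0 hp.le
  have hq : 0 < 1 - p := by linarith
  set L := Real.log (n * p) with hLdef
  set K := threshold n p with hK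
  have hxL : 500 * L ≤ n * p := by
    have h := Real.quadratic_le_exp_of_nonneg (by linarith : 0 ≤ L)
    rw [Real.exp_log hx0] at h
    nlinarith
  have hK1 := threshold_mul_le hp hp2' hx
  have hK2 := le_succ_threshold_mul hp hp2' hx
  have hK3 := one_le_mul_pow_threshold hp hp2' hx
  rw [← hK, ← hLdef] at hK1 hK2
  rw [← hK] at hK3
  have hsp : s * p ≤ 1 / 1000 := by
    have h1 : s * p = 1 / (4 * (n * p)) := by rw [hs]; field_simp
    rw [h1, div_le_div_iff₀ (by positivity) (by norm_num)]
    nlinarith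
  have hmp : 199 / 100 * L ≤ m * p := by
    have h1 : ((K : ℝ) - 1 - s) * p ≤ m * p := by gcongr
    have h2 : 999 / 1000 * (2 * L - 4) ≤ (1 - p) * (2 * L - 4) := by
      refine mul_le_mul_of_nonneg_right ?_ ?_ <;> linarith
    nlinarith
  have hm2 : 2 ≤ m := by
    have : (2 : ℝ) ≤ m := by nlinarith
    exact_mod_cast this
  have hnK : 995 / 1000 * (n : ℝ) ≤ (n : ℝ) - (K + 1) := by
    have : ((K : ℝ) + 1) * p ≤ (5 / 1000 * n) * p := by nlinarith
    have := le_of_mul_le_mul_right this hp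
    linarith
  -- (1-p)^K ≥ (1-p)³/(enp)², with 7.3891 an upper bound for e². The constant matters: it decides
  -- the comparison below.
  have hqK : 997 / 1000 / (7.3891 * (n * p) ^ 2) ≤ (1 - p) ^ K := by
    rw [div_le_iff₀ (by positivity)]
    have h1 : (1 - p) ^ 3 ≤ (Real.exp 1 * (n * p)) ^ 2 * (1 - p) ^ K := by
      calc (1 - p) ^ 3 = (1 - p) ^ 3 * 1 := by ring
        _ ≤ (1 - p) ^ 3 * ((1 - p)⁻¹ ^ 3 * (Real.exp 1 * (n * p)) ^ 2 * (1 - p) ^ K) := by gcongr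
        _ = ((1 - p) * (1 - p)⁻¹) ^ 3 * ((Real.exp 1 * (n * p)) ^ 2 * (1 - p) ^ K) := by ring
        _ = _ := by rw [mul_inv_cancel₀ hq.ne', one_pow, one_mul]
    have h2 : (997 / 1000 : ℝ) ≤ (1 - p) ^ 3 := by
      have := one_add_mul_le_pow (a := -p) (by linarith) 3
      push_cast at this
      rw [← sub_eq_add_neg] at this
      linarith
    have h3 : Real.exp 1 ^ 2 ≤ 7.3891 := by
      have := Real.exp_one_lt_d9
      have := Real.exp_pos 1
      nlinarith
    calc (997 / 1000 : ℝ) ≤ Real.exp 1 ^ 2 * ((n * p) ^ 2 * (1 - p) ^ K) := by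
          rw [mul_pow] at h1; linarith
      _ ≤ 7.3891 * ((n * p) ^ 2 * (1 - p) ^ K) := by gcongr
      _ = _ := by ring
  have hterm : ∀ k ∈ Icc m (K + 1), meanMaximalTrees n p k ≤
      Real.exp ((s + 2) * (L + 5) - 1.05 * (s * L)) := by
    intro k hk
    obtain ⟨hmk, hkK⟩ := mem_Icc.1 hk
    refine (meanMaximalTrees_le_exp hp.le (by linarith) (by omega)).trans ?_
    have hks : ((K + 1 - k : ℕ) : ℝ) ≤ s + 2 := by
      rw [Nat.cast_sub hkK]
      have : (m : ℝ) ≤ k := by exact_mod_cast hmk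
      push_cast; linarith
    have hμ : meanTrees n p k ≤ Real.exp ((s + 2) * (L + 5)) := by
      have h1 := meanTrees_threshold_sub_le hp hp2' hx (i := K + 1 - k) (by omega)
      rw [← hK, show K + 1 - (K + 1 - k) = k by omega] at h1
      refine h1.trans ?_
      have h2 : 128 * ((n : ℝ) * p) ≤ Real.exp (L + 5) := by
        rw [Real.exp_add, Real.exp_log hx0, mul_comm]
        gcongr
        have h3 : Real.exp 5 = Real.exp 1 ^ 5 := by rw [← Real.exp_nat_mul]; norm_num
        rw [h3]
        have := Real.exp_one_gt_d9
        calc (128 : ℝ) ≤ 2.7 ^ 5 := by norm_num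
          _ ≤ _ := by gcongr; linarith
      calc (128 * ((n : ℝ) * p)) ^ (K + 1 - k) ≤ Real.exp (L + 5) ^ (K + 1 - k) := by gcongr
        _ = Real.exp ((K + 1 - k : ℕ) * (L + 5)) := by rw [← Real.exp_nat_mul]
        _ ≤ _ := by
            refine Real.exp_le_exp.2 (mul_le_mul_of_nonneg_right hks (by linarith))
    -- The main term is n · 2L/(e²(np)²) = (8/e²) sL, and 8/e² > 1.08. The factors 0.995, 1.99/2 and
    -- 0.997 lose little enough to keep 1.05.
    have hE : 1.05 * (s * L) ≤ (n - k : ℕ) * (k * (p * (1 - p) ^ (k - 1))) := by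
      have h1 : 995 / 1000 * (n : ℝ) ≤ (n - k : ℕ) := by
        have h3 := two_mul_succ_threshold_le hp hp2' hx
        rw [Nat.cast_sub (by omega)]
        have : (k : ℝ) ≤ K + 1 := by exact_mod_cast hkK
        linarith
      have h2 : 199 / 100 * L ≤ k * p := by
        have : (m : ℝ) ≤ k := by exact_mod_cast hmk
        refine hmp.trans (by gcongr)
      have h3 : 997 / 1000 / (7.3891 * (n * p) ^ 2) ≤ (1 - p) ^ (k - 1) :=
        hqK.trans (pow_le_pow_of_le_one hq.le (by linarith) (by omega))
      calc 1.05 * (s * L) ≤ (995 / 1000 * 199 / 100 * 997 / 1000 * 4 / 7.3891) * (s * L) := by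
            have : 0 ≤ s * L := by
              have : 0 ≤ L := by linarith
              positivity
            gcongr
            norm_num
        _ = 995 / 1000 * (n : ℝ) * (199 / 100 * L * (997 / 1000 / (7.3891 * (n * p) ^ 2))) := by
            rw [hs]; field_simp
        _ ≤ (n - k : ℕ) * (k * p * (1 - p) ^ (k - 1)) := by
            have : 0 ≤ L := by linarith
            gcongr
        _ = _ := by ring
    calc _ ≤ Real.exp ((s + 2) * (L + 5)) * Real.exp (-(1.05 * (s * L))) := by
          gcongr
      _ = _ := by rw [← Real.exp_add]; ring_nf
  have hsum := pr_le_maxInducedTree_le (V := Fin n) (p := p) hp.le (by linarith)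
    (m := m) (by omega)
  rw [Fintype.card_fin] at hsum
  refine hsum.trans ?_
  have hsplit : ∑ k ∈ Icc m n, meanMaximalTrees n p k ≤
      ∑ k ∈ Icc m (K + 1), meanMaximalTrees n p k +
        ∑ k ∈ Icc (K + 2) n, meanMaximalTrees n p k := by
    have hnn : ∀ k, 1 ≤ k → 0 ≤ meanMaximalTrees n p k := fun k hk =>
      mul_nonneg (meanTrees_nonneg hp.le (by linarith) n k)
        (pow_nonneg (by linarith [mul_pow_pred_le_one hp.le (by linarith) hk]) _)
    have hdisj : Disjoint (Icc m (K + 1)) (Icc (K + 2) n) := by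
      rw [disjoint_left]
      intro a ha hb
      rw [mem_Icc] at ha hb
      omega
    rw [← sum_union hdisj]
    refine sum_le_sum_of_subset_of_nonneg ?_ ?_
    · intro a ha
      rw [mem_union, mem_Icc, mem_Icc]
      rw [mem_Icc] at ha
      omega
    · intro a ha _
      rw [mem_union, mem_Icc, mem_Icc] at ha
      exact hnn a (by omega)
  refine hsplit.trans (add_le_add ?_ ?_)
  · refine (sum_le_card_nsmul _ _ _ hterm).trans ?_
    rw [nsmul_eq_mul, Nat.card_Icc]
    have hcard : ((K + 1 + 1 - m : ℕ) : ℝ) ≤ Real.exp (s + 2) := by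
      have h1 := Real.add_one_le_exp (s + 2)
      refine le_trans ?_ h1
      rcases Nat.lt_or_ge (K + 1 + 1) m with h | h
      · rw [Nat.sub_eq_zero_of_le h.le]
        push_cast; linarith
      · rw [Nat.cast_sub h]; push_cast; linarith
    calc _ ≤ Real.exp (s + 2) * Real.exp ((s + 2) * (L + 5) - 1.05 * (s * L)) := by gcongr
      _ = Real.exp (s + 2 + ((s + 2) * (L + 5) - 1.05 * (s * L))) := (Real.exp_add _ _).symm
      _ ≤ _ := by
          refine Real.exp_le_exp.2 ?_
          -- The gain 0.05·sL beats the remaining 7s + 2L + 12 because L ≥ 1000 and s ≥ 80.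
          nlinarith
  · refine (sum_le_sum fun k hk => meanMaximalTrees_le hp.le (by linarith) ?_).trans
      (sum_meanTrees_threshold_add_two_le hp hp2' hx n)
    have := mem_Icc.1 hk
    omega

end Bounds

end

/-! ### Asymptotics along p = p(n) -/

section

lemma Whp.of_tendsto {p : ℕ → I} {P : (n : ℕ) → SimpleGraph (Fin n) → Prop}
    (h : Tendsto (fun n => pr (p n : ℝ) (P n)) atTop (𝓝 1)) : Whp p P := by
  unfold Whp
  simp_rw [measure_eq_ofReal_pr]
  have := ENNReal.tendsto_ofReal h
  rwa [ENNReal.ofReal_one] at this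

section Asymptotics

variable {p : ℕ → ℝ}

lemma tendsto_mul_atTop (hp : ∀ n, 0 ≤ p n)
    (h : (fun n : ℕ => 1 / (n : ℝ)) =o[atTop] p) :
    Tendsto (fun n : ℕ => (n : ℝ) * p n) atTop atTop := by
  refine tendsto_atTop.2 fun M => ?_
  have hM : 0 < (max M 1)⁻¹ := by positivity
  filter_upwards [h.def hM, eventually_ge_atTop 1] with n hn hn1
  have hn0 : (0 : ℝ) < n := by exact_mod_cast hn1
  rw [Real.norm_of_nonneg (by positivity), Real.norm_of_nonneg (hp n), inv_mul_eq_div,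
    div_le_div_iff₀ hn0 (by positivity)] at hn
  linarith [le_max_left M 1]

lemma tendsto_mul_log_sq (h : p =o[atTop] (fun n : ℕ => 1 / Real.log n ^ 2)) :
    Tendsto (fun n : ℕ => p n * Real.log n ^ 2) atTop (𝓝 0) := by
  have := h.tendsto_div_nhds_zero
  simpa [div_eq_mul_inv] using this

/-- Squaring the hypothesis of (ii) gives the form that controls `fewNbrsError`. -/
lemma tendsto_log_cube_div (h : (fun n : ℕ => (n : ℝ) ^ (-(1 / 2) : ℝ) * Real.log n ^ (3 / 2 : ℝ))
    =o[atTop] p) : Tendsto (fun n : ℕ => Real.log n ^ 3 / (n * p n ^ 2)) atTop (𝓝 0) := by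
  have h1 := h.tendsto_div_nhds_zero.pow 2
  rw [zero_pow two_ne_zero] at h1
  refine h1.congr' ?_
  filter_upwards [eventually_ge_atTop 1] with n hn
  have hn0 : (0 : ℝ) < n := by exact_mod_cast hn
  have hl : 0 ≤ Real.log n := Real.log_nonneg (by exact_mod_cast hn)
  have e1 : ((n : ℝ) ^ (-(1 / 2) : ℝ)) ^ 2 = (n : ℝ)⁻¹ := by
    rw [← Real.rpow_mul_natCast hn0.le, ← Real.rpow_neg_one]; norm_num
  have e2 : (Real.log n ^ (3 / 2 : ℝ)) ^ 2 = Real.log n ^ 3 := by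
    rw [← Real.rpow_mul_natCast hl, ← Real.rpow_natCast]; norm_num
  rw [div_pow, mul_pow, e1, e2, inv_mul_eq_div, div_div]

lemma tendsto_mul_sq (h : p =o[atTop] (fun n : ℕ => (n : ℝ) ^ (-(1 / 2) : ℝ))) :
    Tendsto (fun n : ℕ => n * p n ^ 2) atTop (𝓝 0) := by
  have h1 := h.tendsto_div_nhds_zero.pow 2
  rw [zero_pow two_ne_zero] at h1
  refine h1.congr' ?_
  filter_upwards [eventually_ge_atTop 1] with n hn
  have hn0 : (0 : ℝ) < n := by exact_mod_cast hn
  have e1 : ((n : ℝ) ^ (-(1 / 2) : ℝ)) ^ 2 = (n : ℝ)⁻¹ := by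
    rw [← Real.rpow_mul_natCast hn0.le, ← Real.rpow_neg_one]; norm_num
  rw [div_pow, e1, div_inv_eq_mul, mul_comm]

lemma tendsto_of_mul_log_sq (hp : ∀ n, 0 ≤ p n)
    (h : Tendsto (fun n : ℕ => p n * Real.log n ^ 2) atTop (𝓝 0)) : Tendsto p atTop (𝓝 0) := by
  have hl : Tendsto (fun n : ℕ => Real.log n) atTop atTop :=
    Real.tendsto_log_atTop.comp tendsto_natCast_atTop_atTop
  refine squeeze_zero' (Eventually.of_forall hp) ?_ h
  filter_upwards [hl.eventually_ge_atTop 1] with n hn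
  exact le_mul_of_one_le_right (hp n) (one_le_pow₀ hn)

lemma tendsto_log_pow_mul_rpow (m : ℕ) {a : ℝ} (ha : 0 < a) :
    Tendsto (fun x : ℝ => Real.log x ^ m * x ^ (-a)) atTop (𝓝 0) := by
  have h := (isLittleO_log_rpow_rpow_atTop (m : ℝ) ha).tendsto_div_nhds_zero
  refine h.congr' ?_
  filter_upwards [eventually_gt_atTop 0] with x hx
  rw [Real.rpow_natCast, Real.rpow_neg hx.le, div_eq_mul_inv]

lemma eventually_regime (hp1 : ∀ n, p n ≤ 1)
    (hx : Tendsto (fun n : ℕ => (n : ℝ) * p n) atTop atTop) (hp0 : Tendsto p atTop (𝓝 0)) (M ε : ℝ) (hε : 0 < ε) :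
    ∀ᶠ n : ℕ in atTop, 0 < p n ∧ p n ≤ ε ∧ Real.exp 100 ≤ n * p n ∧ M ≤ Real.log (n * p n) ∧
      Real.log (n * p n) ≤ Real.log n := by
  filter_upwards [hx.eventually_ge_atTop (Real.exp 100), hp0.eventually_lt_const hε,
    (Real.tendsto_log_atTop.comp hx).eventually_ge_atTop M] with n h1 h2 h3
  have hx0 : 0 < (n : ℝ) * p n := lt_of_lt_of_le (Real.exp_pos _) h1
  refine ⟨pos_of_mul_pos_right hx0 (Nat.cast_nonneg n), h2.le, h1, h3,
    Real.log_le_log hx0 (mul_le_of_le_one_right (Nat.cast_nonneg n) (hp1 n))⟩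

lemma eventually_lowThreshold_mul_le (hp1 : ∀ n, p n ≤ 1)
    (hx : Tendsto (fun n : ℕ => (n : ℝ) * p n) atTop atTop) (hp0 : Tendsto p atTop (𝓝 0)) :
    ∀ᶠ n : ℕ in atTop, lowThreshold n (p n) * p n ≤ 3 * Real.log (n * p n) := by
  filter_upwards [eventually_regime hp1 hx hp0 100 (1 / 2) (by norm_num)]
    with n ⟨h1, h2, h3, h4, _⟩
  have h5 := threshold_mul_le h1 h2 h3
  have h6 : (lowThreshold n (p n) : ℝ) ≤ threshold n (p n) := by
    exact_mod_cast lowThreshold_le_threshold h3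
  nlinarith

lemma tendsto_lowThreshold_pow_mul_rpow (hp : ∀ n, 0 ≤ p n) (hp1 : ∀ n, p n ≤ 1)
    (hx : Tendsto (fun n : ℕ => (n : ℝ) * p n) atTop atTop) (hp0 : Tendsto p atTop (𝓝 0)) (m : ℕ) {a : ℝ} (ha : 0 < a) :
    Tendsto (fun n : ℕ => (lowThreshold n (p n) * p n) ^ m * ((n : ℝ) * p n) ^ (-a)) atTop (𝓝 0) := by
  have h := ((tendsto_log_pow_mul_rpow m ha).comp hx).const_mul ((3 : ℝ) ^ m)
  rw [mul_zero] at h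
  refine squeeze_zero' ?_ ?_ h
  · filter_upwards with n
    have := hp n
    positivity
  · filter_upwards [eventually_lowThreshold_mul_le hp1 hx hp0] with n h1
    have := hp n
    calc _ ≤ (3 * Real.log (n * p n)) ^ m * ((n : ℝ) * p n) ^ (-a) := by gcongr
      _ = _ := by simp only [Function.comp]; rw [mul_pow]; ring

lemma tendsto_lowThreshold_cube_div (hp : ∀ n, 0 ≤ p n) (hp1 : ∀ n, p n ≤ 1)
    (hx : Tendsto (fun n : ℕ => (n : ℝ) * p n) atTop atTop) (hp0 : Tendsto p atTop (𝓝 0))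
    (hd : Tendsto (fun n : ℕ => Real.log n ^ 3 / (n * p n ^ 2)) atTop (𝓝 0)) :
    Tendsto (fun n : ℕ => (lowThreshold n (p n) * p n) ^ 3 / (n * p n ^ 2)) atTop (𝓝 0) := by
  have h := hd.const_mul 27
  rw [mul_zero] at h
  refine squeeze_zero' ?_ ?_ h
  · filter_upwards with n
    have := hp n
    positivity
  · filter_upwards [eventually_lowThreshold_mul_le hp1 hx hp0,
      eventually_regime hp1 hx hp0 100 (1 / 2) (by norm_num)] with n h1 ⟨h2, _, _, _, h3⟩
    calc _ ≤ (3 * Real.log n) ^ 3 / (n * p n ^ 2) := by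
          have h4 := h1.trans (by linarith : 3 * Real.log (n * p n) ≤ 3 * Real.log n)
          gcongr
      _ = _ := by ring

lemma tendsto_fewNbrsError (hp : ∀ n, 0 ≤ p n) (hp1 : ∀ n, p n ≤ 1)
    (hx : Tendsto (fun n : ℕ => (n : ℝ) * p n) atTop atTop) (hp0 : Tendsto p atTop (𝓝 0)) (D : ℝ)
    (hd : Tendsto (fun n : ℕ => Real.log n ^ 3 / (n * p n ^ 2)) atTop (𝓝 0)) :
    Tendsto (fun n : ℕ => fewNbrsError D n (p n) (lowThreshold n (p n))) atTop (𝓝 0) := by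
  have h := (tendsto_lowThreshold_cube_div hp hp1 hx hp0 hd).const_mul (32 * D)
  rw [mul_zero] at h
  exact h

lemma eventually_nearThreshold (hp1 : ∀ n, p n ≤ 1)
    (hx : Tendsto (fun n : ℕ => (n : ℝ) * p n) atTop atTop) (hp0 : Tendsto p atTop (𝓝 0)) :
    ∀ᶠ n : ℕ in atTop, NearThreshold (8 * Real.exp 4) n (p n) (lowThreshold n (p n)) := by
  filter_upwards [eventually_regime hp1 hx hp0 (6144 ^ 2 + 10) (1 / 2) (by norm_num)]
    with n ⟨h1, h2, h3, h4, _⟩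
  exact nearThreshold_lowThreshold h1 h2 h3 h4

lemma tendsto_farError (hp : ∀ n, 0 ≤ p n) (hp1 : ∀ n, p n ≤ 1)
    (hx : Tendsto (fun n : ℕ => (n : ℝ) * p n) atTop atTop) (hp0 : Tendsto p atTop (𝓝 0)) {D : ℝ} (hD : 0 ≤ D)
    (hd : Tendsto (fun n : ℕ => Real.log n ^ 3 / (n * p n ^ 2)) atTop (𝓝 0)) :
    Tendsto (fun n : ℕ => farError D n (p n) (lowThreshold n (p n))) atTop (𝓝 0) := by
  have h1 := (tendsto_lowThreshold_cube_div hp hp1 hx hp0 hd).const_mul (Real.exp 9)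
  have h2 := (tendsto_lowThreshold_pow_mul_rpow hp hp1 hx hp0 2
    (by norm_num : (0 : ℝ) < 1 / 32)).const_mul (Real.exp 8 * D)
  have h3 := h1.add h2
  rw [mul_zero, mul_zero, add_zero] at h3
  refine squeeze_zero' ?_ ?_ h3
  · filter_upwards with n
    have := hp n
    unfold farError
    positivity
  · filter_upwards [eventually_nearThreshold hp1 hx hp0] with n hn
    have hp0 := hn.pos
    have hlam : 1 ≤ lowThreshold n (p n) * p n := le_trans (by norm_num) hn.le_mul
    have hn0 : (0 : ℝ) < n :=
      pos_of_mul_pos_left (lt_of_lt_of_le one_pos hn.one_le_mul) hp0.le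
    unfold farError
    rw [mul_assoc (Real.exp 8 * D)]
    rw [mul_div_assoc]
    refine add_le_add (mul_le_mul_of_nonneg_left ?_ (by positivity)) le_rfl
    -- An extra factor kp ≥ 1 reduces this term to the limit already known for (kp)³/(np²).
    calc (lowThreshold n (p n) : ℝ) ^ 2 / n = (lowThreshold n (p n) * p n) ^ 2 / (n * p n ^ 2) := by
          field_simp
      _ ≤ _ := by
          gcongr
          norm_num

lemma tendsto_nearError (hp : ∀ n, 0 ≤ p n) (hp1 : ∀ n, p n ≤ 1)
    (hx : Tendsto (fun n : ℕ => (n : ℝ) * p n) atTop atTop) (hp0 : Tendsto p atTop (𝓝 0)) {D : ℝ} (hD : 0 ≤ D)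
    (hpl : Tendsto (fun n : ℕ => p n * Real.log n ^ 2) atTop (𝓝 0))
    (hd : Tendsto (fun n : ℕ => Real.log n ^ 3 / (n * p n ^ 2)) atTop (𝓝 0)) :
    Tendsto (fun n : ℕ => nearError D n (p n) (lowThreshold n (p n))) atTop (𝓝 0) := by
  have h1 := (tendsto_lowThreshold_cube_div hp hp1 hx hp0 hd).const_mul (Real.exp 21 * D)
  have h2 := (tendsto_lowThreshold_pow_mul_rpow hp hp1 hx hp0 4
    (by norm_num : (0 : ℝ) < 5 / 8)).const_mul (Real.exp 2 * D ^ 2)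
  have h3 := h1.add h2
  rw [mul_zero, mul_zero, add_zero] at h3
  refine squeeze_zero' ?_ ?_ h3
  · filter_upwards with n
    have := hp n
    unfold nearError
    positivity
  · filter_upwards [eventually_nearThreshold hp1 hx hp0,
      eventually_lowThreshold_mul_le hp1 hx hp0,
      eventually_regime hp1 hx hp0 100 (1 / 2) (by norm_num),
      hpl.eventually_lt_const (by norm_num : (0 : ℝ) < 1 / 3)] with n hn hle ⟨_, _, _, h4, h5⟩ h6
    have hp0 := hn.pos
    have hn0 : (0 : ℝ) < n :=
      pos_of_mul_pos_left (lt_of_lt_of_le one_pos hn.one_le_mul) hp0.le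
    unfold nearError
    rw [mul_assoc (Real.exp 2 * D ^ 2)]
    refine add_le_add (mul_le_mul_of_nonneg_left ?_ (by positivity)) le_rfl
    set k := lowThreshold n (p n)
    -- kp² ≤ 3p log n, and p log² n tends to 0. Hence k^(7/2)p²/n is at most (kp)³/(np²).
    have hs : √(k : ℝ) * p n ≤ 1 := by
      refine le_of_sq_le_sq ?_ (by norm_num)
      rw [mul_pow, Real.sq_sqrt (by positivity)]
      have : Real.log n ≤ Real.log n ^ 2 := by nlinarith
      nlinarith
    calc (k : ℝ) ^ 3 * √k * p n ^ 2 / n = (k * p n) ^ 3 / (n * p n ^ 2) * (√k * p n) := by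
          field_simp
      _ ≤ (k * p n) ^ 3 / (n * p n ^ 2) * 1 := by gcongr
      _ = _ := mul_one _

lemma tendsto_inv_meanTrees_lowThreshold (hp1 : ∀ n, p n ≤ 1)
    (hx : Tendsto (fun n : ℕ => (n : ℝ) * p n) atTop atTop) (hp0 : Tendsto p atTop (𝓝 0)) :
    Tendsto (fun n : ℕ => (meanTrees n (p n) (lowThreshold n (p n)))⁻¹) atTop (𝓝 0) := by
  refine Tendsto.inv_tendsto_atTop ?_
  have h1 : Tendsto (fun n : ℕ => √((n : ℝ) * p n) / (8 * Real.exp 5)) atTop atTop :=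
    (Real.tendsto_sqrt_atTop.comp hx).atTop_div_const (by positivity)
  refine tendsto_atTop_mono' _ ?_ h1
  filter_upwards [eventually_regime hp1 hx hp0 100 (1 / 2) (by norm_num)]
    with n ⟨h2, h3, h4, _, _⟩
  exact sqrt_le_meanTrees_lowThreshold h2 h3 h4

theorem tendsto_pr_lowThreshold (hp : ∀ n, 0 ≤ p n) (hp1 : ∀ n, p n ≤ 1)
    (hx : Tendsto (fun n : ℕ => (n : ℝ) * p n) atTop atTop) (hp0 : Tendsto p atTop (𝓝 0))
    (hpl : Tendsto (fun n : ℕ => p n * Real.log n ^ 2) atTop (𝓝 0))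
    (hd : Tendsto (fun n : ℕ => Real.log n ^ 3 / (n * p n ^ 2)) atTop (𝓝 0)) :
    Tendsto (fun n : ℕ => pr (p n) (fun G : SimpleGraph (Fin n) =>
      maxInducedTree G = lowThreshold n (p n) ∨ maxInducedTree G = lowThreshold n (p n) + 1))
      atTop (𝓝 1) := by
  set D : ℝ := 8 * Real.exp 4 with hD
  have hD0 : 0 ≤ D := by positivity
  have hf := tendsto_farError hp hp1 hx hp0 hD0 hd
  have hn := tendsto_nearError hp hp1 hx hp0 hD0 hpl hd
  have hδ := tendsto_fewNbrsError hp hp1 hx hp0 D hd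
  have hμ := tendsto_inv_meanTrees_lowThreshold hp1 hx hp0
  have hxi : Tendsto (fun n : ℕ => 4 * Real.exp 5 / ((n : ℝ) * p n) + 2 * (√((n : ℝ) * p n))⁻¹)
      atTop (𝓝 (0 + 2 * 0)) :=
    (hx.const_div_atTop _).add ((Real.tendsto_sqrt_atTop.comp hx).inv_tendsto_atTop.const_mul 2)
  have hlow := (((tendsto_const_nhds (x := (1 : ℝ))).sub hδ).pow 2).div
    ((tendsto_const_nhds (x := (1 : ℝ))).add ((hf.const_mul 2).add (hμ.const_mul 2))) (by norm_num)
  have hlow2 := hlow.sub hxi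
  rw [show ((1 : ℝ) - 0) ^ 2 / (1 + (2 * 0 + 2 * 0)) - (0 + 2 * 0) = 1 by norm_num] at hlow2
  refine tendsto_of_tendsto_of_tendsto_of_le_of_le' hlow2 tendsto_const_nhds ?_ ?_
  · filter_upwards [eventually_nearThreshold hp1 hx hp0,
      eventually_regime hp1 hx hp0 100 (1 / 2) (by norm_num),
      hf.eventually_lt_const (by norm_num : (0 : ℝ) < 1 / 2),
      hn.eventually_lt_const (by norm_num : (0 : ℝ) < 1 / 2),
      hδ.eventually_lt_const one_pos] with n h1 ⟨h2, h3, h4, _, _⟩ h5 h6 h7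
    have hx0 : 0 < (n : ℝ) * p n := lt_of_lt_of_le (Real.exp_pos _) h4
    have hμ0 : 0 < meanTrees n (p n) (lowThreshold n (p n)) :=
      lt_of_lt_of_le (by positivity) (sqrt_le_meanTrees_lowThreshold h2 h3 h4)
    have e1 := h1.le_pr h5.le h6.le h7.le hμ0
    have e2 := pr_lowThreshold_add_two_le h2 h3 h4
    have e3 := le_pr_lowThreshold (n := n) (k := lowThreshold n (p n)) (hp n) (hp1 n)
    rw [Pi.div_apply]
    linarith
  · exact Eventually.of_forall fun n => pr_le_one (hp n) (hp1 n) _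

theorem tendsto_pr_lt_lowThreshold (hp : ∀ n, 0 ≤ p n) (hp1 : ∀ n, p n ≤ 1)
    (hx : Tendsto (fun n : ℕ => (n : ℝ) * p n) atTop atTop) (hp0 : Tendsto p atTop (𝓝 0)) (hs : Tendsto (fun n : ℕ => n * p n ^ 2) atTop (𝓝 0)) :
    Tendsto (fun n : ℕ => pr (p n) (fun G : SimpleGraph (Fin n) =>
      (maxInducedTree G : ℝ) < (lowThreshold n (p n) : ℝ) - 1 / (4 * n * p n ^ 2)))
      atTop (𝓝 1) := by
  have hs4 : Tendsto (fun n : ℕ => 1 / (4 * (n : ℝ) * p n ^ 2)) atTop atTop := by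
    have h1 : Tendsto (fun n : ℕ => 4 * ((n : ℝ) * p n ^ 2)) atTop (𝓝[>] 0) := by
      refine tendsto_nhdsWithin_iff.2 ⟨by simpa using hs.const_mul 4, ?_⟩
      filter_upwards [eventually_regime hp1 hx hp0 100 (1 / 2) (by norm_num)]
        with n ⟨h2, _, h4, _, _⟩
      have hx0 : 0 < (n : ℝ) * p n := lt_of_lt_of_le (Real.exp_pos _) h4
      have : 0 < 4 * ((n : ℝ) * p n * p n) := by positivity
      rw [Set.mem_Ioi]
      calc 0 < _ := this
        _ = _ := by ring
    refine h1.inv_tendsto_nhdsGT_zero.congr fun n => ?_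
    simp only [Pi.inv_apply]
    rw [one_div, mul_assoc]
  have hexp : Tendsto (fun n : ℕ => 1 - (Real.exp (-(1 / (4 * (n : ℝ) * p n ^ 2))) +
      4 * Real.exp 5 / (n * p n))) atTop (𝓝 (1 - (0 + 0))) :=
    tendsto_const_nhds.sub ((Real.tendsto_exp_neg_atTop_nhds_zero.comp hs4).add
      (hx.const_div_atTop _))
  rw [show (1 : ℝ) - (0 + 0) = 1 by norm_num] at hexp
  refine tendsto_of_tendsto_of_tendsto_of_le_of_le' hexp tendsto_const_nhds ?_
    (Eventually.of_forall fun n => pr_le_one (hp n) (hp1 n) _)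
  filter_upwards [eventually_regime hp1 hx hp0 1000 (1 / 1000) (by norm_num),
    hs4.eventually_ge_atTop 80] with n ⟨h2, h3, h4, h5, _⟩ h6
  set s : ℝ := 1 / (4 * (n : ℝ) * p n ^ 2) with hsdef
  -- T ≥ k₀ - s forces T ≥ m, and m ≥ K - 1 - s because k₀ ≥ K - 1.
  set m : ℕ := ⌈(lowThreshold n (p n) : ℝ) - s⌉₊ with hm
  have hK : (threshold n (p n) : ℝ) ≤ lowThreshold n (p n) + 1 := by
    exact_mod_cast threshold_le_lowThreshold_add_one h4
  have hmle : (lowThreshold n (p n) : ℝ) - s ≤ m := Nat.le_ceil _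
  have h7 := pr_le_of_sparse h2 h3 h5 hsdef h6 (m := m) (by linarith)
  have h8 := pr_and_add_pr_and_not (p := p n) (fun _ : SimpleGraph (Fin n) => True)
    (fun G => (maxInducedTree G : ℝ) < (lowThreshold n (p n) : ℝ) - s)
  simp only [true_and] at h8
  rw [pr_true] at h8
  have h9 : pr (p n) (fun G : SimpleGraph (Fin n) =>
      ¬ (maxInducedTree G : ℝ) < (lowThreshold n (p n) : ℝ) - s) ≤
      pr (p n) (fun G : SimpleGraph (Fin n) => m ≤ maxInducedTree G) :=
    pr_mono (hp n) (hp1 n) fun G hG => Nat.ceil_le.2 (not_lt.1 hG)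
  linarith

end Asymptotics

end

end

end InducedTree

theorem theorem1 :
    ∃ k₀ : ℕ → I → ℤ, ∀ p : ℕ → I,
      (fun n : ℕ => 1 / (n : ℝ)) =o[atTop] (fun n => (p n : ℝ)) →
      (fun n => (p n : ℝ)) =o[atTop] (fun n : ℕ => 1 / Real.log n ^ 2) →
      (∀ᶠ n : ℕ in atTop, ∃ K : ℕ,
          IsGreatest {k : ℕ | 1 ≤ InducedTree.expectedCount n (p n) k} K ∧
          ((K : ℤ) = k₀ n (p n) ∨ (K : ℤ) = k₀ n (p n) + 1)) ∧
      ((fun n : ℕ => (n : ℝ) ^ (-(1 / 2) : ℝ) * Real.log n ^ (3 / 2 : ℝ))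
            =o[atTop] (fun n => (p n : ℝ)) →
        InducedTree.Whp p fun n G =>
          (InducedTree.maxInducedTree G : ℤ) = k₀ n (p n) ∨
          (InducedTree.maxInducedTree G : ℤ) = k₀ n (p n) + 1) ∧
      ((fun n => (p n : ℝ)) =o[atTop] (fun n : ℕ => (n : ℝ) ^ (-(1 / 2) : ℝ)) →
        InducedTree.Whp p fun n G =>
          (InducedTree.maxInducedTree G : ℝ) <
            (k₀ n (p n) : ℝ) - 1 / (4 * (n : ℝ) * (p n : ℝ) ^ 2)) := by
  refine ⟨fun n p => (InducedTree.lowThreshold n p : ℤ), fun p h1 h2 => ?_⟩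
  have hp : ∀ n, 0 ≤ (p n : ℝ) := fun n => (p n).2.1
  have hp1 : ∀ n, (p n : ℝ) ≤ 1 := fun n => (p n).2.2
  have hx := InducedTree.tendsto_mul_atTop hp h1
  have hpl := InducedTree.tendsto_mul_log_sq h2
  have hp0 := InducedTree.tendsto_of_mul_log_sq hp hpl
  refine ⟨?_, fun h3 => ?_, fun h3 => ?_⟩
  · filter_upwards [Filter.eventually_ge_atTop 1] with n hn
    refine ⟨InducedTree.threshold n (p n), InducedTree.isGreatest_threshold (p n) hn, ?_⟩
    exact_mod_cast InducedTree.lowThreshold_eq_or (p := (p n : ℝ)) hn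
  · refine InducedTree.Whp.of_tendsto ?_
    have h := InducedTree.tendsto_pr_lowThreshold hp hp1 hx hp0 hpl
      (InducedTree.tendsto_log_cube_div h3)
    refine h.congr fun n => congrArg (InducedTree.pr (p n : ℝ)) (funext fun G => propext ?_)
    dsimp only
    omega
  · refine InducedTree.Whp.of_tendsto ?_
    have h := InducedTree.tendsto_pr_lt_lowThreshold hp hp1 hx hp0 (InducedTree.tendsto_mul_sq h3)
    refine h.congr fun n => congrArg (InducedTree.pr (p n : ℝ)) (funext fun G => propext ?_)
    rw [Int.cast_natCast]
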